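/- Let $G$ be a finite simple graph on $n$ vertices and let $\sigma$ be an orientation of $G$ (each edge gets exactly one direction). The skew-adjacency matrix $S=S(G^\sigma)$ is the $n\times n$ matrix with $s_{uv}=1$ if $(u,v)$ is an arc, $s_{uv}=-1$ if $(v,u)$ is an arc, and $s_{uv}=0$ otherwise. The skew energy $\varepsilon_s(G^\sigma)$ is the sum of the singular values of $S$, and $G^\sigma$ is said to have optimum skew energy if $\varepsilon_s(G^\sigma)=n\sqrt{\Delta}$, where $\Delta$ is the maximum degree of $G$. Theorem. Suppose that $G$ is connected, 5-regular and triangle-free, and that $G^\sigma$ has optimum skew energy. Then $G$ is isomorphic to one of the following graphs. (1) For some $t\ge 2$, the graph on $6t$ vertices consisting of layers $L_0,\dots,L_{2t-1}$ (indices modulo $2t$), each an independent set of three vertices, in which $L_i$ and $L_{i+1}$ are joined by $K_{3,3}$ minus a perfect matching if $i$ is even and by $K_{3,3}$ if $i$ is odd (there are no other edges). (2) For some $m\ge 4$, the Cartesian product $P_2\square U_m$, where $U_m$ is the graph with vertices $(i,b)$, $i\in\mathbb Z/m$, $b\in\{0,1\}$, and with $(i,b)$ adjacent to $(j,c)$ if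 and only if $j-i=\pm1$. (3) For some $k\ge 4$, the graph on $4k$ vertices obtained from $U_{2k}$ by adding the edges between $(i,b)$ and $(i+k,b)$ for all $i\in\mathbb Z/2k$ and $b\in\{0,1\}$. (4) The folded 5-cube: its vertices are the 16 binary words of length 4, two words being adjacent if and only if they differ in exactly one position or in all four positions. (5) The graph $P_2\square H$, where $H$ is the non-incidence graph of the Fano plane (the bipartite graph between the 7 points and the 7 lines in which a point is adjacent to the lines that do not contain it). (6) The 5-dimensional hypercube $Q_5$. (7) The bipartite double $K_2\times I$ of the icosahedron graph $I$: two copies of the vertex set of $I$, with $u$ in one copy adjacent to $v$ in the other copy if and only if $uv$ is an edge of $I$. -/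

import Mathlib

namespace SkewEnergy

/-- An orientation of a simple graph `G`: each edge `uv` receives exactly one of the two
directions `(u, v)`, `(v, u)`; `arc u v` says that `(u, v)` is an arc, with tail `u` and head `v`. -/
structure GraphOrientation {V : Type*} (G : SimpleGraph V) where
  arc : V → V → Prop
  adj_iff : ∀ u v, G.Adj u v ↔ arc u v ∨ arc v u
  asymm : ∀ u v, arc u v → ¬ arc v u

open Classical in
/-- The skew-adjacency matrix of an oriented graph. -/
noncomputable def skewAdjMatrix {V : Type*} {G : SimpleGraph V} (σ : GraphOrientation G) :
    Matrix V V ℝ :=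
  Matrix.of fun u v => if σ.arc u v then 1 else if σ.arc v u then -1 else 0

/-- The skew energy of an oriented graph on `n` vertices: the sum of the `n` singular values of its
skew-adjacency matrix. -/
noncomputable def skewEnergy {V : Type*} [Fintype V] [DecidableEq V] {G : SimpleGraph V}
    (σ : GraphOrientation G) : ℝ :=
  ∑ i ∈ Finset.range (Fintype.card V),
    (Matrix.toEuclideanLin (skewAdjMatrix σ)).singularValues i

/-- The oriented graph has optimum skew energy: its skew energy is `n √Δ`, where `n` is the number
of vertices and `Δ` the maximum degree. -/
def HasOptimumSkewEnergy {V : Type*} [Fintype V] [DecidableEq V] {G : SimpleGraph V}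
    [DecidableRel G.Adj] (σ : GraphOrientation G) : Prop :=
  skewEnergy σ = (Fintype.card V : ℝ) * √(G.maxDegree : ℝ)

/-- The prism `P₂ □ H`. -/
def prism {W : Type*} (H : SimpleGraph W) : SimpleGraph (Fin 2 × W) :=
  SimpleGraph.boxProd (SimpleGraph.pathGraph 2) H

/-- `U_m`, `m ≥ 3`: two copies of the cycle `C_m` in which, in addition, each vertex is joined to
the two neighbours of its counterpart in the other copy. -/
def doubledCycle (m : ℕ) : SimpleGraph (Fin m × Bool) :=
  (SimpleGraph.cycleGraph m).comap Prod.fst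

/-- `U_{2k}` together with the perfect matching that joins each vertex to the antipodal vertex of
the same copy of the cycle `C_{2k}`. -/
def antipodalDoubledCycle (k : ℕ) : SimpleGraph (Fin (2 * k) × Bool) :=
  doubledCycle (2 * k) ⊔
    SimpleGraph.fromRel fun x y => (y.1 : ℕ) = (x.1 : ℕ) + k ∧ x.2 = y.2

/-- A cyclic arrangement of `2t` layers of three independent vertices each, in which two consecutive
layers are joined, alternately, by `K_{3,3}` minus a perfect matching (from an even layer to the
next one) and by `K_{3,3}` (from an odd layer to the next one). Used for `t ≥ 2`. -/
def tripleRing (t : ℕ) : SimpleGraph (Fin (2 * t) × Fin 3) :=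
  SimpleGraph.fromRel fun x y =>
    (y.1 : ℕ) = ((x.1 : ℕ) + 1) % (2 * t) ∧ (Even (x.1 : ℕ) → x.2 ≠ y.2)

/-- The folded 5-cube (the 5-regular Clebsch graph), on 16 vertices. -/
def foldedFiveCube : SimpleGraph (Fin 4 → Bool) :=
  SimpleGraph.fromRel fun x y => hammingDist x y = 1 ∨ hammingDist x y = 4

/-- The 5-dimensional hypercube, on 32 vertices. -/
def fiveCube : SimpleGraph (Fin 5 → Bool) :=
  SimpleGraph.fromRel fun x y => hammingDist x y = 1

/-- The non-incidence graph of the Fano plane (the bipartite complement of the Heawood graph):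
points `(i, false)`, lines `(j, true)`, the point `i` lying on the line `j` iff
`j - i ∈ {1, 2, 4}` modulo 7. It is 4-regular on 14 vertices. -/
def fanoNonincidence : SimpleGraph (ZMod 7 × Bool) :=
  SimpleGraph.fromRel fun x y =>
    x.2 = false ∧ y.2 = true ∧ y.1 - x.1 ∉ ({1, 2, 4} : Finset (ZMod 7))

/-- The icosahedron: two poles `(none, false)`, `(none, true)`, each joined to all the vertices of
its pentagon `(some i, false)`, respectively `(some i, true)`, with `i` modulo 5, and
`(some i, false)` joined to `(some i, true)` and to `(some (i + 1), true)`. -/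
def icosahedron : SimpleGraph (Option (ZMod 5) × Bool) :=
  SimpleGraph.fromRel fun x y =>
    (x.1 = none ∧ y.1 ≠ none ∧ x.2 = y.2) ∨
    (∃ i : ZMod 5, x.1 = some i ∧ y.1 = some (i + 1) ∧ x.2 = y.2) ∨
    (∃ i : ZMod 5, x = (some i, false) ∧ (y = (some i, true) ∨ y = (some (i + 1), true)))

/-- The bipartite double `K₂ × H` of `H`: two copies of the vertex set, with `u` in one copy joined
to `v` in the other copy whenever `u` and `v` are adjacent in `H`. -/
def bipartiteDouble {W : Type*} (H : SimpleGraph W) : SimpleGraph (W × Bool) where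
  Adj x y := H.Adj x.1 y.1 ∧ x.2 ≠ y.2
  symm := ⟨fun _ _ h => ⟨h.1.symm, h.2.symm⟩⟩
  loopless := ⟨fun _ h => h.2 rfl⟩

end SkewEnergy

set_option linter.unusedSectionVars false

namespace SkewEnergy

/-! ### From optimum energy to orthogonal rows -/

open Finset Matrix

/-! The squares of the singular values of `S` add up to the trace `5n` of `SᵀS`, so optimum energy
is the equality case of Cauchy–Schwarz: all singular values equal `√5`, and `SᵀS = 5I`. Hence
distinct rows of `S` are orthogonal (`exists_isOrthogonalSigning`). The common neighbours of two
vertices contribute terms `±1` with sum zero, so there are 0, 2 or 4 of them (`card_common`);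
vertices with 4 are called mates. Throughout, vertices are treated as rows or as columns of an
incidence table, although `G` need not be bipartite. Three regimes arise.

If some vertex has two mates, signs and parities fill in the whole table around it, and `G` is
`K_{6,6}` minus a perfect matching (the ring with `t = 2`) or the prism over `K_{4,4}`
(`nonempty_iso_of_two_mates`).

If mates exist and are unique, every vertex `x` has a mate `μ x`. It is joined to both members of
two mate classes, and to one further vertex `ν x` (`exists_mateStructure`). The classes form cycles,
and `ν` is an involution respecting them. Either `ν` carries a cycle to a disjoint one, which gives
a prism, or it preserves the cycle; then it cannot reflect it, so it is the half-turn and gives the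
antipodal family (`MateStructure.classification`).

If there are no mates, two vertices have 0 or 2 common neighbours, and each quadrangle has sign
product `-1`. Fix `v` with neighbours `a 0, …, a 4`. Vertices at distance two from `v` correspond to
pairs of indices. A further vertex `c` draws on the five indices the pairs whose vertices it is
adjacent to; every index lies on none or two of these pairs, so a nonempty drawing is a cycle of
length 3, 4 or 5. The signs enter through one rule: two columns through the same two disjoint pairs
cannot traverse them in the same relative direction (`IsStar.not_dir_dir`). Consequently a pentagon
brings along a pentagram and five 4-cycles, and yields the double of the icosahedron. A 4-cycle
without pentagons brings along the other 4-cycles on its indices and six triangles, and yields the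
Fano prism. Triangles alone yield the 5-cube or its antipodal quotient
(`SignedRectagraph.classification`).

In each of these finite configurations the table maps to `G`. A row and a column at distance at most
3 cannot coincide, since this would create a triangle; only antipodes of the 5-cube escape this
argument. Regularity and connectedness then make an injective map an isomorphism. -/

lemma transpose_mul_self_eq_of_sum_singularValues {V : Type*} [Fintype V] [DecidableEq V]
    (A : Matrix V V ℝ) (d : ℝ) (hd : 0 ≤ d) (htr : (Aᵀ * A).trace = Fintype.card V * d)
    (hsum : ∑ i ∈ range (Fintype.card V), (toEuclideanLin A).singularValues i =
      Fintype.card V * √d) :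
    Aᵀ * A = d • (1 : Matrix V V ℝ) := by
  set T := toEuclideanLin A with hT
  have hn : Module.finrank ℝ (EuclideanSpace ℝ V) = Fintype.card V := finrank_euclideanSpace
  have hP : LinearMap.adjoint T ∘ₗ T = toEuclideanLin (Aᵀ * A) := by
    rw [hT, ← toEuclideanLin_conjTranspose_eq_adjoint, conjTranspose_eq_transpose_of_trivial]
    ext x : 1
    simp [toLpLin_apply, mulVec_mulVec]
  have hsym := T.isSymmetric_adjoint_comp_self
  have htrace : ∑ i, hsym.eigenvalues hn i = Fintype.card V * d := by
    have h : LinearMap.trace ℝ _ (LinearMap.adjoint T ∘ₗ T) = Fintype.card V * d := by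
      rw [hP, toEuclideanLin_eq_toLin_orthonormal, Matrix.trace_toLin_eq, htr]
    rw [hsym.trace_eq_sum_eigenvalues hn] at h
    exact_mod_cast h
  have hsv : ∑ i : Fin (Fintype.card V), T.singularValues i = Fintype.card V * √d := by
    rw [← hsum, Finset.sum_range]
  -- The equality case of Cauchy–Schwarz, as a vanishing variance: the sum expands to `nd - 2√d ·
  -- n√d + nd`.
  have hzero : ∑ i : Fin (Fintype.card V), (T.singularValues i - √d) ^ 2 = 0 := by
    have : ∀ i : Fin (Fintype.card V), (T.singularValues i - √d) ^ 2 =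
        hsym.eigenvalues hn i - 2 * √d * T.singularValues i + d := by
      intro i
      rw [← T.sq_singularValues_fin hn i, sub_sq, Real.sq_sqrt hd]
      ring
    rw [sum_congr rfl fun i _ => this i, sum_add_distrib, sum_sub_distrib, ← mul_sum, htrace, hsv,
      sum_const, card_univ, Fintype.card_fin, nsmul_eq_mul]
    linear_combination (-2 * (Fintype.card V : ℝ)) * Real.mul_self_sqrt hd
  have hev : ∀ i, hsym.eigenvalues hn i = d := by
    intro i
    have h := (sum_eq_zero_iff_of_nonneg fun i _ => sq_nonneg _).1 hzero i (mem_univ i)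
    rw [← T.sq_singularValues_fin hn i, sub_eq_zero.1 (pow_eq_zero_iff (two_ne_zero) |>.1 h),
      Real.sq_sqrt hd]
  have hlin : toEuclideanLin (Aᵀ * A) = toEuclideanLin (d • (1 : Matrix V V ℝ)) := by
    rw [← hP]
    refine (hsym.eigenvectorBasis hn).toBasis.ext fun i => ?_
    have := hsym.apply_eigenvectorBasis hn i
    rw [OrthonormalBasis.coe_toBasis, this, hev i, map_smul, LinearMap.smul_apply]
    simp
  exact toEuclideanLin.injective hlin

/-- An integral skew weighting of a graph, with entries `±1` on the edges and mutually orthogonal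
rows. -/
structure IsOrthogonalSigning {V : Type*} [Fintype V] (G : SimpleGraph V) (s : V → V → ℤ) :
    Prop where
  adj_iff : ∀ u x, G.Adj u x ↔ s u x = 1 ∨ s u x = -1
  zero_of_not_adj : ∀ u x, ¬ G.Adj u x → s u x = 0
  skew : ∀ u x, s x u = - s u x
  orthogonal : ∀ u w, u ≠ w → ∑ x, s u x * s w x = 0

-- Regularity makes the diagonal of `SᵀS` constant, which supplies the trace needed for the equality
-- case. Passing to integer entries makes parity and `omega` available later.
open Classical in
lemma exists_isOrthogonalSigning {V : Type*} [Fintype V] [DecidableEq V] (G : SimpleGraph V)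
    [DecidableRel G.Adj] (σ : GraphOrientation G) [Nonempty V] (d : ℕ)
    (hreg : G.IsRegularOfDegree d) (hopt : HasOptimumSkewEnergy σ) :
    ∃ s, IsOrthogonalSigning G s := by
  set s : V → V → ℤ := fun u v => if σ.arc u v then 1 else if σ.arc v u then -1 else 0 with hs
  have hadj : ∀ u x, G.Adj u x ↔ s u x = 1 ∨ s u x = -1 := by
    intro u x
    rw [σ.adj_iff, hs]
    dsimp only
    split_ifs <;> simp_all
  have hna : ∀ u x, ¬ G.Adj u x → s u x = 0 := by
    intro u x h
    rw [σ.adj_iff] at h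
    simp_all
  have hskew : ∀ u x, s x u = - s u x := by
    intro u x
    have := σ.asymm u x
    simp only [hs]
    split_ifs <;> simp_all
  have hA : ∀ u x, skewAdjMatrix σ u x = s u x := by
    intro u x
    simp only [skewAdjMatrix, hs, of_apply]
    split_ifs <;> simp
  have hmax : G.maxDegree = d := hreg.maxDegree_eq
  have hcol : ∀ x, ∑ u, s u x * s u x = d := by
    intro x
    rw [← hreg x, SimpleGraph.degree, card_eq_sum_ones, SimpleGraph.neighborFinset_eq_filter,
      sum_filter]
    push_cast
    refine sum_congr rfl fun u _ => ?_
    split_ifs with h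
    · rcases (hadj u x).1 h.symm with h | h <;> simp [h]
    · simp [hna u x fun h' => h h'.symm]
  have hmul : (skewAdjMatrix σ)ᵀ * skewAdjMatrix σ = (d : ℝ) • (1 : Matrix V V ℝ) := by
    refine transpose_mul_self_eq_of_sum_singularValues _ _ (Nat.cast_nonneg d) ?_ ?_
    · have : ∀ x, ∑ u, (s u x : ℝ) * s u x = d := fun x => by exact_mod_cast hcol x
      simp [trace, mul_apply, hA, this]
    · rw [HasOptimumSkewEnergy, hmax] at hopt
      exact hopt
  refine ⟨s, hadj, hna, hskew, fun u w huw => ?_⟩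
  have h := congrFun (congrFun hmul u) w
  simp only [mul_apply, transpose_apply, hA, Matrix.smul_apply, one_apply_ne huw, smul_zero] at h
  have h' : ∑ x, s x u * s x w = 0 := by exact_mod_cast h
  rw [← h']
  -- `SᵀS` gives orthogonality of columns; skewness turns columns into rows at the cost of two
  -- cancelling signs.
  refine sum_congr rfl fun x _ => ?_
  rw [hskew u x, hskew w x]
  ring

/-! ### Recognising a graph from a locally complete copy -/

section Isomorphism

variable {V W : Type*} [Fintype V] [DecidableEq V] {G : SimpleGraph V} [DecidableRel G.Adj]

/-- An injective homomorphism to a connected graph which is locally surjective is an isomorphism. -/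
lemma nonempty_iso_of_locally_surjective [Nonempty W] {H : SimpleGraph W} (hconn : G.Connected)
    (f : W → V) (hf : Function.Injective f) (hadj : ∀ x y, H.Adj x y → G.Adj (f x) (f y))
    (hnbr : ∀ x v, G.Adj (f x) v → ∃ y, H.Adj x y ∧ f y = v) : Nonempty (G ≃g H) := by
  -- The image is closed under taking neighbours, so connectedness makes it everything.
  have hsurj : Function.Surjective f := by
    obtain ⟨x₀⟩ := ‹Nonempty W›
    intro v
    have h := hconn.preconnected (f x₀) v
    rw [SimpleGraph.reachable_iff_reflTransGen] at h
    induction h with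
    | refl => exact ⟨x₀, rfl⟩
    | tail _ h ih =>
      obtain ⟨x, rfl⟩ := ih
      obtain ⟨y, _, rfl⟩ := hnbr _ _ h
      exact ⟨y, rfl⟩
  refine ⟨(RelIso.mk (Equiv.ofBijective f ⟨hf, hsurj⟩) ?_ : H ≃g G).symm⟩
  intro x y
  refine ⟨fun h => ?_, hadj x y⟩
  obtain ⟨z, hz, hzy⟩ := hnbr x (f y) h
  rwa [← hf hzy]

/-- An injective homomorphism from a nonempty graph with all degrees at least `5` to a connected
`5`-regular graph is an isomorphism. -/
lemma nonempty_iso_of_injective [Nonempty W] {H : SimpleGraph W} (hconn : G.Connected)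
    (hreg : G.IsRegularOfDegree 5) (f : W → V) (hf : Function.Injective f)
    (hadj : ∀ x y, H.Adj x y → G.Adj (f x) (f y))
    (hdeg : ∀ x, ∃ t : Finset W, t.card = 5 ∧ ∀ y ∈ t, H.Adj x y) : Nonempty (G ≃g H) := by
  refine nonempty_iso_of_locally_surjective hconn f hf hadj fun x v hv => ?_
  obtain ⟨t, htc, ht⟩ := hdeg x
  have heq : t.map ⟨f, hf⟩ = G.neighborFinset (f x) := by
    refine eq_of_subset_of_card_le ?_ ?_
    · intro w hw
      obtain ⟨y, hy, rfl⟩ := mem_map.1 hw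
      simpa using hadj x y (ht y hy)
    · rw [card_map, htc]
      exact (hreg (f x)).le
  have hv' : v ∈ t.map ⟨f, hf⟩ := by simpa [heq] using hv
  obtain ⟨y, hy, rfl⟩ := mem_map.1 hv'
  exact ⟨y, ht y hy, rfl⟩

lemma false_of_triangle (htri : G.CliqueFree 3) {x y z : V} (hxy : G.Adj x y) (hyz : G.Adj y z)
    (hzx : G.Adj z x) : False :=
  htri {x, y, z} (SimpleGraph.is3Clique_triple_iff.2 ⟨hxy, hzx.symm, hyz⟩)

/-- The adjacency relation of the bipartite graph with biadjacency table `T`. -/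
def TableAdj {ι κ : Type*} (T : ι → κ → Prop) : ι ⊕ κ → ι ⊕ κ → Prop
  | .inl i, .inr j => T i j
  | .inr j, .inl i => T i j
  | _, _ => False

instance {ι κ : Type*} (T : ι → κ → Prop) [∀ i j, Decidable (T i j)] :
    ∀ x y, Decidable (TableAdj T x y)
  | .inl i, .inr j => inferInstanceAs (Decidable (T i j))
  | .inr j, .inl i => inferInstanceAs (Decidable (T i j))
  | .inl _, .inl _ => inferInstanceAs (Decidable False)
  | .inr _, .inr _ => inferInstanceAs (Decidable False)

/-- A bipartite table in a connected `5`-regular graph, with distinct row and column vertices,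
exhausts the graph. -/
lemma nonempty_iso_of_injective_table {ι κ : Type*} [Nonempty W] {H : SimpleGraph W}
    (hconn : G.Connected) (hreg : G.IsRegularOfDegree 5)
    (T : ι → κ → Prop) (r : ι → V) (c : κ → V) (hT : ∀ i j, T i j → G.Adj (r i) (c j))
    (hr : Function.Injective r) (hc : Function.Injective c) (hrc : ∀ i j, r i ≠ c j)
    (φ : W → ι ⊕ κ) (hφ : Function.Injective φ)
    (hadj : ∀ x y, H.Adj x y → TableAdj T (φ x) (φ y))
    (hdeg : ∀ x, ∃ t : Finset W, t.card = 5 ∧ ∀ y ∈ t, H.Adj x y) : Nonempty (G ≃g H) := by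
  refine nonempty_iso_of_injective hconn hreg (Sum.elim r c ∘ φ)
    ((hr.sumElim hc hrc).comp hφ) ?_ hdeg
  intro x y hxy
  have h := hadj x y hxy
  simp only [Function.comp_apply]
  generalize φ x = p at h ⊢
  generalize φ y = q at h ⊢
  match p, q, h with
  | .inl i, .inr j, h => exact hT i j h
  | .inr j, .inl i, h => exact (hT i j h).symm

/-- If a bipartite graph of diameter `3` is mapped homomorphically to a triangle-free graph, and the
map is injective on both sides, then it is injective. -/
lemma nonempty_iso_of_bipartite_table {ι κ : Type*} [Nonempty W] {H : SimpleGraph W}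
    (hconn : G.Connected) (hreg : G.IsRegularOfDegree 5) (htri : G.CliqueFree 3)
    (T : ι → κ → Prop) (r : ι → V) (c : κ → V) (hT : ∀ i j, T i j → G.Adj (r i) (c j))
    (hr : Function.Injective r) (hc : Function.Injective c)
    (hdist : ∀ i j, ∃ i' j', T i j' ∧ T i' j' ∧ T i' j)
    (φ : W → ι ⊕ κ) (hφ : Function.Injective φ)
    (hadj : ∀ x y, H.Adj x y → TableAdj T (φ x) (φ y))
    (hdeg : ∀ x, ∃ t : Finset W, t.card = 5 ∧ ∀ y ∈ t, H.Adj x y) : Nonempty (G ≃g H) := by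
  refine nonempty_iso_of_injective_table hconn hreg T r c hT hr hc (fun i j h => ?_) φ hφ hadj hdeg
  -- If the ends of the path `r i, c j', r i', c j` coincided, the path would close up to a
  -- triangle.
  obtain ⟨i', j', h1, h2, h3⟩ := hdist i j
  have h3' := hT _ _ h3
  rw [← h] at h3'
  exact false_of_triangle htri (hT _ _ h1) (hT _ _ h2).symm h3'

end Isomorphism

/-! ### The number of common neighbours is 0, 2 or 4 -/

section CommonNeighbours

variable {V : Type*} [Fintype V] [DecidableEq V] {G : SimpleGraph V} [DecidableRel G.Adj]

/-- The common neighbours of two vertices. -/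
def common (G : SimpleGraph V) [DecidableRel G.Adj] (u w : V) : Finset V :=
  univ.filter fun x => G.Adj u x ∧ G.Adj w x

@[simp] lemma mem_common {u w x : V} : x ∈ common G u w ↔ G.Adj u x ∧ G.Adj w x := by
  simp [common]

lemma common_comm (u w : V) : common G u w = common G w u := by
  ext x; simp [and_comm]

variable {s : V → V → ℤ}

lemma sum_common (hs : IsOrthogonalSigning G s) {u w : V} (h : u ≠ w) :
    ∑ x ∈ common G u w, s u x * s w x = 0 := by
  rw [← hs.orthogonal u w h, common, sum_filter]
  refine sum_congr rfl fun x _ => ?_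
  split_ifs with hx
  · rfl
  · by_cases hu : G.Adj u x
    · rw [hs.zero_of_not_adj w x fun hw => hx ⟨hu, hw⟩, mul_zero]
    · rw [hs.zero_of_not_adj u x hu, zero_mul]

/-- Each term of the vanishing inner product is `±1`, that is, `1` modulo 2. -/
lemma even_card_common (hs : IsOrthogonalSigning G s) {u w : V} (h : u ≠ w) :
    Even (common G u w).card := by
  have h0 := congrArg (Int.cast : ℤ → ZMod 2) (sum_common hs h)
  rw [Int.cast_sum, sum_congr rfl (g := fun _ => (1 : ZMod 2))] at h0
  · simpa [ZMod.natCast_eq_zero_iff_even] using h0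
  · intro x hx
    rw [mem_common, hs.adj_iff, hs.adj_iff] at hx
    rcases hx with ⟨h1 | h1, h2 | h2⟩ <;> simp [h1, h2]

lemma card_common (hs : IsOrthogonalSigning G s) (hreg : G.IsRegularOfDegree 5) {u w : V}
    (h : u ≠ w) : (common G u w).card = 0 ∨ (common G u w).card = 2 ∨ (common G u w).card = 4 := by
  have h5 : (common G u w).card ≤ 5 := by
    rw [← hreg u]
    exact card_le_card fun x hx => by simpa using (mem_common.1 hx).1
  have := even_card_common hs h
  interval_cases (common G u w).card <;> simp_all +decide

lemma eq_of_five (hreg : G.IsRegularOfDegree 5) {v a b c d e x : V} (ha : G.Adj v a)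
    (hb : G.Adj v b) (hc : G.Adj v c) (hd : G.Adj v d) (he : G.Adj v e)
    (hab : a ≠ b) (hac : a ≠ c) (had : a ≠ d) (hae : a ≠ e) (hbc : b ≠ c) (hbd : b ≠ d)
    (hbe : b ≠ e) (hcd : c ≠ d) (hce : c ≠ e) (hde : d ≠ e) (hx : G.Adj v x) :
    x = a ∨ x = b ∨ x = c ∨ x = d ∨ x = e := by
  have heq : ({a, b, c, d, e} : Finset V) = G.neighborFinset v := by
    refine eq_of_subset_of_card_le ?_ ?_
    · intro y hy
      simp only [mem_insert, mem_singleton] at hy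
      rw [SimpleGraph.mem_neighborFinset]
      rcases hy with rfl | rfl | rfl | rfl | rfl <;> assumption
    · rw [SimpleGraph.card_neighborFinset_eq_degree, hreg v]
      simp [*]
  have hx' : x ∈ ({a, b, c, d, e} : Finset V) := by rw [heq]; simpa using hx
  simpa using hx'

/-- A vertex has a fifth neighbour, besides four given ones. -/
lemma exists_fifth (hreg : G.IsRegularOfDegree 5) {v a b c d : V} (ha : G.Adj v a)
    (hb : G.Adj v b) (hc : G.Adj v c) (hd : G.Adj v d) (hab : a ≠ b) (hac : a ≠ c) (had : a ≠ d)
    (hbc : b ≠ c) (hbd : b ≠ d) (hcd : c ≠ d) :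
    ∃ e, G.Adj v e ∧ a ≠ e ∧ b ≠ e ∧ c ≠ e ∧ d ≠ e ∧
      ∀ x, G.Adj v x → x = a ∨ x = b ∨ x = c ∨ x = d ∨ x = e := by
  have hlt : ({a, b, c, d} : Finset V).card < (G.neighborFinset v).card := by
    rw [SimpleGraph.card_neighborFinset_eq_degree, hreg v]
    simp [*]
  obtain ⟨e, he, hne⟩ := exists_mem_notMem_of_card_lt_card hlt
  rw [SimpleGraph.mem_neighborFinset] at he
  simp only [mem_insert, mem_singleton, not_or] at hne
  obtain ⟨h1, h2, h3, h4⟩ := hne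
  exact ⟨e, he, Ne.symm h1, Ne.symm h2, Ne.symm h3, Ne.symm h4, fun x hx =>
    eq_of_five hreg ha hb hc hd he hab hac had (Ne.symm h1) hbc hbd (Ne.symm h2) hcd (Ne.symm h3)
      (Ne.symm h4) hx⟩

/-- Two vertices with a common neighbour have another one. -/
lemma exists_other (hs : IsOrthogonalSigning G s) {u w i : V} (h : u ≠ w) (hu : G.Adj u i)
    (hw : G.Adj w i) : ∃ j, j ≠ i ∧ G.Adj u j ∧ G.Adj w j := by
  have hi : i ∈ common G u w := mem_common.2 ⟨hu, hw⟩
  have h1 : 1 < (common G u w).card := by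
    have := even_card_common hs h
    have : 0 < (common G u w).card := card_pos.2 ⟨i, hi⟩
    by_contra hc
    have h1 : (common G u w).card = 1 := by omega
    simp_all +decide
  obtain ⟨j, hj, hji⟩ := exists_mem_ne h1 i
  exact ⟨j, hji, mem_common.1 hj⟩

/-- Two vertices with three common neighbours have a fourth one, and then no more. -/
lemma exists_fourth (hs : IsOrthogonalSigning G s) (hreg : G.IsRegularOfDegree 5) {u w i j k : V}
    (h : u ≠ w) (hij : i ≠ j) (hik : i ≠ k) (hjk : j ≠ k) (hui : G.Adj u i) (hwi : G.Adj w i)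
    (huj : G.Adj u j) (hwj : G.Adj w j) (huk : G.Adj u k) (hwk : G.Adj w k) :
    ∃ l, i ≠ l ∧ j ≠ l ∧ k ≠ l ∧ common G u w = {i, j, k, l} := by
  have hsub : ({i, j, k} : Finset V) ⊆ common G u w := by
    intro x hx
    simp only [mem_insert, mem_singleton] at hx
    rcases hx with rfl | rfl | rfl <;> simp [*]
  have h3 : ({i, j, k} : Finset V).card = 3 := by simp [*]
  have hle := card_le_card hsub
  have h4 : (common G u w).card = 4 := by
    rcases card_common hs hreg h with h | h | h <;> omega
  obtain ⟨l, hl, hne⟩ := exists_mem_notMem_of_card_lt_card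
    (s := ({i, j, k} : Finset V)) (t := common G u w) (by omega)
  simp only [mem_insert, mem_singleton, not_or] at hne
  obtain ⟨h1, h2, h3⟩ := hne
  refine ⟨l, Ne.symm h1, Ne.symm h2, Ne.symm h3, (eq_of_subset_of_card_le ?_ ?_).symm⟩
  · intro x hx
    simp only [mem_insert, mem_singleton] at hx
    rcases hx with rfl | rfl | rfl | rfl
    · exact hsub (by simp)
    · exact hsub (by simp)
    · exact hsub (by simp)
    · exact hl
  · rw [h4, card_insert_of_notMem, card_insert_of_notMem, card_insert_of_notMem, card_singleton]
    all_goals simp [*, Ne.symm h1, Ne.symm h2, Ne.symm h3]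

end CommonNeighbours

/-! ### Parity and sign relations between rows -/

section Parity

variable {V : Type*} [Fintype V] [DecidableEq V] {G : SimpleGraph V} [DecidableRel G.Adj]
  {s : V → V → ℤ}

/-- Evenness of the number of common neighbours of `v` and `r`, as a linear equation over the field
of two elements; this lets later steps solve for unknown adjacencies. -/
lemma xor_adj (hs : IsOrthogonalSigning G s) {v r a b c d e : V}
    (hv : ∀ x, G.Adj v x ↔ x = a ∨ x = b ∨ x = c ∨ x = d ∨ x = e)
    (hab : a ≠ b) (hac : a ≠ c) (had : a ≠ d) (hae : a ≠ e) (hbc : b ≠ c) (hbd : b ≠ d)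
    (hbe : b ≠ e) (hcd : c ≠ d) (hce : c ≠ e) (hde : d ≠ e) (hvr : v ≠ r) :
    (decide (G.Adj r a) ^^ decide (G.Adj r b) ^^ decide (G.Adj r c) ^^ decide (G.Adj r d) ^^
      decide (G.Adj r e)) = false := by
  have h1 : common G v r = ({a, b, c, d, e} : Finset V).filter fun x => G.Adj r x := by
    ext x
    simp [hv]
  have h2 : (common G v r).card = (if G.Adj r a then 1 else 0) + (if G.Adj r b then 1 else 0) +
      (if G.Adj r c then 1 else 0) + (if G.Adj r d then 1 else 0) +
      (if G.Adj r e then 1 else 0) := by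
    rw [h1, card_filter, sum_insert, sum_insert, sum_insert, sum_insert, sum_singleton]
    · ring
    all_goals simp [*]
  have h3 := even_card_common hs hvr
  rw [h2] at h3
  by_cases ha : G.Adj r a <;> by_cases hb : G.Adj r b <;> by_cases hc : G.Adj r c <;>
    by_cases hd : G.Adj r d <;> by_cases he : G.Adj r e <;>
    simp [ha, hb, hc, hd, he] at h3 ⊢ <;> revert h3 <;> decide

lemma entry (hs : IsOrthogonalSigning G s) {u x : V} (h : G.Adj u x) : s u x = 1 ∨ s u x = -1 :=
  (hs.adj_iff u x).1 h

/-- Two changes of sign cancel, so a sign relation between two rows can be read as one between two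
columns. -/
lemma entry_comm (hs : IsOrthogonalSigning G s) (u x w y : V) :
    s x u * s y w = s u x * s w y := by
  rw [hs.skew u x, hs.skew w y]; ring

/-- Two common neighbours have opposite relative signs when there are no others. -/
lemma sign_of_common_eq_pair (hs : IsOrthogonalSigning G s) {u w i j : V} (h : u ≠ w) (hij : i ≠ j)
    (hc : common G u w = {i, j}) : s u i * s w i + s u j * s w j = 0 := by
  have := sum_common hs h
  rwa [hc, sum_pair hij] at this

lemma sign_of_common_eq_quad (hs : IsOrthogonalSigning G s) {u w i j k l : V} (h : u ≠ w)
    (hij : i ≠ j) (hik : i ≠ k) (hil : i ≠ l) (hjk : j ≠ k) (hjl : j ≠ l) (hkl : k ≠ l)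
    (hc : common G u w = {i, j, k, l}) :
    s u i * s w i + s u j * s w j + s u k * s w k + s u l * s w l = 0 := by
  have := sum_common hs h
  rw [hc, sum_insert, sum_insert, sum_pair hkl] at this
  · linarith
  all_goals simp [*]

/-- If two columns `b`, `c` have rows `v`, `w`, `u` in common, and `v` differs in relative sign from
both `w` and `u`, then the fourth common row shares four columns with `v`. -/
lemma exists_fourth_row (hs : IsOrthogonalSigning G s) (hreg : G.IsRegularOfDegree 5)
    {v w u b c : V} (hbc : b ≠ c) (hvw : v ≠ w) (hvu : v ≠ u) (hwu : w ≠ u)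
    (hvb : G.Adj v b) (hvc : G.Adj v c) (hwb : G.Adj w b) (hwc : G.Adj w c) (hub : G.Adj u b)
    (huc : G.Adj u c) (hα : s v b * s v c = - (s w b * s w c))
    (hβ : s v b * s v c = - (s u b * s u c)) :
    ∃ r, v ≠ r ∧ w ≠ r ∧ u ≠ r ∧ G.Adj r b ∧ G.Adj r c ∧ common G v r ≠ {b, c} := by
  obtain ⟨r, hvr, hwr, hur, hcom⟩ := exists_fourth hs hreg hbc hvw hvu hwu hvb.symm hvc.symm
    hwb.symm hwc.symm hub.symm huc.symm
  have hr : r ∈ common G b c := by simp [hcom]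
  rw [mem_common] at hr
  have hsum := sign_of_common_eq_quad hs hbc hvw hvu hvr hwu hwr hur hcom
  rw [entry_comm hs v b v c, entry_comm hs w b w c, entry_comm hs u b u c,
    entry_comm hs r b r c] at hsum
  -- Four signs with sum zero, two of them opposite to that of `v`: the fourth agrees with that of
  -- `v`. If `b` and `c` were the only common columns of `v` and `r`, orthogonality of these rows
  -- would make the two signs opposite.
  have heq : s r b * s r c = s v b * s v c := by linarith
  refine ⟨r, hvr, hwr, hur, hr.1.symm, hr.2.symm, fun h2 => ?_⟩
  have h3 := sign_of_common_eq_pair hs hvr hbc h2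
  rcases entry hs hvb with h4 | h4 <;> rcases entry hs hvc with h5 | h5 <;>
    rcases entry hs hr.1.symm with h6 | h6 <;> rcases entry hs hr.2.symm with h7 | h7 <;>
    rw [h4, h5, h6, h7] at h3 heq <;> omega

/-- Three signs with sum `±1` are not all equal, so the products `aᵢbᵢ` single out one of the three
columns, and so do the products `aᵢcᵢ`. Two columns that include the singled-out ones separate both
patterns. This provides the sign hypotheses of `exists_fourth_row`. -/
lemma signs_of_three_rows (a₁ a₂ a₃ a₄ b₁ b₂ b₃ b₄ c₁ c₂ c₃ c₄ d₁ d₂ d₃ : ℤ)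
    (ha₁ : a₁ = 1 ∨ a₁ = -1) (ha₂ : a₂ = 1 ∨ a₂ = -1) (ha₃ : a₃ = 1 ∨ a₃ = -1)
    (hb₁ : b₁ = 1 ∨ b₁ = -1) (hb₂ : b₂ = 1 ∨ b₂ = -1) (hb₃ : b₃ = 1 ∨ b₃ = -1)
    (hc₁ : c₁ = 1 ∨ c₁ = -1) (hc₂ : c₂ = 1 ∨ c₂ = -1) (hc₃ : c₃ = 1 ∨ c₃ = -1)
    (ha₄ : a₄ = 1 ∨ a₄ = -1) (hb₄ : b₄ = 1 ∨ b₄ = -1) (hc₄ : c₄ = 1 ∨ c₄ = -1)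
    (hd₁ : d₁ = 1 ∨ d₁ = -1) (hd₂ : d₂ = 1 ∨ d₂ = -1) (hd₃ : d₃ = 1 ∨ d₃ = -1)
    (hab : a₁ * b₁ + a₂ * b₂ + a₃ * b₃ + a₄ * b₄ = 0)
    (hac : a₁ * c₁ + a₂ * c₂ + a₃ * c₃ + d₁ * c₄ = 0)
    (hbc : b₁ * c₁ + b₂ * c₂ + b₃ * c₃ + d₂ * d₃ = 0) :
    (a₁ * a₂ = -(b₁ * b₂) ∧ a₁ * a₂ = -(c₁ * c₂)) ∨
    (a₁ * a₃ = -(b₁ * b₃) ∧ a₁ * a₃ = -(c₁ * c₃)) ∨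
    (a₂ * a₃ = -(b₂ * b₃) ∧ a₂ * a₃ = -(c₂ * c₃)) := by
  have h1 : a₄ * b₄ = 1 ∨ a₄ * b₄ = -1 := by
    rcases ha₄ with h | h <;> rcases hb₄ with h' | h' <;> simp [h, h']
  have h2 : d₁ * c₄ = 1 ∨ d₁ * c₄ = -1 := by
    rcases hd₁ with h | h <;> rcases hc₄ with h' | h' <;> simp [h, h']
  have h3 : d₂ * d₃ = 1 ∨ d₂ * d₃ = -1 := by
    rcases hd₂ with h | h <;> rcases hd₃ with h' | h' <;> simp [h, h']
  generalize a₄ * b₄ = x at *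
  generalize d₁ * c₄ = y at *
  generalize d₂ * d₃ = z at *
  clear ha₄ hb₄ hc₄ hd₁ hd₂ hd₃
  rcases ha₁ with rfl | rfl <;> rcases ha₂ with rfl | rfl <;> rcases ha₃ with rfl | rfl <;>
  rcases hb₁ with rfl | rfl <;> rcases hb₂ with rfl | rfl <;> rcases hb₃ with rfl | rfl <;>
  rcases hc₁ with rfl | rfl <;> rcases hc₂ with rfl | rfl <;> rcases hc₃ with rfl | rfl <;>
  omega

end Parity

/-! ### The two graphs in which mates are not unique, as tables -/

section ThreeRows

variable {V : Type*} [Fintype V] [DecidableEq V] {G : SimpleGraph V} [DecidableRel G.Adj]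
  {s : V → V → ℤ}

def tripleRingCode (x : Fin (2 * 2) × Fin 3) : Fin 6 ⊕ Fin 6 :=
  if x.1 = 0 then .inl ⟨x.2, by omega⟩ else if x.1 = 2 then .inl ⟨x.2 + 3, by omega⟩
  else if x.1 = 1 then .inr ⟨x.2, by omega⟩ else .inr ⟨x.2 + 3, by omega⟩

instance : DecidableRel (tripleRing 2).Adj := by
  unfold tripleRing; infer_instance

/-- With four layers, the even layers form one side of a bipartite graph and the odd layers the
other; the two deleted matchings together are a perfect matching of `K_{6,6}`. -/
lemma nonempty_iso_tripleRing_of_table (hconn : G.Connected) (hreg : G.IsRegularOfDegree 5)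
    (htri : G.CliqueFree 3) (r c : Fin 6 → V) (hr : Function.Injective r)
    (hc : Function.Injective c) (h : ∀ i j, i ≠ j → G.Adj (r i) (c j)) :
    Nonempty (G ≃g tripleRing 2) := by
  refine nonempty_iso_of_bipartite_table hconn hreg htri (fun i j => i ≠ j) r c h hr hc (by decide)
    tripleRingCode (by decide) (by decide) ?_
  intro x
  refine ⟨univ.filter fun y => (tripleRing 2).Adj x y, ?_, by simp⟩
  revert x; decide

/-- Even positions of the cycle are rows in the first copy and columns in the second, so that the
rungs of the prism also join rows to columns. -/
def prismCode (x : Fin 2 × (Fin 4 × Bool)) : Fin 8 ⊕ Fin 8 :=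
  let n : Fin 8 := if x.2.1 = 0 ∨ x.2.1 = 1 then (if x.2.2 then 0 else 1) else
    if x.2.2 then 2 else 3
  if x.1 = 0 then
    if x.2.1 = 0 ∨ x.2.1 = 2 then .inl n else .inr n
  else
    if x.2.1 = 0 ∨ x.2.1 = 2 then .inr (n + 4) else .inl (n + 4)

lemma prism_adj {W : Type*} (H : SimpleGraph W) (x y : Fin 2 × W) :
    (prism H).Adj x y ↔ (x.1 ≠ y.1 ∧ x.2 = y.2) ∨ (x.1 = y.1 ∧ H.Adj x.2 y.2) := by
  have h : ∀ a b : Fin 2, (SimpleGraph.pathGraph 2).Adj a b ↔ a ≠ b := by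
    intro a b
    rw [SimpleGraph.pathGraph_adj]
    omega
  rw [prism, SimpleGraph.boxProd_adj, h]
  tauto

lemma doubledCycle_adj {m : ℕ} (x y : Fin m × Bool) :
    (doubledCycle m).Adj x y ↔ (x.1 - y.1).val = 1 ∨ (y.1 - x.1).val = 1 := by
  rw [doubledCycle, SimpleGraph.comap_adj, SimpleGraph.cycleGraph_adj']

instance {m : ℕ} : DecidableRel (doubledCycle m).Adj := fun x y =>
  decidable_of_iff _ (doubledCycle_adj x y).symm

instance {W : Type*} [DecidableEq W] (H : SimpleGraph W) [DecidableRel H.Adj] :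
    DecidableRel (prism H).Adj := fun x y => decidable_of_iff _ (prism_adj H x y).symm

/-- `U_4` is `K_{4,4}`, so the table consists of two complete blocks and a perfect matching between
them; `i = j + 4` is read modulo 8 and covers both directions of the matching. -/
lemma nonempty_iso_prism_of_table (hconn : G.Connected) (hreg : G.IsRegularOfDegree 5)
    (htri : G.CliqueFree 3) (r c : Fin 8 → V) (hr : Function.Injective r)
    (hc : Function.Injective c)
    (h : ∀ i j : Fin 8, (i < 4 ∧ j < 4) ∨ (4 ≤ i ∧ 4 ≤ j) ∨ i = j + 4 → G.Adj (r i) (c j)) :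
    Nonempty (G ≃g prism (doubledCycle 4)) := by
  refine nonempty_iso_of_bipartite_table hconn hreg htri _ r c h hr hc (by decide)
    prismCode (by decide) (by decide) ?_
  intro x
  refine ⟨univ.filter fun y => (prism (doubledCycle 4)).Adj x y, ?_, by simp⟩
  revert x; decide

end ThreeRows

/-! ### Completing the table from three rows -/

section Mates

variable {V : Type*} [Fintype V] [DecidableEq V] {G : SimpleGraph V} [DecidableRel G.Adj]
  {s : V → V → ℤ}

lemma adj_iff_of_five (hreg : G.IsRegularOfDegree 5) {v a b c d e : V} (ha : G.Adj v a)
    (hb : G.Adj v b) (hc : G.Adj v c) (hd : G.Adj v d) (he : G.Adj v e)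
    (hab : a ≠ b) (hac : a ≠ c) (had : a ≠ d) (hae : a ≠ e) (hbc : b ≠ c) (hbd : b ≠ d)
    (hbe : b ≠ e) (hcd : c ≠ d) (hce : c ≠ e) (hde : d ≠ e) (x : V) :
    G.Adj v x ↔ x = a ∨ x = b ∨ x = c ∨ x = d ∨ x = e := by
  refine ⟨eq_of_five hreg ha hb hc hd he hab hac had hae hbc hbd hbe hcd hce hde, ?_⟩
  rintro (rfl | rfl | rfl | rfl | rfl) <;> assumption

lemma xor_rotate : ∀ x y z t r : Bool, (x ^^ y ^^ z ^^ t ^^ r) = false →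
    (z ^^ x ^^ y ^^ t ^^ r) = false := by
  decide

lemma xor_swap : ∀ x y z t r : Bool, (x ^^ y ^^ z ^^ t ^^ r) = false →
    (y ^^ x ^^ z ^^ t ^^ r) = false := by
  decide

lemma xor_last : ∀ x y z t r : Bool, (x ^^ y ^^ z ^^ t) = true →
    (x ^^ y ^^ z ^^ t ^^ r) = false → r = true := by
  decide

/-- Adding the relations in pairs identifies `D`, `E` and `F`; then, as `B` and `C` cancel, the
first relation leaves only `A`. -/
lemma xor_cases (A B C D E F : Prop) [Decidable A] [Decidable B] [Decidable C] [Decidable D]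
    [Decidable E] [Decidable F] (hB : B) (hC : C)
    (h1 : (decide A ^^ decide B ^^ decide C ^^ decide D ^^ decide E) = false)
    (h2 : (decide A ^^ decide B ^^ decide C ^^ decide D ^^ decide F) = false)
    (h3 : (decide A ^^ decide B ^^ decide C ^^ decide E ^^ decide F) = false) :
    ¬ A ∧ (D ↔ E) ∧ (D ↔ F) := by
  by_cases A <;> by_cases D <;> by_cases E <;> by_cases F <;> simp_all

/-- Rows `v`, `w`, `u` on the columns `abcde`, `abcdf`, `abcef`: the configuration closes up to
`K_{6,6}` minus a perfect matching. -/
lemma nonempty_iso_tripleRing_aux (hs : IsOrthogonalSigning G s) (hconn : G.Connected)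
    (hreg : G.IsRegularOfDegree 5) (htri : G.CliqueFree 3) {v w u a b c d e f : V}
    (hnd : [a, b, c, d, e, f].Nodup) (hvw : v ≠ w) (hvu : v ≠ u) (hwu : w ≠ u)
    (hv : ∀ x, G.Adj v x ↔ x = a ∨ x = b ∨ x = c ∨ x = d ∨ x = e)
    (hw : ∀ x, G.Adj w x ↔ x = a ∨ x = b ∨ x = c ∨ x = d ∨ x = f)
    (hu : ∀ x, G.Adj u x ↔ x = a ∨ x = b ∨ x = c ∨ x = e ∨ x = f)
    (hα : s v b * s v c = - (s w b * s w c)) (hβ : s v b * s v c = - (s u b * s u c)) :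
    Nonempty (G ≃g tripleRing 2) := by
  simp only [List.nodup_cons, List.mem_cons, List.not_mem_nil, or_false, not_or,
    not_false_eq_true, List.nodup_nil, and_true] at hnd
  obtain ⟨⟨hab, hac, had, hae, haf⟩, ⟨hbc, hbd, hbe, hbf⟩, ⟨hcd, hce, hcf⟩, ⟨hde, hdf⟩, hef⟩ := hnd
  have key : ∀ r, v ≠ r → w ≠ r → u ≠ r →
      (decide (G.Adj r a) ^^ decide (G.Adj r b) ^^ decide (G.Adj r c) ^^ decide (G.Adj r d) ^^
        decide (G.Adj r e)) = false ∧
      (decide (G.Adj r a) ^^ decide (G.Adj r b) ^^ decide (G.Adj r c) ^^ decide (G.Adj r d) ^^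
        decide (G.Adj r f)) = false ∧
      (decide (G.Adj r a) ^^ decide (G.Adj r b) ^^ decide (G.Adj r c) ^^ decide (G.Adj r e) ^^
        decide (G.Adj r f)) = false := fun r h1 h2 h3 =>
    ⟨xor_adj hs hv hab hac had hae hbc hbd hbe hcd hce hde h1,
      xor_adj hs hw hab hac had haf hbc hbd hbf hcd hcf hdf h2,
      xor_adj hs hu hab hac hae haf hbc hbe hbf hce hcf hef h3⟩
  have hva : G.Adj v a := by simp [hv]
  have hvb : G.Adj v b := by simp [hv]
  have hvc : G.Adj v c := by simp [hv]
  have hvd : G.Adj v d := by simp [hv]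
  have hwa : G.Adj w a := by simp [hw]
  have hwb : G.Adj w b := by simp [hw]
  have hwc : G.Adj w c := by simp [hw]
  have hwd : G.Adj w d := by simp [hw]
  have hua : G.Adj u a := by simp [hu]
  have hub : G.Adj u b := by simp [hu]
  have huc : G.Adj u c := by simp [hu]
  have hud : ¬ G.Adj u d := by simp [hu, Ne.symm had, Ne.symm hbd, Ne.symm hcd, hde, hdf]
  obtain ⟨r, hvr, hwr, hur, hrb, hrc, hne⟩ :=
    exists_fourth_row hs hreg hbc hvw hvu hwu hvb hvc hwb hwc hub huc hα hβ
  obtain ⟨k1, k2, k3⟩ := key r hvr hwr hur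
  -- By parity `r` avoids `a` and meets all or none of `d`, `e`, `f`; none is impossible, as `r`
  -- shares more than `b`, `c` with `v`.
  obtain ⟨hra, hde', hdf'⟩ := xor_cases _ _ _ _ _ _ hrb hrc k1 k2 k3
  have hrd : G.Adj r d := by
    by_contra hrd
    refine hne ?_
    ext x
    simp only [mem_common, hv, mem_insert, mem_singleton]
    have hre : ¬ G.Adj r e := fun h => hrd (hde'.2 h)
    constructor
    · rintro ⟨rfl | rfl | rfl | rfl | rfl, h⟩ <;> simp_all
    · rintro (rfl | rfl) <;> simp [hrb, hrc]
  have hre := hde'.1 hrd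
  have hrf := hdf'.1 hrd
  -- the rows through `a`, `b` and through `a`, `c`
  obtain ⟨p, hvp, hwp, hup, hcom⟩ := exists_fourth hs hreg hab hvw hvu hwu hva.symm hvb.symm
    hwa.symm hwb.symm hua.symm hub.symm
  have hpm : p ∈ common G a b := by simp [hcom]
  rw [mem_common] at hpm
  obtain ⟨hpa, hpb⟩ := hpm
  obtain ⟨q, hvq, hwq, huq, hcom'⟩ := exists_fourth hs hreg hac hvw hvu hwu hva.symm hvc.symm
    hwa.symm hwc.symm hua.symm huc.symm
  have hqm : q ∈ common G a c := by simp [hcom']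
  rw [mem_common] at hqm
  obtain ⟨hqa, hqc⟩ := hqm
  have hrp : r ≠ p := by rintro rfl; exact hra hpa.symm
  have hrq : r ≠ q := by rintro rfl; exact hra hqa.symm
  obtain ⟨k1, k2, k3⟩ := key p hvp hwp hup
  obtain ⟨hpc, hpde, hpdf⟩ := xor_cases (G.Adj p c) (G.Adj p a) (G.Adj p b)
    (G.Adj p d) (G.Adj p e) (G.Adj p f) hpa.symm
    hpb.symm (xor_rotate _ _ _ _ _ k1) (xor_rotate _ _ _ _ _ k2) (xor_rotate _ _ _ _ _ k3)
  obtain ⟨k1, k2, k3⟩ := key q hvq hwq huq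
  obtain ⟨hqb, hqde, hqdf⟩ := xor_cases (G.Adj q b) (G.Adj q a) (G.Adj q c)
    (G.Adj q d) (G.Adj q e) (G.Adj q f) hqa.symm
    hqc.symm (xor_swap _ _ _ _ _ k1) (xor_swap _ _ _ _ _ k2)
    (xor_swap _ _ _ _ _ k3)
  have hpq : p ≠ q := by rintro rfl; exact hqb hpb.symm
  -- Columns `b` and `d` share `v`, `w`, `r`, hence a fourth row. The five rows through `b` are now
  -- `v`, `w`, `u`, `r`, `p`, and `u` misses `d`, so the fourth row is `p`. The same argument with
  -- `c` and `q` follows.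
  have hpd : G.Adj p d := by
    obtain ⟨t, hvt, hwt, hrt, hct⟩ := exists_fourth hs hreg hbd hvw hvr hwr hvb.symm hvd.symm
      hwb.symm hwd.symm hrb.symm hrd.symm
    have ht : t ∈ common G b d := by simp [hct]
    rw [mem_common] at ht
    rcases eq_of_five hreg hvb.symm hwb.symm hub.symm hrb.symm hpb hvw hvu hvr hvp hwu hwr hwp
      hur hup hrp ht.1 with h | h | h | h | h
    · exact absurd h.symm hvt
    · exact absurd h.symm hwt
    · exact absurd (h ▸ ht.2.symm) hud
    · exact absurd h.symm hrt
    · exact h ▸ ht.2.symm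
  have hqd : G.Adj q d := by
    obtain ⟨t, hvt, hwt, hrt, hct⟩ := exists_fourth hs hreg hcd hvw hvr hwr hvc.symm hvd.symm
      hwc.symm hwd.symm hrc.symm hrd.symm
    have ht : t ∈ common G c d := by simp [hct]
    rw [mem_common] at ht
    rcases eq_of_five hreg hvc.symm hwc.symm huc.symm hrc.symm hqc hvw hvu hvr hvq hwu hwr hwq
      hur huq hrq ht.1 with h | h | h | h | h
    · exact absurd h.symm hvt
    · exact absurd h.symm hwt
    · exact absurd (h ▸ ht.2.symm) hud
    · exact absurd h.symm hrt
    · exact h ▸ ht.2.symm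
  have hpe := hpde.1 hpd
  have hpf := hpdf.1 hpd
  have hqe := hqde.1 hqd
  have hqf := hqdf.1 hqd
  refine nonempty_iso_tripleRing_of_table hconn hreg htri ![r, q, p, u, w, v] ![a, b, c, d, e, f]
    ?_ ?_ ?_
  · rw [← List.nodup_ofFn]
    simp [hrp, hrq, Ne.symm hpq, Ne.symm hvw, Ne.symm hvu, Ne.symm hwu,
      Ne.symm hvr, Ne.symm hwr, Ne.symm hur, Ne.symm hvp, Ne.symm hwp, Ne.symm hup, Ne.symm hvq,
      Ne.symm hwq, Ne.symm huq]
  · rw [← List.nodup_ofFn]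
    simp [*]
  · intro i j hij
    fin_cases i <;> fin_cases j <;> first | exact absurd rfl hij | skip
    all_goals simp [hpa.symm, hpb.symm, hqa.symm, hqc.symm, *]

set_option maxHeartbeats 1000000 in
/-- Rows `v`, `w`, `u` with four columns in common. -/
lemma nonempty_iso_prism_aux (hs : IsOrthogonalSigning G s) (hconn : G.Connected)
    (hreg : G.IsRegularOfDegree 5) (htri : G.CliqueFree 3) {v w u a b c d e f g : V}
    (hnd : [a, b, c, d, e, f, g].Nodup) (hvw : v ≠ w) (hvu : v ≠ u) (hwu : w ≠ u)
    (hv : ∀ x, G.Adj v x ↔ x = a ∨ x = b ∨ x = c ∨ x = d ∨ x = e)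
    (hw : ∀ x, G.Adj w x ↔ x = a ∨ x = b ∨ x = c ∨ x = d ∨ x = f)
    (hu : ∀ x, G.Adj u x ↔ x = a ∨ x = b ∨ x = c ∨ x = d ∨ x = g)
    (hα : s v a * s v b = - (s w a * s w b)) (hβ : s v a * s v b = - (s u a * s u b)) :
    Nonempty (G ≃g prism (doubledCycle 4)) := by
  simp only [List.nodup_cons, List.mem_cons, List.not_mem_nil, or_false, not_or,
    not_false_eq_true, List.nodup_nil, and_true] at hnd
  obtain ⟨⟨hab, hac, had, hae, haf, hag⟩, ⟨hbc, hbd, hbe, hbf, hbg⟩, ⟨hcd, hce, hcf, hcg⟩,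
    ⟨hde, hdf, hdg⟩, ⟨hef, heg⟩, hfg⟩ := hnd
  have key : ∀ r, v ≠ r → w ≠ r → u ≠ r →
      (decide (G.Adj r a) ^^ decide (G.Adj r b) ^^ decide (G.Adj r c) ^^ decide (G.Adj r d) ^^
        decide (G.Adj r e)) = false ∧
      (decide (G.Adj r a) ^^ decide (G.Adj r b) ^^ decide (G.Adj r c) ^^ decide (G.Adj r d) ^^
        decide (G.Adj r f)) = false ∧
      (decide (G.Adj r a) ^^ decide (G.Adj r b) ^^ decide (G.Adj r c) ^^ decide (G.Adj r d) ^^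
        decide (G.Adj r g)) = false := fun r h1 h2 h3 =>
    ⟨xor_adj hs hv hab hac had hae hbc hbd hbe hcd hce hde h1,
      xor_adj hs hw hab hac had haf hbc hbd hbf hcd hcf hdf h2,
      xor_adj hs hu hab hac had hag hbc hbd hbg hcd hcg hdg h3⟩
  have hva : G.Adj v a := by simp [hv]
  have hvb : G.Adj v b := by simp [hv]
  have hvc : G.Adj v c := by simp [hv]
  have hvd : G.Adj v d := by simp [hv]
  have hve : G.Adj v e := by simp [hv]
  have hwa : G.Adj w a := by simp [hw]
  have hwb : G.Adj w b := by simp [hw]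
  have hwc : G.Adj w c := by simp [hw]
  have hwd : G.Adj w d := by simp [hw]
  have hua : G.Adj u a := by simp [hu]
  have hub : G.Adj u b := by simp [hu]
  have huc : G.Adj u c := by simp [hu]
  have hud : G.Adj u d := by simp [hu]
  obtain ⟨r, hvr, hwr, hur, hra, hrb, hne⟩ :=
    exists_fourth_row hs hreg hab hvw hvu hwu hva hvb hwa hwb hua hub hα hβ
  obtain ⟨k1, k2, k3⟩ := key r hvr hwr hur
  -- By parity `r` meets all or none of `e`, `f`, `g`, according to whether it meets exactly one of
  -- `c`, `d`. Meeting exactly one would give `r` six neighbours, and meeting none of `c`, `d`, `e`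
  -- contradicts `hne`.
  have hrcd : G.Adj r c ∧ G.Adj r d ∧ ¬ G.Adj r e ∧ ¬ G.Adj r f ∧ ¬ G.Adj r g := by
    have hne' : G.Adj r c ∨ G.Adj r d ∨ G.Adj r e := by
      by_contra! h
      refine hne ?_
      ext x
      simp only [mem_common, hv, mem_insert, mem_singleton]
      constructor
      · rintro ⟨rfl | rfl | rfl | rfl | rfl, h⟩ <;> simp_all
      · rintro (rfl | rfl) <;> simp [hra, hrb]
    by_cases hrc : G.Adj r c <;> by_cases hrd : G.Adj r d <;> by_cases hre : G.Adj r e <;>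
      by_cases hrf : G.Adj r f <;> by_cases hrg : G.Adj r g <;> simp_all
    · rcases eq_of_five hreg hra hrb hrc hre hrf hab hac hae haf hbc hbe hbf hce hcf hef hrg with
        h | h | h | h | h <;> simp_all
    · rcases eq_of_five hreg hra hrb hrd hre hrf hab had hae haf hbd hbe hbf hde hdf hef hrg with
        h | h | h | h | h <;> simp_all
  obtain ⟨hrc, hrd, hre, hrf, hrg⟩ := hrcd
  obtain ⟨h, hrh, hah, hbh, hch, hdh, hr⟩ :=
    exists_fifth hreg hra hrb hrc hrd hab hac had hbc hbd hcd
  have heh : e ≠ h := by rintro rfl; exact hre hrh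
  have hfh : f ≠ h := by rintro rfl; exact hrf hrh
  have hgh : g ≠ h := by rintro rfl; exact hrg hrh
  have hr' : ∀ x, G.Adj r x ↔ x = a ∨ x = b ∨ x = c ∨ x = d ∨ x = h := fun x =>
    ⟨hr x, by rintro (rfl | rfl | rfl | rfl | rfl) <;> assumption⟩
  -- the fifth row through a column meets the other fifth columns
  have fifth : ∀ x, G.Adj v x → G.Adj w x → G.Adj u x → G.Adj r x → ∃ t, v ≠ t ∧ w ≠ t ∧ u ≠ t ∧
      r ≠ t ∧ G.Adj t x ∧ (∀ y, y ≠ x → G.Adj v y → G.Adj w y → G.Adj u y → G.Adj r y →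
        ¬ G.Adj t y) := by
    intro x h1 h2 h3 h4
    obtain ⟨t, hxt, hvt, hwt, hut, hrt, -⟩ :=
      exists_fifth hreg h1.symm h2.symm h3.symm h4.symm hvw hvu hvr hwu hwr hur
    refine ⟨t, hvt, hwt, hut, hrt, hxt.symm, fun y hy g1 g2 g3 g4 g5 => ?_⟩
    -- Otherwise `x` and `y` would share the five rows `v`, `w`, `u`, `r`, `t`, but at most four are
    -- possible.
    obtain ⟨l, -, -, -, hl⟩ := exists_fourth hs hreg hy hvw hvu hwu g1.symm h1.symm g2.symm h2.symm
      g3.symm h3.symm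
    have e1 : r ∈ common G y x := by simp [g4.symm, h4.symm]
    have e2 : t ∈ common G y x := by simp [g5.symm, hxt]
    simp only [hl, mem_insert, mem_singleton] at e1 e2
    have e1' : r = l := by simpa [Ne.symm hvr, Ne.symm hwr, Ne.symm hur] using e1
    have e2' : t = l := by simpa [Ne.symm hvt, Ne.symm hwt, Ne.symm hut] using e2
    exact hrt (e1'.trans e2'.symm)
  have fifth' : ∀ t, v ≠ t → w ≠ t → u ≠ t → r ≠ t →
      (decide (G.Adj t a) ^^ decide (G.Adj t b) ^^ decide (G.Adj t c) ^^ decide (G.Adj t d)) =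
        true → G.Adj t e ∧ G.Adj t f ∧ G.Adj t g ∧ G.Adj t h := by
    intro t h1 h2 h3 h4 h5
    obtain ⟨k1, k2, k3⟩ := key t h1 h2 h3
    have k4 := xor_adj hs hr' hab hac had hah hbc hbd hbh hcd hch hdh h4
    exact ⟨of_decide_eq_true (xor_last _ _ _ _ _ h5 k1),
      of_decide_eq_true (xor_last _ _ _ _ _ h5 k2),
      of_decide_eq_true (xor_last _ _ _ _ _ h5 k3), of_decide_eq_true (xor_last _ _ _ _ _ h5 k4)⟩
  obtain ⟨ta, hvta, hwta, huta, hrta, hta, hta'⟩ := fifth a hva hwa hua hra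
  obtain ⟨tb, hvtb, hwtb, hutb, hrtb, htb, htb'⟩ := fifth b hvb hwb hub hrb
  obtain ⟨tc, hvtc, hwtc, hutc, hrtc, htc, htc'⟩ := fifth c hvc hwc huc hrc
  obtain ⟨td, hvtd, hwtd, hutd, hrtd, htd, htd'⟩ := fifth d hvd hwd hud hrd
  have nab := hta' b (Ne.symm hab) hvb hwb hub hrb
  have nac := hta' c (Ne.symm hac) hvc hwc huc hrc
  have nad := hta' d (Ne.symm had) hvd hwd hud hrd
  have nba := htb' a hab hva hwa hua hra
  have nbc := htb' c (Ne.symm hbc) hvc hwc huc hrc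
  have nbd := htb' d (Ne.symm hbd) hvd hwd hud hrd
  have nca := htc' a hac hva hwa hua hra
  have ncb := htc' b hbc hvb hwb hub hrb
  have ncd := htc' d (Ne.symm hcd) hvd hwd hud hrd
  have nda := htd' a had hva hwa hua hra
  have ndb := htd' b hbd hvb hwb hub hrb
  have ndc := htd' c hcd hvc hwc huc hrc
  obtain ⟨a1, a2, a3, a4⟩ := fifth' ta hvta hwta huta hrta (by simp [hta, nab, nac, nad])
  obtain ⟨b1, b2, b3, b4⟩ := fifth' tb hvtb hwtb hutb hrtb (by simp [htb, nba, nbc, nbd])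
  obtain ⟨c1, c2, c3, c4⟩ := fifth' tc hvtc hwtc hutc hrtc (by simp [htc, nca, ncb, ncd])
  obtain ⟨d1, d2, d3, d4⟩ := fifth' td hvtd hwtd hutd hrtd (by simp [htd, nda, ndb, ndc])
  have eab : ta ≠ tb := by rintro rfl; exact nab htb
  have eac : ta ≠ tc := by rintro rfl; exact nac htc
  have ead : ta ≠ td := by rintro rfl; exact nad htd
  have ebc : tb ≠ tc := by rintro rfl; exact nbc htc
  have ebd : tb ≠ td := by rintro rfl; exact nbd htd
  have ecd : tc ≠ td := by rintro rfl; exact ncd htd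
  refine nonempty_iso_prism_of_table hconn hreg htri ![v, w, u, r, ta, tb, tc, td]
    ![a, b, c, d, e, f, g, h] ?_ ?_ ?_
  · rw [← List.nodup_ofFn]
    simp [*]
  · rw [← List.nodup_ofFn]
    simp [*]
  · intro i j hij
    fin_cases i <;> fin_cases j <;> first | (exfalso; revert hij; decide) | skip
    all_goals simp [*]

end Mates

/-! ### A vertex with two mates -/

section Mates

variable {V : Type*} [Fintype V] [DecidableEq V] {G : SimpleGraph V} [DecidableRel G.Adj]
  {s : V → V → ℤ}

lemma adj_of_common_eq {u w : V} {t : Finset V} (h : common G u w = t) {x : V} (hx : x ∈ t) :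
    G.Adj u x ∧ G.Adj w x := by
  rwa [← mem_common, h]

/-- Three rows whose pairwise common columns are `abcd`, `abce`, `abcf`. -/
lemma nonempty_iso_of_common_three (hs : IsOrthogonalSigning G s) (hconn : G.Connected)
    (hreg : G.IsRegularOfDegree 5) (htri : G.CliqueFree 3) {v w u a b c d e : V} (hvw : v ≠ w)
    (hvu : v ≠ u) (hwu : w ≠ u) (hnd : [a, b, c, d, e].Nodup) (h1 : common G v w = {a, b, c, d})
    (h2 : common G v u = {a, b, c, e}) : Nonempty (G ≃g tripleRing 2) := by
  have hnd' := hnd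
  simp only [List.nodup_cons, List.mem_cons, List.not_mem_nil, or_false, not_or,
    not_false_eq_true, List.nodup_nil, and_true] at hnd
  obtain ⟨⟨hab, hac, had, hae⟩, ⟨hbc, hbd, hbe⟩, ⟨hcd, hce⟩, hde⟩ := hnd
  obtain ⟨hva, hwa⟩ := adj_of_common_eq h1 (x := a) (by simp)
  obtain ⟨hvb, hwb⟩ := adj_of_common_eq h1 (x := b) (by simp)
  obtain ⟨hvc, hwc⟩ := adj_of_common_eq h1 (x := c) (by simp)
  obtain ⟨hvd, hwd⟩ := adj_of_common_eq h1 (x := d) (by simp)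
  obtain ⟨-, hua⟩ := adj_of_common_eq h2 (x := a) (by simp)
  obtain ⟨-, hub⟩ := adj_of_common_eq h2 (x := b) (by simp)
  obtain ⟨-, huc⟩ := adj_of_common_eq h2 (x := c) (by simp)
  obtain ⟨hve, hue⟩ := adj_of_common_eq h2 (x := e) (by simp)
  have hud : ¬ G.Adj u d := by
    intro h
    have : d ∈ common G v u := by simp [hvd, h]
    simp [h2, Ne.symm had, Ne.symm hbd, Ne.symm hcd, hde] at this
  have hwe : ¬ G.Adj w e := by
    intro h
    have : e ∈ common G v w := by simp [hve, h]
    simp [h1, Ne.symm hae, Ne.symm hbe, Ne.symm hce, Ne.symm hde] at this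
  obtain ⟨f, haf, hbf, hcf, h3⟩ := exists_fourth hs hreg hwu hab hac hbc hwa hua hwb hub hwc huc
  obtain ⟨hwf, huf⟩ := adj_of_common_eq h3 (x := f) (by simp)
  have hdf : d ≠ f := by rintro rfl; exact hud huf
  have hef : e ≠ f := by rintro rfl; exact hwe hwf
  have hv := adj_iff_of_five hreg hva hvb hvc hvd hve hab hac had hae hbc hbd hbe hcd hce hde
  have hw := adj_iff_of_five hreg hwa hwb hwc hwd hwf hab hac had haf hbc hbd hbf hcd hcf hdf
  have hu := adj_iff_of_five hreg hua hub huc hue huf hab hac hae haf hbc hbe hbf hce hcf hef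
  have s1 := sign_of_common_eq_quad hs hvw hab hac had hbc hbd hcd h1
  have s2 := sign_of_common_eq_quad hs hvu hab hac hae hbc hbe hce h2
  have s3 := sign_of_common_eq_quad hs hwu hab hac haf hbc hbf hcf h3
  -- The columns `a`, `b`, `c` play symmetric roles; the three cases move the pair that separates
  -- `v` from both other rows into the places `b`, `c`.
  rcases signs_of_three_rows _ _ _ _ _ _ _ _ _ _ _ _ _ _ _ (entry hs hva) (entry hs hvb)
    (entry hs hvc) (entry hs hwa) (entry hs hwb) (entry hs hwc) (entry hs hua) (entry hs hub)
    (entry hs huc) (entry hs hvd) (entry hs hwd) (entry hs hue) (entry hs hve) (entry hs hwf)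
    (entry hs huf) s1 s2 s3 with ⟨k1, k2⟩ | ⟨k1, k2⟩ | ⟨k1, k2⟩
  · exact nonempty_iso_tripleRing_aux hs hconn hreg htri (a := c) (b := a) (c := b) (d := d)
      (e := e) (f := f) (by simp; grind) hvw hvu hwu (by grind) (by grind) (by grind) k1 k2
  · exact nonempty_iso_tripleRing_aux hs hconn hreg htri (a := b) (b := a) (c := c) (d := d)
      (e := e) (f := f) (by simp; grind) hvw hvu hwu (by grind) (by grind) (by grind) k1 k2
  · exact nonempty_iso_tripleRing_aux hs hconn hreg htri (a := a) (b := b) (c := c) (d := d)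
      (e := e) (f := f) (by simp; grind) hvw hvu hwu hv hw hu k1 k2

/-- Three rows with the same four columns `abcd` in common. -/
lemma nonempty_iso_of_common_four (hs : IsOrthogonalSigning G s) (hconn : G.Connected)
    (hreg : G.IsRegularOfDegree 5) (htri : G.CliqueFree 3) {v w u a b c d : V} (hvw : v ≠ w)
    (hvu : v ≠ u) (hwu : w ≠ u) (hnd : [a, b, c, d].Nodup) (h1 : common G v w = {a, b, c, d})
    (h2 : common G v u = {a, b, c, d}) : Nonempty (G ≃g prism (doubledCycle 4)) := by
  simp only [List.nodup_cons, List.mem_cons, List.not_mem_nil, or_false, not_or,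
    not_false_eq_true, List.nodup_nil, and_true] at hnd
  obtain ⟨⟨hab, hac, had⟩, ⟨hbc, hbd⟩, hcd⟩ := hnd
  obtain ⟨hva, hwa⟩ := adj_of_common_eq h1 (x := a) (by simp)
  obtain ⟨hvb, hwb⟩ := adj_of_common_eq h1 (x := b) (by simp)
  obtain ⟨hvc, hwc⟩ := adj_of_common_eq h1 (x := c) (by simp)
  obtain ⟨hvd, hwd⟩ := adj_of_common_eq h1 (x := d) (by simp)
  obtain ⟨-, hua⟩ := adj_of_common_eq h2 (x := a) (by simp)
  obtain ⟨-, hub⟩ := adj_of_common_eq h2 (x := b) (by simp)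
  obtain ⟨-, huc⟩ := adj_of_common_eq h2 (x := c) (by simp)
  obtain ⟨-, hud⟩ := adj_of_common_eq h2 (x := d) (by simp)
  obtain ⟨e, hve, hae, hbe, hce, hde, hv⟩ :=
    exists_fifth hreg hva hvb hvc hvd hab hac had hbc hbd hcd
  obtain ⟨f, hwf, haf, hbf, hcf, hdf, hw⟩ :=
    exists_fifth hreg hwa hwb hwc hwd hab hac had hbc hbd hcd
  obtain ⟨g, hug, hag, hbg, hcg, hdg, hu⟩ :=
    exists_fifth hreg hua hub huc hud hab hac had hbc hbd hcd
  obtain ⟨l, hal, hbl, hcl, h3⟩ := exists_fourth hs hreg hwu hab hac hbc hwa hua hwb hub hwc huc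
  have hdl : d = l := by
    have : d ∈ common G w u := by simp [hwd, hud]
    simpa [h3, Ne.symm had, Ne.symm hbd, Ne.symm hcd] using this
  subst hdl
  have hef : e ≠ f := by
    rintro rfl
    have : e ∈ common G v w := by simp [hve, hwf]
    simp [h1, Ne.symm hae, Ne.symm hbe, Ne.symm hce, Ne.symm hde] at this
  have heg : e ≠ g := by
    rintro rfl
    have : e ∈ common G v u := by simp [hve, hug]
    simp [h2, Ne.symm hae, Ne.symm hbe, Ne.symm hce, Ne.symm hde] at this
  have hfg : f ≠ g := by
    rintro rfl
    have : f ∈ common G w u := by simp [hwf, hug]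
    simp [h3, Ne.symm haf, Ne.symm hbf, Ne.symm hcf, Ne.symm hdf] at this
  have hv := adj_iff_of_five hreg hva hvb hvc hvd hve hab hac had hae hbc hbd hbe hcd hce hde
  have hw := adj_iff_of_five hreg hwa hwb hwc hwd hwf hab hac had haf hbc hbd hbf hcd hcf hdf
  have hu := adj_iff_of_five hreg hua hub huc hud hug hab hac had hag hbc hbd hbg hcd hcg hdg
  have s1 := sign_of_common_eq_quad hs hvw hab hac had hbc hbd hcd h1
  have s2 := sign_of_common_eq_quad hs hvu hab hac had hbc hbd hcd h2
  have s3 := sign_of_common_eq_quad hs hwu hab hac had hbc hbd hcd h3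
  rcases signs_of_three_rows _ _ _ _ _ _ _ _ _ _ _ _ _ _ _ (entry hs hva) (entry hs hvb)
    (entry hs hvc) (entry hs hwa) (entry hs hwb) (entry hs hwc) (entry hs hua) (entry hs hub)
    (entry hs huc) (entry hs hvd) (entry hs hwd) (entry hs hud) (entry hs hvd) (entry hs hwd)
    (entry hs hud) s1 s2 s3 with ⟨k1, k2⟩ | ⟨k1, k2⟩ | ⟨k1, k2⟩
  · exact nonempty_iso_prism_aux hs hconn hreg htri (a := a) (b := b) (c := c) (d := d)
      (e := e) (f := f) (g := g) (by simp; grind) hvw hvu hwu hv hw hu k1 k2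
  · exact nonempty_iso_prism_aux hs hconn hreg htri (a := a) (b := c) (c := b) (d := d)
      (e := e) (f := f) (g := g) (by simp; grind) hvw hvu hwu (by grind) (by grind) (by grind) k1 k2
  · exact nonempty_iso_prism_aux hs hconn hreg htri (a := b) (b := c) (c := a) (d := d)
      (e := e) (f := f) (g := g) (by simp; grind) hvw hvu hwu (by grind) (by grind) (by grind) k1 k2

/-- If some vertex shares four neighbours with each of two others, the graph is determined. -/
lemma nonempty_iso_of_two_mates (hs : IsOrthogonalSigning G s) (hconn : G.Connected)
    (hreg : G.IsRegularOfDegree 5) (htri : G.CliqueFree 3) {v w u : V} (hvw : v ≠ w)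
    (hvu : v ≠ u) (hwu : w ≠ u) (hw : (common G v w).card = 4) (hu : (common G v u).card = 4) :
    Nonempty (G ≃g tripleRing 2) ∨ Nonempty (G ≃g prism (doubledCycle 4)) := by
  by_cases heq : common G v w = common G v u
  · right
    obtain ⟨a, b, c, d, hab, hac, had, hbc, hbd, hcd, h⟩ := card_eq_four.1 hw
    exact nonempty_iso_of_common_four hs hconn hreg htri hvw hvu hwu (by simp [*]) h
      (heq.symm.trans h)
  · left
    -- Two different 4-subsets of the five neighbours of `v` meet in exactly three elements.
    have hun : (common G v w ∪ common G v u).card ≤ 5 := by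
      rw [← hreg v]
      refine card_le_card fun x hx => ?_
      simp only [mem_union, mem_common] at hx
      rw [SimpleGraph.mem_neighborFinset]
      tauto
    have hinter := card_union_add_card_inter (common G v w) (common G v u)
    have hlt : (common G v w ∩ common G v u).card < 4 := by
      rw [← hw]
      refine card_lt_card ⟨inter_subset_left, fun h => heq ?_⟩
      exact eq_of_subset_of_card_le (h.trans inter_subset_right) (by omega)
    have h3 : (common G v w ∩ common G v u).card = 3 := by omega
    have hd : (common G v w \ common G v u).card = 1 := by
      have := card_sdiff_add_card_inter (common G v w) (common G v u)
      omega
    have he : (common G v u \ common G v w).card = 1 := by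
      have := card_sdiff_add_card_inter (common G v u) (common G v w)
      rw [inter_comm] at this
      omega
    obtain ⟨a, b, c, hab, hac, hbc, habc⟩ := card_eq_three.1 h3
    obtain ⟨d, hd⟩ := card_eq_one.1 hd
    obtain ⟨e, he⟩ := card_eq_one.1 he
    have e1 : common G v w = {a, b, c, d} := by
      rw [← sdiff_union_inter (common G v w) (common G v u), hd, habc]
      ext x; simp; tauto
    have e2 : common G v u = {a, b, c, e} := by
      rw [← sdiff_union_inter (common G v u) (common G v w), he, inter_comm, habc]
      ext x; simp; tauto
    have hd' : d ∈ common G v w \ common G v u := by simp [hd]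
    have he' : e ∈ common G v u \ common G v w := by simp [he]
    simp only [mem_sdiff, e1, e2, mem_insert, mem_singleton] at hd' he'
    exact nonempty_iso_of_common_three hs hconn hreg htri hvw hvu hwu (by simp; grind) e1 e2

end Mates

/-! ### Unique mates: pairing and matching -/

section UniqueMates

variable {V : Type*} [Fintype V] [DecidableEq V] {G : SimpleGraph V} [DecidableRel G.Adj]
  {s : V → V → ℤ}

/-- Two distinct vertices are mates if they have four neighbours in common. -/
def Mate (G : SimpleGraph V) [DecidableRel G.Adj] (v w : V) : Prop :=
  v ≠ w ∧ (common G v w).card = 4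

lemma Mate.symm {v w : V} (h : Mate G v w) : Mate G w v :=
  ⟨h.1.symm, common_comm (G := G) v w ▸ h.2⟩

lemma mate_of_three (hs : IsOrthogonalSigning G s) (hreg : G.IsRegularOfDegree 5) {u w i j k : V}
    (h : u ≠ w) (hij : i ≠ j) (hik : i ≠ k) (hjk : j ≠ k) (hui : G.Adj u i) (hwi : G.Adj w i)
    (huj : G.Adj u j) (hwj : G.Adj w j) (huk : G.Adj u k) (hwk : G.Adj w k) : Mate G u w := by
  obtain ⟨l, hil, hjl, hkl, hl⟩ := exists_fourth hs hreg h hij hik hjk hui hwi huj hwj huk hwk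
  refine ⟨h, ?_⟩
  rw [hl, card_insert_of_notMem, card_insert_of_notMem, card_insert_of_notMem, card_singleton]
  all_goals simp [*]

/-- Vertices with the same relative sign in two columns show that these columns are mates. -/
lemma mate_of_sign (hs : IsOrthogonalSigning G s) (hreg : G.IsRegularOfDegree 5) {v w a b : V}
    (hvw : v ≠ w) (hab : a ≠ b) (hva : G.Adj v a) (hvb : G.Adj v b) (hwa : G.Adj w a)
    (hwb : G.Adj w b) (h : s v a * s w a = s v b * s w b) : Mate G a b := by
  refine ⟨hab, ?_⟩
  have hsub : ({v, w} : Finset V) ⊆ common G a b := by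
    intro x hx
    simp only [mem_insert, mem_singleton] at hx
    rw [mem_common]
    rcases hx with rfl | rfl
    exacts [⟨hva.symm, hvb.symm⟩, ⟨hwa.symm, hwb.symm⟩]
  have hle := card_le_card hsub
  rw [card_pair hvw] at hle
  rcases card_common hs hreg hab with h0 | h2 | h4
  · omega
  -- With `v` and `w` as the only common rows, orthogonality of `a` and `b` would make the signs
  -- opposite.
  · have heq := eq_of_subset_of_card_le hsub (by rw [card_pair hvw, h2])
    have hsum := sign_of_common_eq_pair hs hab hvw heq.symm
    rw [entry_comm hs v a v b, entry_comm hs w a w b] at hsum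
    rcases entry hs hva with h4 | h4 <;> rcases entry hs hvb with h5 | h5 <;>
      rcases entry hs hwa with h6 | h6 <;> rcases entry hs hwb with h7 | h7 <;>
      rw [h4, h5, h6, h7] at h hsum <;> omega
  · exact h4

lemma split_four_signs (p q r t : ℤ) (hp : p = 1 ∨ p = -1) (hq : q = 1 ∨ q = -1)
    (hr : r = 1 ∨ r = -1) (ht : t = 1 ∨ t = -1) (h : p + q + r + t = 0) :
    (p = q ∧ r = t) ∨ (p = r ∧ q = t) ∨ (p = t ∧ q = r) := by
  omega

/-- The common neighbours of two mates form two pairs of mates. -/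
lemma Mate.exists_common (hs : IsOrthogonalSigning G s) (hreg : G.IsRegularOfDegree 5) {v w : V}
    (h : Mate G v w) : ∃ a a' b b', [a, a', b, b'].Nodup ∧ common G v w = {a, a', b, b'} ∧
      Mate G a a' ∧ Mate G b b' := by
  have hvw := h.1
  obtain ⟨a, b, c, d, hab, hac, had, hbc, hbd, hcd, hcom⟩ := card_eq_four.1 h.2
  obtain ⟨hva, hwa⟩ := adj_of_common_eq hcom (x := a) (by simp)
  obtain ⟨hvb, hwb⟩ := adj_of_common_eq hcom (x := b) (by simp)
  obtain ⟨hvc, hwc⟩ := adj_of_common_eq hcom (x := c) (by simp)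
  obtain ⟨hvd, hwd⟩ := adj_of_common_eq hcom (x := d) (by simp)
  have hsum := sign_of_common_eq_quad hs hvw hab hac had hbc hbd hcd hcom
  have pm : ∀ x, G.Adj v x → G.Adj w x → s v x * s w x = 1 ∨ s v x * s w x = -1 := by
    intro x h1 h2
    rcases entry hs h1 with h | h <;> rcases entry hs h2 with h' | h' <;> simp [h, h']
  have ea := pm a hva hwa
  have eb := pm b hvb hwb
  have ec := pm c hvc hwc
  have ed := pm d hvd hwd
  -- Two of the four relative signs are positive and two are negative; columns with equal relative
  -- sign are mates.
  have hcases := split_four_signs _ _ _ _ ea eb ec ed hsum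
  rcases hcases with ⟨h1, h2⟩ | ⟨h1, h2⟩ | ⟨h1, h2⟩
  · exact ⟨a, b, c, d, by simp [*], hcom,
      mate_of_sign hs hreg hvw hab hva hvb hwa hwb h1,
      mate_of_sign hs hreg hvw hcd hvc hvd hwc hwd h2⟩
  · exact ⟨a, c, b, d, by simp [*, Ne.symm hbc], by rw [hcom, insert_comm b c],
      mate_of_sign hs hreg hvw hac hva hvc hwa hwc h1,
      mate_of_sign hs hreg hvw hbd hvb hvd hwb hwd h2⟩
  · exact ⟨a, d, b, c, by simp [*, Ne.symm hbd, Ne.symm hcd],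
      by rw [hcom, pair_comm c d, insert_comm b d],
      mate_of_sign hs hreg hvw had hva hvd hwa hwd h1,
      mate_of_sign hs hreg hvw hbc hvb hvc hwb hwc h2⟩

/-- The neighbourhood of a vertex with a mate, when mates are unique. -/
lemma Mate.exists_neighbours (hs : IsOrthogonalSigning G s) (hreg : G.IsRegularOfDegree 5)
    (huniq : ∀ v w u, Mate G v w → Mate G v u → w = u) {v w : V} (h : Mate G v w) :
    ∃ a a' b b' e e', Mate G a a' ∧ Mate G b b' ∧ Mate G e e' ∧ [a, a', b, b', e].Nodup ∧
      (∀ x, G.Adj v x ↔ x = a ∨ x = a' ∨ x = b ∨ x = b' ∨ x = e) ∧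
      (∀ x, G.Adj w x ↔ x = a ∨ x = a' ∨ x = b ∨ x = b' ∨ x = e') := by
  have hvw := h.1
  obtain ⟨a, b, c, d, hnd, hcom, hMab, hMcd⟩ := h.exists_common hs hreg
  simp only [List.nodup_cons, List.mem_cons, List.not_mem_nil, or_false, not_or,
    not_false_eq_true, List.nodup_nil, and_true] at hnd
  obtain ⟨⟨hab, hac, had⟩, ⟨hbc, hbd⟩, hcd⟩ := hnd
  obtain ⟨hva, hwa⟩ := adj_of_common_eq hcom (x := a) (by simp)
  obtain ⟨hvb, hwb⟩ := adj_of_common_eq hcom (x := b) (by simp)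
  obtain ⟨hvc, hwc⟩ := adj_of_common_eq hcom (x := c) (by simp)
  obtain ⟨hvd, hwd⟩ := adj_of_common_eq hcom (x := d) (by simp)
  obtain ⟨e, hve, hae, hbe, hce, hde, hv⟩ :=
    exists_fifth hreg hva hvb hvc hvd hab hac had hbc hbd hcd
  obtain ⟨f, hwf, haf, hbf, hcf, hdf, hw⟩ :=
    exists_fifth hreg hwa hwb hwc hwd hab hac had hbc hbd hcd
  have hwe : ¬ G.Adj w e := by
    intro h
    have : e ∈ common G v w := by simp [hve, h]
    simp [hcom, Ne.symm hae, Ne.symm hbe, Ne.symm hce, Ne.symm hde] at this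
  have hef : e ≠ f := by rintro rfl; exact hwe hwf
  -- The vertices `x` and `e` share `v` and hence another `y`, which is not a mate of `v` by
  -- uniqueness and so shares only `x`, `e` with it. But `y` and `w` share `x` and so one more
  -- vertex, which can only be `f`. Different `x` give different `y`; three of them make `e` and `f`
  -- mates.
  have hex : ∀ x, G.Adj v x → G.Adj w x → ∃ y, y ∈ common G e f ∧ common G v y = {x, e} := by
    intro x hvx hwx
    have hxe : x ≠ e := by rintro rfl; exact hwe hwx
    obtain ⟨y, hyv, hxy, hey⟩ := exists_other hs hxe hvx.symm hve.symm
    have hwy : y ≠ w := by rintro rfl; exact hwe hey.symm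
    have hnm : ¬ Mate G v y := fun h' => hwy (huniq v y w h' h)
    have hsub : ({x, e} : Finset V) ⊆ common G v y := by
      intro z hz
      simp only [mem_insert, mem_singleton] at hz
      rcases hz with rfl | rfl <;> simp [*, hxy.symm, hey.symm]
    have heq : common G v y = {x, e} := by
      refine (eq_of_subset_of_card_le hsub ?_).symm
      rw [card_pair hxe]
      rcases card_common hs hreg (Ne.symm hyv) with h0 | h2 | h4
      · omega
      · omega
      · exact absurd ⟨Ne.symm hyv, h4⟩ hnm
    obtain ⟨z, hzx, hyz, hwz⟩ := exists_other hs hwy hxy.symm hwx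
    have hzf : z = f := by
      by_contra hzf
      have hvz : G.Adj v z := by
        rcases hw z hwz with rfl | rfl | rfl | rfl | rfl
        · exact hva
        · exact hvb
        · exact hvc
        · exact hvd
        · exact absurd rfl hzf
      have : z ∈ common G v y := by simp [hvz, hyz]
      rw [heq, mem_insert, mem_singleton] at this
      rcases this with rfl | rfl
      · exact hzx rfl
      · exact hwe hwz
    subst hzf
    exact ⟨y, by simp [hey, hyz.symm], heq⟩
  have hinj : ∀ x x' y, x ≠ x' → x ≠ e → common G v y = {x, e} → common G v y ≠ {x', e} := by
    intro x x' y hne hxe h1 h2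
    have : x ∈ ({x', e} : Finset V) := by rw [← h2, h1]; simp
    simp [hne, hxe] at this
  obtain ⟨ya, hya, hya'⟩ := hex a hva hwa
  obtain ⟨yb, hyb, hyb'⟩ := hex b hvb hwb
  obtain ⟨yc, hyc, hyc'⟩ := hex c hvc hwc
  have hM : Mate G e f := by
    simp only [mem_common] at hya hyb hyc
    refine mate_of_three hs hreg hef (i := ya) (j := yb) (k := yc) ?_ ?_ ?_ hya.1 hya.2 hyb.1
      hyb.2 hyc.1 hyc.2
    · rintro rfl; exact hinj a b ya hab hae hya' hyb'
    · rintro rfl; exact hinj a c ya hac hae hya' hyc'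
    · rintro rfl; exact hinj b c yb hbc hbe hyb' hyc'
  exact ⟨a, b, c, d, e, f, hMab, hMcd, hM, by simp [*],
    adj_iff_of_five hreg hva hvb hvc hvd hve hab hac had hae hbc hbd hbe hcd hce hde,
    adj_iff_of_five hreg hwa hwb hwc hwd hwf hab hac had haf hbc hbd hbf hcd hcf hdf⟩

/-- If mates are unique and one vertex has a mate, then all have. -/
lemma Mate.exists_of_connected (hs : IsOrthogonalSigning G s) (hconn : G.Connected)
    (hreg : G.IsRegularOfDegree 5) (huniq : ∀ v w u, Mate G v w → Mate G v u → w = u) {v w : V}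
    (h : Mate G v w) (x : V) : ∃ y, Mate G x y := by
  have hx := hconn.preconnected v x
  rw [SimpleGraph.reachable_iff_reflTransGen] at hx
  induction hx with
  | refl => exact ⟨w, h⟩
  | tail _ hadj ih =>
    obtain ⟨y, hy⟩ := ih
    obtain ⟨a, a', b, b', e, e', ha, hb, he, -, hv, -⟩ := hy.exists_neighbours hs hreg huniq
    rcases (hv _).1 hadj with rfl | rfl | rfl | rfl | rfl
    exacts [⟨_, ha⟩, ⟨_, ha.symm⟩, ⟨_, hb⟩, ⟨_, hb.symm⟩, ⟨_, he⟩]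

/-- `F x y`: both `x` and its mate are adjacent to `y`. -/
def FullAdj (G : SimpleGraph V) (μ : V → V) (x y : V) : Prop := G.Adj x y ∧ G.Adj (μ x) y

/-- The structure of the graph when every vertex has a unique mate: `μ x` is the mate of `x` and
`ν x` the neighbour of `x` which is not adjacent to `μ x`. -/
structure MateStructure (G : SimpleGraph V) (μ ν : V → V) : Prop where
  mate_mate : ∀ x, μ (μ x) = x
  mate_ne : ∀ x, μ x ≠ x
  full_symm : ∀ x y, FullAdj G μ x y → FullAdj G μ y x
  adj_iff : ∀ x y, G.Adj x y ↔ FullAdj G μ x y ∨ y = ν x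
  match_match : ∀ x, ν (ν x) = x
  match_mate : ∀ x, ν (μ x) = μ (ν x)
  not_full_match : ∀ x, ¬ FullAdj G μ x (ν x)
  full_match : ∀ x y, FullAdj G μ x y → FullAdj G μ (ν x) (ν y)
  full_iff : ∀ x, ∃ a b, a ≠ b ∧ a ≠ μ b ∧
    ∀ y, FullAdj G μ x y ↔ y = a ∨ y = μ a ∨ y = b ∨ y = μ b
  eq_mate : ∀ u w i j k, u ≠ w → i ≠ j → i ≠ k → j ≠ k → G.Adj u i → G.Adj w i → G.Adj u j →
    G.Adj w j → G.Adj u k → G.Adj w k → w = μ u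

/-- The four common neighbours of `x` and `μ x` are two mate pairs, so full adjacency depends only
on mate classes. The leftover neighbours give `ν`, an involution commuting with `μ`, because an edge
that is full at one end is full at the other. -/
lemma exists_mateStructure (hs : IsOrthogonalSigning G s) (hconn : G.Connected)
    (hreg : G.IsRegularOfDegree 5) (huniq : ∀ v w u, Mate G v w → Mate G v u → w = u) {v w : V}
    (h : Mate G v w) : ∃ μ ν : V → V, MateStructure G μ ν := by
  choose μ hμ using h.exists_of_connected hs hconn hreg huniq
  have hμμ : ∀ x, μ (μ x) = x := fun x => huniq _ _ _ (hμ (μ x)) (hμ x).symm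
  have hloc : ∀ v, ∃ a b e, [a, μ a, b, μ b, e].Nodup ∧
      (∀ x, G.Adj v x ↔ x = a ∨ x = μ a ∨ x = b ∨ x = μ b ∨ x = e) ∧
      (∀ x, G.Adj (μ v) x ↔ x = a ∨ x = μ a ∨ x = b ∨ x = μ b ∨ x = μ e) := by
    intro v
    obtain ⟨a, a', b, b', e, e', ha, hb, he, hnd, h1, h2⟩ :=
      (hμ v).exists_neighbours hs hreg huniq
    obtain rfl := huniq _ _ _ ha (hμ a)
    obtain rfl := huniq _ _ _ hb (hμ b)
    obtain rfl := huniq _ _ _ he (hμ e)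
    exact ⟨a, b, e, hnd, h1, h2⟩
  choose α β ν hnd hN hN' using hloc
  have hν_ne : ∀ x, μ (ν x) ≠ ν x := fun x h => (hμ (ν x)).1 h.symm
  have hfull : ∀ x y, FullAdj G μ x y ↔ y = α x ∨ y = μ (α x) ∨ y = β x ∨ y = μ (β x) := by
    intro x y
    have h2 : ¬ (y = ν x ∧ y = μ (ν x)) := fun h => hν_ne x (h.2.symm.trans h.1)
    rw [FullAdj, hN x, hN' x]
    tauto
  have hadj : ∀ x y, G.Adj x y ↔ FullAdj G μ x y ∨ y = ν x := by
    intro x y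
    rw [hfull, hN]
    tauto
  have hfμ : ∀ x y, FullAdj G μ x y → FullAdj G μ x (μ y) := by
    intro x y h
    rw [hfull] at h ⊢
    rcases h with rfl | rfl | rfl | rfl <;> simp [hμμ]
  have hfμ' : ∀ x y, FullAdj G μ x y → FullAdj G μ (μ x) y := by
    intro x y h
    exact ⟨h.2, by rw [hμμ]; exact h.1⟩
  have hsymm : ∀ x y, FullAdj G μ x y → FullAdj G μ y x := fun x y h =>
    ⟨h.1.symm, (hfμ x y h).1.symm⟩
  have hnf : ∀ x, ¬ FullAdj G μ x (ν x) := by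
    intro x h
    have h1 := hnd x
    rw [hfull] at h
    rcases h with h | h | h | h <;> simp [h] at h1
  have hνadj : ∀ x, G.Adj x (ν x) := fun x => (hadj _ _).2 (Or.inr rfl)
  have hνν : ∀ x, ν (ν x) = x := by
    intro x
    rcases (hadj _ _).1 (hνadj x).symm with h | h
    · exact absurd (hsymm _ _ h) (hnf x)
    · exact h.symm
  have hνμ : ∀ x, ν (μ x) = μ (ν x) := by
    intro x
    have h1 : G.Adj (μ x) (μ (ν x)) := by simp [hN']
    rcases (hadj _ _).1 h1 with h | h
    · have h2 := hfμ _ _ (hfμ' _ _ h)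
      rw [hμμ, hμμ] at h2
      exact absurd h2 (hnf x)
    · exact h.symm
  refine ⟨μ, ν, hμμ, fun x h => (hμ x).1 h.symm, hsymm, hadj, hνν, hνμ, hnf, ?_, fun x =>
    ⟨α x, β x, ?_, ?_, hfull x⟩,
    fun u w i j k h1 h2 h3 h4 h5 h6 h7 h8 h9 h10 =>
      huniq _ _ _ (mate_of_three hs hreg h1 h2 h3 h4 h5 h6 h7 h8 h9 h10) (hμ u)⟩
  · intro x y hxy
    have hne : y ≠ ν x := by rintro rfl; exact hnf x hxy
    obtain ⟨z, hzx, hyz, hez⟩ := exists_other hs hne hxy.1.symm (hνadj x).symm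
    -- If `y` were fully adjacent to `z`, then `x` and `z` would share `y`, `μ y` and `ν x`, which
    -- makes them mates and `ν x` fully adjacent to `x`.
    have hz : z = ν y := by
      rcases (hadj _ _).1 hyz with h | h
      · exfalso
        have hyy : y ≠ μ y := (hμ y).1
        have hne' : μ y ≠ ν x := by
          intro h'
          exact hnf x (h' ▸ hfμ _ _ hxy)
        have hM : Mate G x z := mate_of_three hs hreg (Ne.symm hzx) hyy hne hne' hxy.1 hyz.symm
          (hfμ _ _ hxy).1 h.2.symm (hνadj x) hez.symm
        have := huniq _ _ _ hM (hμ x)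
        subst this
        exact hnf x ⟨hνadj x, hez.symm⟩
      · exact h
    rcases (hadj _ _).1 hez with h | h
    · rwa [hz] at h
    · rw [hνν] at h
      exact absurd h hzx
  · have h1 := hnd x
    simp at h1
    tauto
  · have h1 := hnd x
    simp at h1
    tauto

end UniqueMates

/-! ### Full adjacency arranges the mate classes in cycles -/

section Cycles

variable {V : Type*} [Fintype V] [DecidableEq V] {G : SimpleGraph V} [DecidableRel G.Adj]
  {μ ν : V → V}

/-- `x` and `y` are equal or mates. -/
def SameClass (μ : V → V) (x y : V) : Prop := y = x ∨ y = μ x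

namespace MateStructure

variable (M : MateStructure G μ ν)
include M

lemma same_refl (x : V) : SameClass μ x x := Or.inl rfl

lemma same_symm {x y : V} (h : SameClass μ x y) : SameClass μ y x := by
  rcases h with rfl | rfl
  · exact Or.inl rfl
  · exact Or.inr (M.mate_mate x).symm

lemma same_trans {x y z : V} (h : SameClass μ x y) (h' : SameClass μ y z) : SameClass μ x z := by
  rcases h with rfl | rfl
  · exact h'
  · rcases h' with rfl | rfl
    · exact Or.inr rfl
    · exact Or.inl (M.mate_mate x)

lemma full_mate_left {x y : V} (h : FullAdj G μ x y) : FullAdj G μ (μ x) y :=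
  ⟨h.2, by rw [M.mate_mate]; exact h.1⟩

lemma full_congr {x x' y y' : V} (h : FullAdj G μ x y) (hx : SameClass μ x x')
    (hy : SameClass μ y y') : FullAdj G μ x' y' := by
  have h1 : FullAdj G μ x' y := by
    rcases hx with rfl | rfl
    exacts [h, M.full_mate_left h]
  have h2 := M.full_symm _ _ h1
  refine M.full_symm _ _ ?_
  rcases hy with rfl | rfl
  exacts [h2, M.full_mate_left h2]

lemma not_same_of_full {x y : V} (h : FullAdj G μ x y) : ¬ SameClass μ x y := by
  rintro (rfl | rfl)
  · exact G.irrefl h.1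
  · exact G.irrefl h.2

lemma exists_next {x y : V} (h : FullAdj G μ x y) : ∃ z, FullAdj G μ y z ∧ ¬ SameClass μ x z := by
  obtain ⟨a, b, hab, hab', hf⟩ := M.full_iff y
  by_cases ha : SameClass μ x a
  · refine ⟨b, (hf b).2 (by simp), fun hb => ?_⟩
    rcases M.same_trans (M.same_symm ha) hb with h | h
    · exact hab h.symm
    · exact hab' (by rw [h, M.mate_mate])
  · exact ⟨a, (hf a).2 (by simp), ha⟩

/-- Each class has exactly two neighbouring classes, so a walk that does not backtrack is determined
by two consecutive classes. -/
lemma same_of_full {x y z z' : V} (hx : FullAdj G μ y x) (hz : FullAdj G μ y z)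
    (hz' : FullAdj G μ y z') (hxz : ¬ SameClass μ x z) (hxz' : ¬ SameClass μ x z') :
    SameClass μ z z' := by
  obtain ⟨a, b, -, -, hf⟩ := M.full_iff y
  have key : ∀ t, FullAdj G μ y t → SameClass μ a t ∨ SameClass μ b t := by
    intro t ht
    rcases (hf t).1 ht with h | h | h | h
    exacts [Or.inl (Or.inl h), Or.inl (Or.inr h), Or.inr (Or.inl h), Or.inr (Or.inr h)]
  rcases key x hx with h1 | h1 <;> rcases key z hz with h2 | h2 <;> rcases key z' hz' with h3 | h3
  · exact absurd (M.same_trans (M.same_symm h1) h2) hxz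
  · exact absurd (M.same_trans (M.same_symm h1) h2) hxz
  · exact absurd (M.same_trans (M.same_symm h1) h3) hxz'
  · exact M.same_trans (M.same_symm h2) h3
  · exact M.same_trans (M.same_symm h2) h3
  · exact absurd (M.same_trans (M.same_symm h1) h3) hxz'
  · exact absurd (M.same_trans (M.same_symm h1) h2) hxz
  · exact absurd (M.same_trans (M.same_symm h1) h2) hxz

lemma same_match {x y : V} (h : SameClass μ x y) : SameClass μ (ν x) (ν y) := by
  rcases h with rfl | rfl
  · exact Or.inl rfl
  · exact Or.inr (M.match_mate x)

omit M in
/-- A non-backtracking walk of full adjacencies. -/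
structure IsRay (G : SimpleGraph V) [DecidableRel G.Adj] (μ : V → V) (x : ℕ → V) : Prop where
  full : ∀ n, FullAdj G μ (x n) (x (n + 1))
  not_same : ∀ n, ¬ SameClass μ (x n) (x (n + 2))

lemma exists_isRay (v : V) : ∃ x : ℕ → V, IsRay G μ x := by
  obtain ⟨a, b, -, -, hf⟩ := M.full_iff v
  have : Nonempty V := ⟨v⟩
  choose! g hg hg' using fun (p : V × V) (h : FullAdj G μ p.1 p.2) => M.exists_next h
  let y : ℕ → V × V := fun n => Nat.rec (v, a) (fun _ p => (p.2, g p)) n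
  have hy : ∀ n, FullAdj G μ (y n).1 (y n).2 := by
    intro n
    induction n with
    | zero => exact (hf a).2 (by simp)
    | succ n ih => exact hg _ ih
  exact ⟨fun n => (y n).1, fun n => hy n, fun n => hg' _ (hy n)⟩

variable {x : ℕ → V} (hx : IsRay G μ x)
include hx

omit [Fintype V] [DecidableEq V] M in
lemma isRay_shift (n : ℕ) : IsRay G μ fun k => x (k + n) :=
  ⟨fun k => by simpa [add_right_comm] using hx.full (k + n),
   fun k => by simpa [add_right_comm] using hx.not_same (k + n)⟩

/-- A vertex fully adjacent to a vertex of a ray belongs to the class of one of its neighbours. -/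
lemma same_of_full_ray (n : ℕ) {y : V} (h : FullAdj G μ (x (n + 1)) y) :
    SameClass μ (x n) y ∨ SameClass μ (x (n + 2)) y := by
  by_cases h' : SameClass μ (x n) y
  · exact Or.inl h'
  · exact Or.inr (M.same_of_full (M.full_symm _ _ (hx.full n)) (hx.full (n + 1)) h
      (hx.not_same n) h')

/-- By finiteness some class recurs; take the first index `m` whose class occurred before, at `i`.
The class of `x (m - 1)` is a neighbour of that of `x i`. If `i > 0`, it is one of the two
neighbouring classes already on the walk, which contradicts minimality; so `i = 0`. Periods 1, 2 and
3 would mean a loop, a backtracking step and a triangle. -/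
lemma exists_period (htri : G.CliqueFree 3) : ∃ m, 4 ≤ m ∧
    (∀ n, SameClass μ (x n) (x (n + m))) ∧
    ∀ i j, i < m → j < m → SameClass μ (x i) (x j) → i = j := by
  have hex : ∃ m, ∃ i < m, SameClass μ (x i) (x m) := by
    obtain ⟨i, j, hij, h⟩ := Finite.exists_ne_map_eq_of_infinite x
    rcases lt_or_gt_of_ne hij with h' | h'
    · exact ⟨j, i, h', Or.inl h.symm⟩
    · exact ⟨i, j, h', Or.inl h⟩
  classical
  let m := Nat.find hex
  obtain ⟨i, him, hi⟩ : ∃ i < m, SameClass μ (x i) (x m) := Nat.find_spec hex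
  have hmin : ∀ i j, i < j → j < m → ¬ SameClass μ (x i) (x j) := fun i j h1 h2 h3 =>
    Nat.find_min hex h2 ⟨i, h1, h3⟩
  have hinj : ∀ i j, i < m → j < m → SameClass μ (x i) (x j) → i = j := by
    intro i j hi hj h
    rcases lt_trichotomy i j with h' | h' | h'
    · exact absurd h (hmin i j h' hj)
    · exact h'
    · exact absurd (M.same_symm h) (hmin j i h' hi)
  have hne1 : i + 1 ≠ m := by
    intro h
    exact M.not_same_of_full (hx.full i) (h ▸ hi)
  have hne2 : i + 2 ≠ m := by
    intro h
    exact hx.not_same i (h ▸ hi)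
  obtain ⟨k, hk⟩ : ∃ k, m = k + 1 := ⟨m - 1, by omega⟩
  have hlast : FullAdj G μ (x i) (x k) := by
    have := hx.full k
    rw [← hk] at this
    exact M.full_symm _ _ (M.full_congr this (M.same_refl _) (M.same_symm hi))
  have hi0 : i = 0 := by
    by_contra hi0
    obtain ⟨j, rfl⟩ : ∃ j, i = j + 1 := ⟨i - 1, by omega⟩
    rcases M.same_of_full_ray hx j hlast with h | h
    · exact hmin j k (by omega) (by omega) h
    · exact hmin (j + 2) k (by omega) (by omega) h
  subst hi0
  have hm4 : 4 ≤ m := by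
    by_contra h
    have hk2 : k = 2 := by omega
    rw [hk2] at hlast
    exact false_of_triangle htri (hx.full 0).1 (hx.full 1).1 hlast.1.symm
  refine ⟨m, hm4, ?_, hinj⟩
  have h1 : SameClass μ (x 1) (x (1 + m)) := by
    have hf : FullAdj G μ (x 0) (x (1 + m)) := by
      rw [add_comm]
      exact M.full_congr (hx.full m) (M.same_symm hi) (M.same_refl _)
    refine M.same_of_full hlast (hx.full 0) hf ?_ ?_
    · intro h
      have := hinj k 1 (by omega) (by omega) h
      omega
    · have := hx.not_same k
      rwa [show k + 2 = 1 + m by omega] at this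
  -- Two consecutive coincidences are carried along, since two classes determine the next one.
  have hall : ∀ n, SameClass μ (x n) (x (n + m)) ∧ SameClass μ (x (n + 1)) (x (n + 1 + m)) := by
    intro n
    induction n with
    | zero => exact ⟨by simpa using hi, by simpa using h1⟩
    | succ n ih =>
      refine ⟨ih.2, ?_⟩
      have hf : FullAdj G μ (x (n + 1)) (x (n + 2 + m)) := by
        have := hx.full (n + 1 + m)
        rw [show n + 1 + m + 1 = n + 2 + m by omega] at this
        exact M.full_congr this (M.same_symm ih.2) (M.same_refl _)
      refine M.same_of_full (M.full_symm _ _ (hx.full n)) (hx.full (n + 1)) hf (hx.not_same n) ?_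
      intro h
      have := hx.not_same (n + m)
      rw [show n + m + 2 = n + 2 + m by omega] at this
      exact this (M.same_trans (M.same_symm ih.1) h)
  exact fun n => (hall n).1

omit hx in
lemma same_mod {m : ℕ} (hper : ∀ n, SameClass μ (x n) (x (n + m))) (n : ℕ) :
    SameClass μ (x (n % m)) (x n) := by
  have : ∀ k r, SameClass μ (x r) (x (r + m * k)) := by
    intro k
    induction k with
    | zero => intro r; exact M.same_refl _
    | succ k ih =>
      intro r
      have := M.same_trans (ih r) (hper (r + m * k))
      rwa [add_assoc, ← Nat.mul_succ] at this
  have h := this (n / m) (n % m)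
  rwa [Nat.mod_add_div] at h

omit [Fintype V] M hx in
lemma val_eq_of_sub_val_eq_one {m : ℕ} (hm : 2 ≤ m) (i j : Fin m) :
    (j - i).val = 1 ↔ j.val = (i.val + 1) % m := by
  have hi := i.isLt
  have hj := j.isLt
  rw [Fin.sub_def]
  simp only
  rcases Nat.lt_or_ge (i.val + 1) m with h | h
  · rw [Nat.mod_eq_of_lt h]
    rcases Nat.lt_or_ge (m - i.val + j.val) m with h' | h'
    · rw [Nat.mod_eq_of_lt h']
      omega
    · rw [Nat.mod_eq_sub_mod h', Nat.mod_eq_of_lt (by omega)]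
      omega
  · have hi1 : i.val + 1 = m := by omega
    rw [hi1, Nat.mod_self]
    rcases Nat.lt_or_ge (m - i.val + j.val) m with h' | h'
    · rw [Nat.mod_eq_of_lt h']
      omega
    · rw [Nat.mod_eq_sub_mod h', Nat.mod_eq_of_lt (by omega)]
      omega

/-- The map from the doubled cycle given by representatives `z n` of the classes of a closed ray. -/
lemma full_of_doubledCycle_adj {m : ℕ} (hm : 2 ≤ m)
    (hper : ∀ n, SameClass μ (x n) (x (n + m))) {p q : Fin m × Bool}
    (h : (doubledCycle m).Adj p q) : FullAdj G μ (x p.1) (x q.1) := by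
  rw [doubledCycle_adj, val_eq_of_sub_val_eq_one hm, val_eq_of_sub_val_eq_one hm] at h
  rcases h with h | h
  · refine M.full_symm _ _ ?_
    rw [h]
    exact M.full_congr (hx.full _) (M.same_refl _) (M.same_symm (M.same_mod hper _))
  · rw [h]
    exact M.full_congr (hx.full _) (M.same_refl _) (M.same_symm (M.same_mod hper _))

lemma exists_adj_of_full {m : ℕ} (hm : 2 ≤ m) (hper : ∀ n, SameClass μ (x n) (x (n + m)))
    (i : Fin m) {y : V} (h : FullAdj G μ (x i) y) :
    ∃ j : Fin m, ((i - j).val = 1 ∨ (j - i).val = 1) ∧ SameClass μ (x j) y := by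
  -- Shifting by a period gives the position a predecessor even when `i` is zero.
  obtain ⟨k, hk⟩ : ∃ k, i.val + m = k + 1 := ⟨i.val + m - 1, by omega⟩
  have hf : FullAdj G μ (x (k + 1)) y := by
    rw [← hk]
    exact M.full_congr h (hper _) (M.same_refl _)
  rcases M.same_of_full_ray hx k hf with h | h
  · refine ⟨⟨k % m, Nat.mod_lt _ (by omega)⟩, Or.inl ?_, M.same_trans (M.same_mod hper k) h⟩
    rw [val_eq_of_sub_val_eq_one hm]
    simp only [Nat.mod_add_mod, ← hk, Nat.add_mod_right]
    exact (Nat.mod_eq_of_lt i.isLt).symm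
  · refine ⟨⟨(k + 2) % m, Nat.mod_lt _ (by omega)⟩, Or.inr ?_, M.same_trans (M.same_mod hper _) h⟩
    rw [val_eq_of_sub_val_eq_one hm]
    simp only
    rw [show k + 2 = i.val + 1 + m by omega, Nat.add_mod_right]

end MateStructure

end Cycles

/-! ### Prisms and antipodal doubled cycles -/

section Cycles

variable {V : Type*} [Fintype V] [DecidableEq V] {G : SimpleGraph V} [DecidableRel G.Adj]
  {μ ν : V → V}

/-- The two vertices `z i`, `μ (z i)` of each class. -/
def classLift (μ : V → V) {m : ℕ} (z : ℕ → V) (p : Fin m × Bool) : V :=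
  if p.2 then μ (z p.1) else z p.1

namespace MateStructure

variable (M : MateStructure G μ ν) {x z : ℕ → V} {m : ℕ}
include M

lemma same_classLift (hz : ∀ n < m, SameClass μ (x n) (z n)) (p : Fin m × Bool) :
    SameClass μ (x p.1) (classLift μ z p) := by
  refine M.same_trans (hz _ p.1.isLt) ?_
  unfold classLift
  split_ifs
  · exact Or.inr rfl
  · exact Or.inl rfl

lemma injective_classLift (hz : ∀ n < m, SameClass μ (x n) (z n))
    (hinj : ∀ i j, i < m → j < m → SameClass μ (x i) (x j) → i = j) :
    Function.Injective (classLift μ z : Fin m × Bool → V) := by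
  intro p q h
  have h1 : p.1 = q.1 := by
    refine Fin.ext (hinj _ _ p.1.isLt q.1.isLt ?_)
    exact M.same_trans (M.same_classLift hz p) (h ▸ M.same_symm (M.same_classLift hz q))
  obtain ⟨i, b⟩ := p
  obtain ⟨j, c⟩ := q
  obtain rfl : i = j := h1
  have := M.mate_ne (z i)
  cases b <;> cases c <;> simp only [classLift, if_true, if_false, Bool.false_eq_true] at h
  · rfl
  · exact absurd h.symm this
  · exact absurd h this
  · rfl

lemma exists_classLift (hz : ∀ n < m, SameClass μ (x n) (z n)) (i : Fin m) {y : V}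
    (h : SameClass μ (x i) y) : ∃ b, classLift μ z (i, b) = y := by
  rcases M.same_trans (M.same_symm (hz _ i.isLt)) h with h | h
  · exact ⟨false, by simp [classLift, h]⟩
  · exact ⟨true, by simp [classLift, h]⟩

/-- The ray and its image under `ν` are disjoint: the graph is a prism. -/
lemma nonempty_iso_prism (hconn : G.Connected) (hx : IsRay G μ x) (hm : 2 ≤ m)
    (hper : ∀ n, SameClass μ (x n) (x (n + m)))
    (hinj : ∀ i j, i < m → j < m → SameClass μ (x i) (x j) → i = j)
    (hdisj : ∀ i j, ¬ SameClass μ (ν (x i)) (x j)) :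
    Nonempty (G ≃g prism (doubledCycle m)) := by
  have hz : ∀ n < m, SameClass μ (x n) (x n) := fun n _ => M.same_refl _
  set f : Fin m × Bool → V := classLift μ x with hf
  have hfx := M.same_classLift hz
  have hfi := M.injective_classLift hz hinj
  have hνi : Function.Injective ν := fun a b h => by
    rw [← M.match_match a, h, M.match_match]
  have hne : ∀ p q, f p ≠ ν (f q) := by
    intro p q h
    refine hdisj q.1 p.1 ?_
    exact M.same_trans (M.same_match (hfx q)) (h ▸ M.same_symm (hfx p))
  have hνfull : ∀ a b, FullAdj G μ (ν a) b → ∃ c, b = ν c ∧ FullAdj G μ a c := by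
    intro a b h
    refine ⟨ν b, (M.match_match b).symm, ?_⟩
    have := M.full_match _ _ h
    rwa [M.match_match] at this
  have hfull : ∀ p q, (doubledCycle m).Adj p q → FullAdj G μ (f p) (f q) := fun p q h =>
    M.full_congr (M.full_of_doubledCycle_adj hx hm hper h) (hfx p) (hfx q)
  have hex : ∀ p y, FullAdj G μ (f p) y → ∃ q, (doubledCycle m).Adj p q ∧ f q = y := by
    intro p y h
    obtain ⟨j, hj, hjy⟩ := M.exists_adj_of_full hx hm hper p.1
      (M.full_congr h (M.same_symm (hfx p)) (M.same_refl y))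
    obtain ⟨b, hb⟩ := M.exists_classLift hz j hjy
    exact ⟨(j, b), (doubledCycle_adj _ _).2 hj, hb⟩
  have : Nonempty (Fin 2 × (Fin m × Bool)) := ⟨(0, (⟨0, by omega⟩, true))⟩
  refine nonempty_iso_of_locally_surjective hconn
    (fun p => if p.1 = 0 then f p.2 else ν (f p.2)) ?_ ?_ ?_
  · rintro ⟨i, p⟩ ⟨j, q⟩ h
    fin_cases i <;> fin_cases j
    · simpa using hfi h
    · exact absurd h (hne p q)
    · exact absurd h.symm (hne q p)
    · simpa using hfi (hνi h)
  · rintro ⟨i, p⟩ ⟨j, q⟩ h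
    rw [prism_adj] at h
    rcases h with ⟨h1, h2⟩ | ⟨h1, h2⟩
    · simp only at h1 h2
      subst h2
      have hadj : G.Adj (f p) (ν (f p)) := (M.adj_iff _ _).2 (Or.inr rfl)
      fin_cases i <;> fin_cases j
      · exact absurd rfl h1
      · exact hadj
      · exact hadj.symm
      · exact absurd rfl h1
    · simp only at h1 h2
      subst h1
      fin_cases i
      · exact (hfull p q h2).1
      · exact (M.full_match _ _ (hfull p q h2)).1
  · rintro ⟨i, p⟩ v h
    simp only [prism_adj]
    fin_cases i
    · rcases (M.adj_iff _ _).1 h with h | h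
      · obtain ⟨q, hq, rfl⟩ := hex p v h
        exact ⟨(0, q), Or.inr ⟨rfl, hq⟩, rfl⟩
      · exact ⟨(1, p), Or.inl ⟨by simp, rfl⟩, h.symm⟩
    · rcases (M.adj_iff _ _).1 h with h | h
      · obtain ⟨c, rfl, hc⟩ := hνfull _ _ h
        obtain ⟨q, hq, rfl⟩ := hex p c hc
        exact ⟨(1, q), Or.inr ⟨rfl, hq⟩, rfl⟩
      · refine ⟨(0, p), Or.inl ⟨by simp, rfl⟩, ?_⟩
        exact (M.match_match (f p)).symm.trans h.symm

/-- If `ν` maps the ray to itself, it acts as the shift by half the period. -/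
lemma match_eq_shift (htri : G.CliqueFree 3) (hx : IsRay G μ x) (hm : 4 ≤ m)
    (hper : ∀ n, SameClass μ (x n) (x (n + m)))
    (hinj : ∀ i j, i < m → j < m → SameClass μ (x i) (x j) → i = j) {c : ℕ} (hc : c < m)
    (h0 : SameClass μ (ν (x 0)) (x c)) :
    m = 2 * c ∧ ∀ n, SameClass μ (ν (x n)) (x (n + c)) := by
  have hmf : ∀ n, FullAdj G μ (ν (x n)) (ν (x (n + 1))) := fun n => M.full_match _ _ (hx.full n)
  have hmn : ∀ n, ¬ SameClass μ (ν (x n)) (ν (x (n + 2))) := by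
    intro n h
    have := M.same_match h
    rw [M.match_match, M.match_match] at this
    exact hx.not_same n this
  have hnn : ∀ n, ¬ SameClass μ (x n) (ν (x n)) := by
    intro n h
    have hadj := (M.adj_iff (x n) (ν (x n))).2 (Or.inr rfl)
    rcases h with h | h
    · exact G.irrefl (h ▸ hadj)
    · rw [h] at hadj
      exact false_of_triangle htri hadj (hx.full n).2 (hx.full n).1.symm
  have hnn' : ∀ n, ¬ SameClass μ (x (n + 1)) (ν (x n)) := fun n h =>
    M.not_full_match (x n) (M.full_congr (hx.full n) (M.same_refl _) h)
  have hc0 : c ≠ 0 := by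
    rintro rfl
    exact hnn 0 (M.same_symm h0)
  obtain ⟨k, rfl⟩ : ∃ k, c = k + 1 := ⟨c - 1, by omega⟩
  -- The involution acts on the cycle of classes as a reflection in the first case, and as a
  -- rotation in the second.
  rcases M.same_of_full_ray hx k (M.full_congr (hmf 0) h0 (M.same_refl _)) with h1 | h1
  · exfalso
    -- A reflection would, at the middle of the segment, fix a class or exchange two adjacent ones,
    -- according to the parity of `k`. The facts `hnn` and `hnn'` forbid this.
    have hrefl : ∀ n j, n + j = k → SameClass μ (ν (x n)) (x (j + 1)) ∧
        SameClass μ (ν (x (n + 1))) (x j) := by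
      intro n
      induction n with
      | zero =>
        intro j hj
        obtain rfl : j = k := by omega
        exact ⟨h0, M.same_symm h1⟩
      | succ n ih =>
        intro j hj
        obtain ⟨i1, i2⟩ := ih (j + 1) (by omega)
        refine ⟨i2, ?_⟩
        rcases M.same_of_full_ray hx j (M.full_congr (hmf (n + 1)) i2 (M.same_refl _)) with h | h
        · exact M.same_symm h
        · exact absurd (M.same_trans i1 h) (hmn n)
    rcases Nat.even_or_odd' k with ⟨d, hd | hd⟩
    · exact hnn' d (M.same_symm (hrefl d d (by omega)).1)
    · exact hnn (d + 1) (M.same_symm (hrefl d (d + 1) (by omega)).2)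
  · have hshift : ∀ n, SameClass μ (ν (x n)) (x (n + (k + 1))) ∧
        SameClass μ (ν (x (n + 1))) (x (n + 1 + (k + 1))) := by
      intro n
      induction n with
      | zero =>
        refine ⟨by simpa using h0, ?_⟩
        have := M.same_symm h1
        rwa [show k + 2 = 0 + 1 + (k + 1) by omega] at this
      | succ n ih =>
        obtain ⟨i1, i2⟩ := ih
        refine ⟨i2, ?_⟩
        rw [show n + 1 + (k + 1) = n + (k + 1) + 1 by omega] at i2
        rcases M.same_of_full_ray hx _ (M.full_congr (hmf (n + 1)) i2 (M.same_refl _)) with h | h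
        · exact absurd (M.same_trans i1 h) (hmn n)
        · have := M.same_symm h
          rwa [show n + (k + 1) + 2 = n + 1 + 1 + (k + 1) by omega] at this
    refine ⟨?_, fun n => (hshift n).1⟩
    -- Applying `ν` twice shifts by `2c` and does nothing; as `0 < 2c < 2m`, the period is `2c`.
    have h2 : SameClass μ (x 0) (x (k + 1 + (k + 1))) := by
      have h3 := M.same_match h0
      rw [M.match_match] at h3
      exact M.same_trans h3 (hshift (k + 1)).1
    by_contra hne
    rcases Nat.lt_or_ge (k + 1 + (k + 1)) m with h | h
    · have := hinj 0 _ (by omega) h h2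
      omega
    · obtain ⟨j, hj⟩ : ∃ j, k + 1 + (k + 1) = j + m := ⟨k + 1 + (k + 1) - m, by omega⟩
      rw [hj] at h2
      have := hinj 0 j (by omega) (by omega) (M.same_trans h2 (M.same_symm (hper j)))
      omega

/-- If `ν` acts on the ray as the shift by half the period, the graph is an antipodal doubled
cycle. -/
lemma nonempty_iso_antipodal (hconn : G.Connected) (hx : IsRay G μ x) {k : ℕ} (hk : 1 ≤ k)
    (hper : ∀ n, SameClass μ (x n) (x (n + 2 * k)))
    (hinj : ∀ i j, i < 2 * k → j < 2 * k → SameClass μ (x i) (x j) → i = j)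
    (hshift : ∀ n, SameClass μ (ν (x n)) (x (n + k))) :
    Nonempty (G ≃g antipodalDoubledCycle k) := by
  -- Representatives in the second half are images under `ν` of those in the first, so that `ν`
  -- preserves the Boolean coordinate.
  set z : ℕ → V := fun n => if n < k then x n else ν (x (n - k)) with hzdef
  have hz : ∀ n < 2 * k, SameClass μ (x n) (z n) := by
    intro n hn
    simp only [hzdef]
    split_ifs with h
    · exact M.same_refl _
    · have := M.same_symm (hshift (n - k))
      rwa [Nat.sub_add_cancel (by omega)] at this
  set f : Fin (2 * k) × Bool → V := classLift μ z with hf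
  have hfx := M.same_classLift hz
  have hfi := M.injective_classLift hz hinj
  have hanti : ∀ p q : Fin (2 * k) × Bool, q.1.val = p.1.val + k → p.2 = q.2 → f q = ν (f p) := by
    rintro ⟨i, b⟩ ⟨j, c⟩ h1 h2
    simp only at h1 h2
    subst h2
    have hj := j.isLt
    have hzz : z j = ν (z i) := by
      simp only [hzdef]
      rw [if_neg (by omega), if_pos (by omega), h1, Nat.add_sub_cancel]
    cases b
    · simpa [hf, classLift] using hzz
    · simp [hf, classLift, hzz, M.match_mate]
  have hadj : ∀ p q, (antipodalDoubledCycle k).Adj p q ↔ (doubledCycle (2 * k)).Adj p q ∨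
      (p ≠ q ∧ ((q.1.val = p.1.val + k ∧ p.2 = q.2) ∨ (p.1.val = q.1.val + k ∧ q.2 = p.2))) := by
    intro p q
    rw [antipodalDoubledCycle, SimpleGraph.sup_adj, SimpleGraph.fromRel_adj]
  have hνadj : ∀ v, G.Adj v (ν v) := fun v => (M.adj_iff _ _).2 (Or.inr rfl)
  have : Nonempty (Fin (2 * k) × Bool) := ⟨(⟨0, by omega⟩, true)⟩
  refine nonempty_iso_of_locally_surjective hconn f hfi ?_ ?_
  · intro p q h
    rcases (hadj p q).1 h with h | ⟨-, ⟨h1, h2⟩ | ⟨h1, h2⟩⟩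
    · exact (M.full_congr (M.full_of_doubledCycle_adj hx (by omega) hper h) (hfx p) (hfx q)).1
    · rw [hanti p q h1 h2]
      exact hνadj _
    · rw [hanti q p h1 h2]
      exact (hνadj _).symm
  · intro p v h
    simp only [hadj]
    rcases (M.adj_iff _ _).1 h with h | h
    · obtain ⟨j, hj, hjy⟩ := M.exists_adj_of_full hx (by omega) hper p.1
        (M.full_congr h (M.same_symm (hfx p)) (M.same_refl v))
      obtain ⟨b, hb⟩ := M.exists_classLift hz j hjy
      exact ⟨(j, b), Or.inl ((doubledCycle_adj _ _).2 hj), hb⟩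
    · obtain ⟨i, b⟩ := p
      have hi := i.isLt
      rcases Nat.lt_or_ge i.val k with hik | hik
      · refine ⟨(⟨i.val + k, by omega⟩, b), Or.inr ⟨?_, Or.inl ⟨rfl, rfl⟩⟩, ?_⟩
        · simp [Fin.ext_iff]
          omega
        · rw [h]
          exact hanti _ _ rfl rfl
      · have h1 : i.val = i.val - k + k := by omega
        refine ⟨(⟨i.val - k, by omega⟩, b), Or.inr ⟨?_, Or.inr ⟨h1, rfl⟩⟩, ?_⟩
        · simp [Fin.ext_iff]
          omega
        · rw [h, hanti (⟨i.val - k, by omega⟩, b) (i, b) h1 rfl, M.match_match]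

/-- The classification of the graphs with a mate structure. -/
theorem classification (hconn : G.Connected) (htri : G.CliqueFree 3) :
    (∃ m, 4 ≤ m ∧ Nonempty (G ≃g prism (doubledCycle m))) ∨
    (∃ k, 4 ≤ k ∧ Nonempty (G ≃g antipodalDoubledCycle k)) := by
  obtain ⟨v⟩ := hconn.nonempty
  obtain ⟨x, hx⟩ := M.exists_isRay v
  obtain ⟨m, hm, hper, hinj⟩ := M.exists_period hx htri
  by_cases hdisj : ∀ i j, ¬ SameClass μ (ν (x i)) (x j)
  · exact Or.inl ⟨m, hm, M.nonempty_iso_prism hconn hx (by omega) hper hinj hdisj⟩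
  · right
    push Not at hdisj
    obtain ⟨i, j, hij⟩ := hdisj
    -- The ray is restarted at `i`, because `match_eq_shift` needs the image of position 0. Adding
    -- periods brings `j` beyond `i`, so that the natural subtraction is exact.
    have hy := isRay_shift hx i
    obtain ⟨m', hm', hper', hinj'⟩ := M.exists_period hy htri
    have hfar : ∀ k, SameClass μ (x j) (x (j + k * m)) := by
      intro k
      induction k with
      | zero => simpa using M.same_refl _
      | succ k ih =>
        have := M.same_trans ih (hper (j + k * m))
        rwa [show j + k * m + m = j + (k + 1) * m by ring] at this
    have hle : i ≤ j + i * m :=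
      le_trans (Nat.le_mul_of_pos_right i (by omega)) (Nat.le_add_left _ _)
    have h0 : SameClass μ (ν (x (0 + i))) (x ((j + i * m - i) % m' + i)) := by
      rw [zero_add]
      refine M.same_trans (M.same_trans hij (hfar i)) (M.same_symm ?_)
      have := M.same_mod hper' (j + i * m - i)
      simpa only [Nat.sub_add_cancel hle] using this
    obtain ⟨hmc, hshift⟩ := M.match_eq_shift htri hy hm' hper' hinj' (Nat.mod_lt _ (by omega)) h0
    generalize (j + i * m - i) % m' = c at hmc hshift
    generalize hyx : (fun k => x (k + i)) = y at hy
    have hyx' : ∀ k, x (k + i) = y k := fun k => congrFun hyx k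
    simp only [hyx'] at hper' hinj' hshift
    subst hmc
    refine ⟨c, ?_, M.nonempty_iso_antipodal hconn hy (by omega) hper' hinj' hshift⟩
    by_contra hc
    have hνadj : ∀ v, G.Adj v (ν v) := fun v => (M.adj_iff _ _).2 (Or.inr rfl)
    -- For `c = 2`, `ν (y 0)` lies in the class of `y 2`, and `y 0`, `y 1`, `ν (y 0)` form a
    -- triangle. For `c = 3`, the vertices `y 0` and `y 2` share `y 1`, `μ (y 1)` and `ν (y 2)`, so
    -- they would be mates.
    obtain hc | hc : c = 2 ∨ c = 3 := by omega
    · have h1 := M.full_congr (hy.full 1) (M.same_refl _)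
        (M.same_symm (by simpa [hc] using hshift 0))
      exact false_of_triangle htri (hy.full 0).1 h1.1 (hνadj _).symm
    · have h1 : SameClass μ (ν (y 2)) (y 5) := by simpa [hc] using hshift 2
      have h2 : FullAdj G μ (ν (y 2)) (y 0) := by
        refine M.full_congr (hy.full 5) (M.same_symm h1) (M.same_symm ?_)
        simpa [hc] using hper' 0
      have h3 : ¬ SameClass μ (y 1) (ν (y 2)) := fun h => by
        have := hinj' 1 5 (by omega) (by omega) (M.same_trans h h1)
        omega
      refine hy.not_same 0 (Or.inr ?_)
      have h4 := M.full_symm _ _ (hy.full 0)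
      refine M.eq_mate (y 0) (y 2) (y 1) (μ (y 1)) (ν (y 2)) ?_ (M.mate_ne _).symm ?_ ?_
        (hy.full 0).1 (hy.full 1).1.symm h4.2.symm (hy.full 1).2.symm h2.1.symm (hνadj _)
      · intro h
        exact hy.not_same 0 (Or.inl h.symm)
      · intro h
        exact h3 (Or.inl h.symm)
      · intro h
        exact h3 (Or.inr h.symm)

end MateStructure

end Cycles

/-! ### No mates: columns as drawings on the neighbours of a vertex -/

section Star

variable {V : Type*} [Fintype V] [DecidableEq V] {G : SimpleGraph V} [DecidableRel G.Adj]
  {s : V → V → ℤ}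

/-- A connected `5`-regular triangle-free graph with an orthogonal signing in which two distinct
vertices have at most two common neighbours. -/
structure SignedRectagraph (G : SimpleGraph V) [DecidableRel G.Adj] (s : V → V → ℤ) : Prop where
  conn : G.Connected
  reg : G.IsRegularOfDegree 5
  tri : G.CliqueFree 3
  signing : IsOrthogonalSigning G s
  not_mate : ∀ u w, ¬ Mate G u w

/-- The vertex opposite to `v` in a quadrangle with neighbours `x`, `y` of `v`. -/
noncomputable def opp (G : SimpleGraph V) (v x y : V) : V :=
  @Classical.epsilon V ⟨v⟩ fun t => t ≠ v ∧ G.Adj t x ∧ G.Adj t y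

omit [Fintype V] [DecidableEq V] [DecidableRel G.Adj] in
lemma opp_comm (v x y : V) : opp G v x y = opp G v y x := by
  unfold opp
  congr 1
  funext t
  simp only [and_comm]

/-- A vertex `v` of a signed rectagraph, with a labelling `a` of its neighbours. -/
structure IsStar (G : SimpleGraph V) [DecidableRel G.Adj] (s : V → V → ℤ) (v : V)
    (a : Fin 5 → V) : Prop where
  rect : SignedRectagraph G s
  inj : Function.Injective a
  adj_iff : ∀ x, G.Adj v x ↔ ∃ i, a i = x

/-- `c` is not a neighbour of `v` and it is adjacent to the vertex opposite to `v` in the quadrangle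
through `a i` and `a j`. -/
def Col (G : SimpleGraph V) (v : V) (a : Fin 5 → V) (c : V) (i j : Fin 5) : Prop :=
  ¬ G.Adj v c ∧ G.Adj c (opp G v (a i) (a j))

lemma SignedRectagraph.two (R : SignedRectagraph G s) {u w i j k : V} (h : u ≠ w) (hij : i ≠ j)
    (hik : i ≠ k) (hjk : j ≠ k) (hui : G.Adj u i) (hwi : G.Adj w i) (huj : G.Adj u j)
    (hwj : G.Adj w j) (huk : G.Adj u k) (hwk : G.Adj w k) : False :=
  R.not_mate u w (mate_of_three R.signing R.reg h hij hik hjk hui hwi huj hwj huk hwk)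

/-- The two opposite corners have no other common neighbours, so orthogonality of their rows becomes
one relation per quadrangle. -/
lemma SignedRectagraph.sign (R : SignedRectagraph G s) {u w i j : V} (h : u ≠ w) (hij : i ≠ j)
    (hui : G.Adj u i) (hwi : G.Adj w i) (huj : G.Adj u j) (hwj : G.Adj w j) :
    s u i * s w i * (s u j * s w j) = -1 := by
  have hc : common G u w = {i, j} := by
    ext x
    simp only [mem_common, mem_insert, mem_singleton]
    constructor
    · rintro ⟨h1, h2⟩
      by_contra! hx
      exact R.two h hij hx.1.symm hx.2.symm hui hwi huj hwj h1 h2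
    · rintro (rfl | rfl) <;> simp [*]
  have hsum := sign_of_common_eq_pair R.signing h hij hc
  rcases entry R.signing hui with h4 | h4 <;> rcases entry R.signing hwi with h5 | h5 <;>
    rcases entry R.signing huj with h6 | h6 <;> rcases entry R.signing hwj with h7 | h7 <;>
    rw [h4, h5, h6, h7] at hsum ⊢ <;> omega

lemma exists_isStar (R : SignedRectagraph G s) (v : V) : ∃ a : Fin 5 → V, IsStar G s v a := by
  have hc : (G.neighborFinset v).card = 5 := by
    rw [SimpleGraph.card_neighborFinset_eq_degree, R.reg v]
  let e := (G.neighborFinset v).equivFinOfCardEq hc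
  refine ⟨fun i => (e.symm i : V), R, fun i j h => e.symm.injective (Subtype.ext h), fun x => ?_⟩
  constructor
  · intro h
    exact ⟨e ⟨x, by simpa using h⟩, by simp⟩
  · rintro ⟨i, rfl⟩
    exact (SimpleGraph.mem_neighborFinset _ _ _).1 (e.symm i).2

lemma eq_of_nodup_five {i j k l m : Fin 5} (h : [i, j, k, l, m].Nodup) (x : Fin 5) :
    x = i ∨ x = j ∨ x = k ∨ x = l ∨ x = m := by
  have h1 : [i, j, k, l, m].toFinset = univ := by
    rw [← card_eq_iff_eq_univ, List.toFinset_card_of_nodup h]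
    rfl
  have h2 : x ∈ [i, j, k, l, m].toFinset := h1 ▸ mem_univ x
  simpa using h2

omit [Fintype V] [DecidableEq V] [DecidableRel G.Adj] in
lemma Col.symm {v : V} {a : Fin 5 → V} {c : V} {i j : Fin 5} (h : Col G v a c i j) :
    Col G v a c j i :=
  ⟨h.1, by rw [opp_comm]; exact h.2⟩

namespace IsStar

variable {v : V} {a : Fin 5 → V} (S : IsStar G s v a)
include S

lemma comp (σ : Equiv.Perm (Fin 5)) : IsStar G s v (a ∘ σ) :=
  ⟨S.rect, S.inj.comp σ.injective, fun x => by
    rw [S.adj_iff]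
    exact ⟨fun ⟨i, hi⟩ => ⟨σ.symm i, by simpa using hi⟩, fun ⟨i, hi⟩ => ⟨σ i, hi⟩⟩⟩

lemma adj (i : Fin 5) : G.Adj v (a i) := (S.adj_iff _).2 ⟨i, rfl⟩

lemma opp_spec {i j : Fin 5} (h : i ≠ j) : opp G v (a i) (a j) ≠ v ∧
    G.Adj (opp G v (a i) (a j)) (a i) ∧ G.Adj (opp G v (a i) (a j)) (a j) := by
  obtain ⟨t, ht, hi, hj⟩ := exists_other S.rect.signing (S.inj.ne h) (S.adj i).symm (S.adj j).symm
  exact @Classical.epsilon_spec_aux V ⟨v⟩ (fun t => t ≠ v ∧ G.Adj t (a i) ∧ G.Adj t (a j))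
    ⟨t, ht, hi.symm, hj.symm⟩

lemma opp_ne {i j : Fin 5} (h : i ≠ j) : opp G v (a i) (a j) ≠ v := (S.opp_spec h).1

lemma opp_adj_left {i j : Fin 5} (h : i ≠ j) : G.Adj (opp G v (a i) (a j)) (a i) :=
  (S.opp_spec h).2.1

lemma opp_adj_right {i j : Fin 5} (h : i ≠ j) : G.Adj (opp G v (a i) (a j)) (a j) :=
  (S.opp_spec h).2.2

lemma eq_opp {i j : Fin 5} (h : i ≠ j) {x : V} (hx : x ≠ v) (hi : G.Adj x (a i))
    (hj : G.Adj x (a j)) : x = opp G v (a i) (a j) := by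
  by_contra hne
  exact S.rect.two (S.inj.ne h) hx hne (S.opp_ne h).symm hi.symm hj.symm (S.adj i).symm
    (S.adj j).symm (S.opp_adj_left h).symm (S.opp_adj_right h).symm

lemma opp_adj_iff {i j : Fin 5} (h : i ≠ j) (k : Fin 5) :
    G.Adj (opp G v (a i) (a j)) (a k) ↔ k = i ∨ k = j := by
  constructor
  · intro hk
    by_contra! hne
    exact S.rect.two (S.opp_ne h) (S.inj.ne h) (S.inj.ne hne.1.symm) (S.inj.ne hne.2.symm)
      (S.opp_adj_left h) (S.adj i) (S.opp_adj_right h) (S.adj j) hk (S.adj k)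
  · rintro (rfl | rfl)
    exacts [S.opp_adj_left h, S.opp_adj_right h]

/-- A vertex at distance two from `v` is opposite to `v` in some quadrangle. -/
lemma exists_eq_opp {i : Fin 5} {x : V} (hx : x ≠ v) (hi : G.Adj x (a i)) :
    ∃ j, i ≠ j ∧ x = opp G v (a i) (a j) := by
  obtain ⟨y, hy, hxy, hvy⟩ := exists_other S.rect.signing hx hi (S.adj i)
  obtain ⟨j, rfl⟩ := (S.adj_iff y).1 hvy
  have hij : i ≠ j := by rintro rfl; exact hy rfl
  exact ⟨j, hij, S.eq_opp hij hx hi hxy⟩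

lemma opp_injective {i j k : Fin 5} (hij : i ≠ j) (hik : i ≠ k)
    (h : opp G v (a i) (a j) = opp G v (a i) (a k)) : j = k := by
  have := S.opp_adj_right hik
  rw [← h, S.opp_adj_iff hij] at this
  rcases this with h | h
  · exact absurd h.symm hik
  · exact h.symm

lemma ne_of_col {c : V} {i j : Fin 5} (h : Col G v a c i j) (k : Fin 5) : c ≠ a k := by
  rintro rfl
  exact h.1 (S.adj k)

/-- The common neighbours of `c` and `a i` are exactly the vertices of the pairs at `i` that `c`
passes through, and there are none or two of them. This lemma gives the second one and `col_deg`
excludes a third. -/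
lemma col_next {c : V} {i j : Fin 5} (hij : i ≠ j) (h : Col G v a c i j) :
    ∃ k, k ≠ i ∧ k ≠ j ∧ Col G v a c i k := by
  obtain ⟨x, hx, hcx, hix⟩ := exists_other S.rect.signing (S.ne_of_col h i) h.2
    (S.opp_adj_left hij).symm
  have hxv : x ≠ v := by
    rintro rfl
    exact h.1 hcx.symm
  obtain ⟨k, hik, rfl⟩ := S.exists_eq_opp hxv hix.symm
  refine ⟨k, hik.symm, ?_, h.1, hcx⟩
  rintro rfl
  exact hx rfl

lemma col_deg {c : V} {i j k l : Fin 5} (hij : i ≠ j) (hik : i ≠ k) (hil : i ≠ l) (hjk : j ≠ k)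
    (hjl : j ≠ l) (hkl : k ≠ l) (h1 : Col G v a c i j) (h2 : Col G v a c i k)
    (h3 : Col G v a c i l) : False :=
  S.rect.two (S.ne_of_col h1 i) (fun h => hjk (S.opp_injective hij hik h))
    (fun h => hjl (S.opp_injective hij hil h)) (fun h => hkl (S.opp_injective hik hil h))
    h1.2 (S.opp_adj_left hij).symm h2.2 (S.opp_adj_left hik).symm h3.2 (S.opp_adj_left hil).symm

/-- The vertices of the pairs `ij` and `ik` share `a i` and one other vertex, so a path of length
two extends to exactly one column; `exists_col` is the existence part. -/
lemma col_unique {c d : V} {i j k : Fin 5} (hij : i ≠ j) (hik : i ≠ k) (hjk : j ≠ k)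
    (h1 : Col G v a c i j) (h2 : Col G v a c i k) (h3 : Col G v a d i j) (h4 : Col G v a d i k) :
    c = d := by
  by_contra hne
  exact S.rect.two (fun h => hjk (S.opp_injective hij hik h)) hne (S.ne_of_col h1 i)
    (S.ne_of_col h3 i) h1.2.symm h2.2.symm h3.2.symm h4.2.symm (S.opp_adj_left hij)
    (S.opp_adj_left hik)

lemma exists_col {i j k : Fin 5} (hij : i ≠ j) (hik : i ≠ k) (hjk : j ≠ k) :
    ∃ c, Col G v a c i j ∧ Col G v a c i k := by
  obtain ⟨c, hc, h1, h2⟩ := exists_other S.rect.signing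
    (fun h => hjk (S.opp_injective hij hik h)) (S.opp_adj_left hij) (S.opp_adj_left hik)
  have hout : ¬ G.Adj v c := by
    intro h
    obtain ⟨l, rfl⟩ := (S.adj_iff c).1 h
    rw [S.opp_adj_iff hij] at h1
    rw [S.opp_adj_iff hik] at h2
    rcases h1 with rfl | rfl
    · exact hc rfl
    · rcases h2 with h2 | h2
      · exact hij h2.symm
      · exact hjk h2
  exact ⟨c, ⟨hout, h1.symm⟩, ⟨hout, h2.symm⟩⟩

lemma opp_ne_opp {i j k l : Fin 5} (hij : i ≠ j) (hkl : k ≠ l) (hki : k ≠ i) (hkj : k ≠ j) :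
    opp G v (a i) (a j) ≠ opp G v (a k) (a l) := by
  intro h
  have := S.opp_adj_left hkl
  rw [← h, S.opp_adj_iff hij] at this
  tauto

lemma col_other {c : V} {i j k l : Fin 5} (hij : i ≠ j) (hkl : k ≠ l) (hik : i ≠ k) (hil : i ≠ l)
    (hjk : j ≠ k) (hjl : j ≠ l) (h1 : Col G v a c i j) (h2 : Col G v a c k l) :
    ∃ d, d ≠ c ∧ Col G v a d i j ∧ Col G v a d k l := by
  obtain ⟨d, hd, h3, h4⟩ := exists_other S.rect.signing
    (S.opp_ne_opp hij hkl hik.symm hjk.symm) h1.2.symm h2.2.symm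
  have hout : ¬ G.Adj v d := by
    intro h
    obtain ⟨n, rfl⟩ := (S.adj_iff d).1 h
    rw [S.opp_adj_iff hij] at h3
    rw [S.opp_adj_iff hkl] at h4
    grind
  exact ⟨d, hd, ⟨hout, h3.symm⟩, ⟨hout, h4.symm⟩⟩

lemma sq_entry {u x : V} (h : G.Adj u x) : s u x * s u x = 1 := by
  rcases entry S.rect.signing h with h | h <;> simp [h]

omit [Fintype V] [DecidableEq V] [DecidableRel G.Adj] S in
/-- The relative sign of a column `c` in the rows `ij` and `kl` if `c`, as a cycle, passes from `i`
to `j` and then from `k` to `l`. -/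
def Dir (G : SimpleGraph V) (s : V → V → ℤ) (v : V) (a : Fin 5 → V) (c : V) (i j k l : Fin 5) :
    Prop :=
  s (opp G v (a i) (a j)) (a j) * s (opp G v (a i) (a j)) c * (s v (a j) * s v (a k)) *
    (s (opp G v (a k) (a l)) (a k) * s (opp G v (a k) (a l)) c) = -1

lemma sign_corner {c : V} {i j k : Fin 5} (hij : i ≠ j) (hjk : j ≠ k) (hik : i ≠ k)
    (h1 : Col G v a c i j) (h2 : Col G v a c j k) :
    s (opp G v (a i) (a j)) (a j) * s (opp G v (a j) (a k)) (a j) *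
      (s (opp G v (a i) (a j)) c * s (opp G v (a j) (a k)) c) = -1 := by
  refine S.rect.sign (fun h => ?_) (S.ne_of_col h1 j).symm (S.opp_adj_right hij)
    (S.opp_adj_left hjk) h1.2.symm h2.2.symm
  rw [opp_comm v (a i)] at h
  exact hik (S.opp_injective hij.symm hjk h)

lemma sign_base {j k : Fin 5} (hjk : j ≠ k) :
    s v (a j) * s (opp G v (a j) (a k)) (a j) * (s v (a k) * s (opp G v (a j) (a k)) (a k)) = -1 :=
  S.rect.sign (S.opp_ne hjk).symm (S.inj.ne hjk) (S.adj j) (S.opp_adj_left hjk) (S.adj k)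
    (S.opp_adj_right hjk)

/-- Multiply the relations of three quadrangles: those at the corners `a j` and `a k`, and the one
through `v` and the vertex of `jk`. All entries of that vertex occur squared. One more index on the
way, in `dir_of_long`, adds two factors `-1` and leaves the sign unchanged. -/
lemma dir_of_short {c : V} {i j k l : Fin 5} (hij : i ≠ j) (hjk : j ≠ k) (hik : i ≠ k)
    (hkl : k ≠ l) (hjl : j ≠ l) (h1 : Col G v a c i j) (h2 : Col G v a c j k)
    (h3 : Col G v a c k l) : Dir G s v a c i j k l := by
  have e1 := S.sign_corner hij hjk hik h1 h2
  have e2 := S.sign_corner hjk hkl hjl h2 h3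
  have e3 := S.sign_base hjk
  have q1 := S.sq_entry h2.2.symm
  have q2 := S.sq_entry (S.opp_adj_left hjk)
  have q3 := S.sq_entry (S.opp_adj_right hjk)
  unfold Dir
  generalize s (opp G v (a j) (a k)) c = x at *
  generalize s (opp G v (a j) (a k)) (a j) = y at *
  generalize s (opp G v (a j) (a k)) (a k) = z at *
  generalize s (opp G v (a i) (a j)) (a j) = A at *
  generalize s (opp G v (a i) (a j)) c = B at *
  generalize s v (a j) = C at *
  generalize s v (a k) = D at *
  generalize s (opp G v (a k) (a l)) (a k) = E at *
  generalize s (opp G v (a k) (a l)) c = F at *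
  have h : A * B * (C * D) * (E * F) * ((x * x) * (y * y) * (z * z)) =
      (A * y * (B * x)) * (z * E * (x * F)) * (C * y * (D * z)) := by ring
  rw [e1, e2, e3, q1, q2, q3] at h
  linarith

lemma dir_of_long {c : V} {i j m k l : Fin 5} (hij : i ≠ j) (hjm : j ≠ m) (him : i ≠ m)
    (hmk : m ≠ k) (hjk : j ≠ k) (hkl : k ≠ l) (hml : m ≠ l) (h1 : Col G v a c i j)
    (h2 : Col G v a c j m) (h3 : Col G v a c m k) (h4 : Col G v a c k l) :
    Dir G s v a c i j k l := by
  have e1 := S.dir_of_short hij hjm him hmk hjk h1 h2 h3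
  have e2 := S.sign_corner hmk hkl hml h3 h4
  have e3 := S.sign_base hmk
  have q1 := S.sq_entry h3.2.symm
  have q2 := S.sq_entry (S.opp_adj_left hmk)
  have q3 := S.sq_entry (S.opp_adj_right hmk)
  have q4 := S.sq_entry (S.adj m)
  unfold Dir at e1 ⊢
  generalize s (opp G v (a m) (a k)) c = x at *
  generalize s (opp G v (a m) (a k)) (a m) = y at *
  generalize s (opp G v (a m) (a k)) (a k) = z at *
  generalize s (opp G v (a i) (a j)) (a j) = A at *
  generalize s (opp G v (a i) (a j)) c = B at *
  generalize s v (a j) = C at *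
  generalize s v (a k) = D at *
  generalize s v (a m) = H at *
  generalize s (opp G v (a k) (a l)) (a k) = E at *
  generalize s (opp G v (a k) (a l)) c = F at *
  have h : A * B * (C * D) * (E * F) * ((x * x) * (y * y) * (z * z) * (H * H)) =
      (A * B * (C * H) * (y * x)) * (z * E * (x * F)) * (H * y * (D * z)) := by ring
  rw [e1, e2, e3, q1, q2, q3, q4] at h
  linarith

/-- Two columns cannot pass through two disjoint pairs in the same relative direction. -/
lemma not_dir_dir {c d : V} {i j k l : Fin 5} (hij : i ≠ j) (hkl : k ≠ l) (hik : i ≠ k)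
    (hjk : j ≠ k) (hcd : c ≠ d) (h1 : Col G v a c i j)
    (h2 : Col G v a c k l) (h3 : Col G v a d i j) (h4 : Col G v a d k l)
    (hc : Dir G s v a c i j k l) (hd : Dir G s v a d i j k l) : False := by
  have e1 := S.rect.sign (S.opp_ne_opp hij hkl hik.symm hjk.symm) hcd h1.2.symm h2.2.symm
    h3.2.symm h4.2.symm
  have q1 := S.sq_entry (S.opp_adj_right hij)
  have q2 := S.sq_entry (S.opp_adj_left hkl)
  have q3 := S.sq_entry (S.adj j)
  have q4 := S.sq_entry (S.adj k)
  unfold Dir at hc hd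
  generalize s (opp G v (a i) (a j)) (a j) = A at *
  generalize s (opp G v (a i) (a j)) c = B at *
  generalize s (opp G v (a i) (a j)) d = B' at *
  generalize s v (a j) = C at *
  generalize s v (a k) = D at *
  generalize s (opp G v (a k) (a l)) (a k) = E at *
  generalize s (opp G v (a k) (a l)) c = F at *
  generalize s (opp G v (a k) (a l)) d = F' at *
  -- The product of the two direction signs is `+1`, but it equals the sign `-1` of the quadrangle
  -- on the two rows and the two columns.
  have h : (A * B * (C * D) * (E * F)) * (A * B' * (C * D) * (E * F')) =
    (B * F * (B' * F')) * ((A * A) * (E * E) * (C * C) * (D * D)) := by ring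
  rw [hc, hd, e1, q1, q2, q3, q4] at h
  norm_num at h

end IsStar

end Star

/-! ### Which cycles accompany which -/

section Shapes

variable {V : Type*} [Fintype V] [DecidableEq V] {G : SimpleGraph V} [DecidableRel G.Adj]
  {s : V → V → ℤ} {v : V} {a : Fin 5 → V}

/-- The column `c` passes through the triangle `ijk`. -/
def Tri (G : SimpleGraph V) (v : V) (a : Fin 5 → V) (c : V) (i j k : Fin 5) : Prop :=
  Col G v a c i j ∧ Col G v a c j k ∧ Col G v a c k i

/-- The column `c` passes through the 4-cycle `ijkl`. -/
def Quad (G : SimpleGraph V) (v : V) (a : Fin 5 → V) (c : V) (i j k l : Fin 5) : Prop :=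
  Col G v a c i j ∧ Col G v a c j k ∧ Col G v a c k l ∧ Col G v a c l i

/-- The column `c` passes through the 5-cycle `ijklm`. -/
def Pent (G : SimpleGraph V) (v : V) (a : Fin 5 → V) (c : V) (i j k l m : Fin 5) : Prop :=
  Col G v a c i j ∧ Col G v a c j k ∧ Col G v a c k l ∧ Col G v a c l m ∧ Col G v a c m i

lemma Quad.rotate {c : V} {i j k l : Fin 5} (h : Quad G v a c i j k l) : Quad G v a c j k l i :=
  ⟨h.2.1, h.2.2.1, h.2.2.2, h.1⟩

lemma Pent.rotate {c : V} {i j k l m : Fin 5} (h : Pent G v a c i j k l m) :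
    Pent G v a c j k l m i :=
  ⟨h.2.1, h.2.2.1, h.2.2.2.1, h.2.2.2.2, h.1⟩

namespace IsStar

variable (S : IsStar G s v a)
include S

/-- At each step a column passes on to a new index. -/
lemma col_step {c : V} {i j k l m : Fin 5} (hnd : [i, j, k, l, m].Nodup) (h : Col G v a c i j) :
    Col G v a c j k ∨ Col G v a c j l ∨ Col G v a c j m := by
  have hcases := eq_of_nodup_five hnd
  have hij : i ≠ j := by grind
  obtain ⟨x, hxj, hxi, hx⟩ := S.col_next hij.symm h.symm
  rcases hcases x with rfl | rfl | rfl | rfl | rfl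
  · exact absurd rfl hxi
  · exact absurd rfl hxj
  · exact Or.inl hx
  · exact Or.inr (Or.inl hx)
  · exact Or.inr (Or.inr hx)

/-- A column which passes through two disjoint pairs `ij`, `kl` in this direction is accompanied by
one which passes through `ij`, `lk`. -/
lemma exists_opposite {c : V} {i j k l m : Fin 5} (hnd : [i, j, k, l, m].Nodup)
    (h1 : Col G v a c i j) (h2 : Col G v a c k l) (hdir : Dir G s v a c i j k l) :
    ∃ d, Col G v a d i j ∧ Col G v a d l k ∧ d ≠ c ∧
      (Col G v a d j l ∨ Col G v a d j m ∧ Col G v a d m l) := by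
  have hcases := eq_of_nodup_five hnd
  simp only [List.nodup_cons, List.mem_cons, List.not_mem_nil, or_false, not_or,
    not_false_eq_true, List.nodup_nil, and_true] at hnd
  obtain ⟨⟨hij, hik, hil, him⟩, ⟨hjk, hjl, hjm⟩, ⟨hkl, hkm⟩, hlm⟩ := hnd
  obtain ⟨d, hdc, h3, h4⟩ := S.col_other hij hkl hik hil hjk hjl h1 h2
  refine ⟨d, h3, h4.symm, hdc, ?_⟩
  -- Going from `j` to `k`, directly or through `m`, would repeat the relative direction of `c`; so
  -- `d` reaches `l` first.
  rcases S.col_step (k := k) (l := l) (m := m) (by simp [*]) h3 with h | h | h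
  · exact (S.not_dir_dir hij hkl hik hjk (Ne.symm hdc) h1 h2 h3 h4 hdir
      (S.dir_of_short hij hjk hik hkl hjl h3 h h4)).elim
  · exact Or.inl h
  · right
    refine ⟨h, ?_⟩
    rcases S.col_step (i := j) (j := m) (k := i) (l := k) (m := l)
      (by simp [*, Ne.symm hij, Ne.symm him, Ne.symm hkm, Ne.symm hlm]) h with h' | h' | h'
    -- A triangle `ijm` saturates its indices and leaves `k` no second pair next to `kl`.
    · exfalso
      rcases S.col_step (i := l) (j := k) (k := i) (l := j) (m := m)
        (by simp [*, Ne.symm hil, Ne.symm hik, Ne.symm hjl, Ne.symm hjk, Ne.symm hkl]) h4.symm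
        with g | g | g
      · exact S.col_deg hij him hik hjm hjk (Ne.symm hkm) h3 h'.symm g.symm
      · exact S.col_deg (Ne.symm hij) hjm hjk him hik (Ne.symm hkm) h3.symm h g.symm
      · exact S.col_deg (Ne.symm him) (Ne.symm hjm) (Ne.symm hkm) hij hik hjk h' h.symm g.symm
    · exact (S.not_dir_dir hij hkl hik hjk (Ne.symm hdc) h1 h2 h3 h4 hdir
        (S.dir_of_long hij hjm him (Ne.symm hkm) hjk hkl (Ne.symm hlm) h3 h h' h4)).elim
    · exact h'

/-- A pentagon is accompanied by a 4-cycle for each of its vertices. -/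
lemma exists_quad_of_pent {c : V} {i j k l m : Fin 5} (hnd : [i, j, k, l, m].Nodup)
    (h : Pent G v a c i j k l m) : ∃ d, Quad G v a d i j m l := by
  have hnd' := hnd
  simp only [List.nodup_cons, List.mem_cons, List.not_mem_nil, or_false, not_or,
    not_false_eq_true, List.nodup_nil, and_true] at hnd
  obtain ⟨⟨hij, hik, hil, him⟩, ⟨hjk, hjl, hjm⟩, ⟨hkl, hkm⟩, hlm⟩ := hnd
  obtain ⟨c1, c2, c3, c4, c5⟩ := h
  -- The disjoint sides `ij` and `lm` are used. If `d` went from `j` through `k`, it would share the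
  -- path `ijk` with the pentagon and coincide with `c`.
  obtain ⟨d, d1, d2, hdc, hd⟩ := S.exists_opposite (i := i) (j := j) (k := l) (l := m) (m := k)
    (by simp [*, Ne.symm hkl, Ne.symm hkm]) c1 c4
    (S.dir_of_long hij hjk hik hkl hjl hlm hkm c1 c2 c3 c4)
  rcases hd with hd | ⟨hd, -⟩
  · refine ⟨d, d1, hd, d2, ?_⟩
    rcases S.col_step (i := m) (j := l) (k := i) (l := j) (m := k)
      (by simp [*, Ne.symm him, Ne.symm hil, Ne.symm hjl, Ne.symm hjm, Ne.symm hkl, Ne.symm hkm,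
        Ne.symm hlm]) d2 with g | g | g
    · exact g
    · exact (S.col_deg (Ne.symm hij) hjm hjl him hil (Ne.symm hlm) d1.symm hd g.symm).elim
    · exact absurd (S.col_unique hlm (Ne.symm hkl) (Ne.symm hkm) d2.symm g c4 c3.symm) hdc
  · exact absurd (S.col_unique (Ne.symm hij) hjk hik d1.symm hd c1.symm c2) hdc

/-- The inner pentagram of a pentagon: one step. -/
lemma pentagram_step {c d : V} {i j k l m : Fin 5} (hnd : [i, j, k, l, m].Nodup)
    (h : Pent G v a c i j k l m) (h1 : Col G v a d k i) (h2 : Col G v a d k m) :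
    Col G v a d m j := by
  obtain ⟨e, he⟩ := S.exists_quad_of_pent (i := m) (j := i) (k := j) (l := k) (m := l)
    (by simp at hnd ⊢; grind) h.rotate.rotate.rotate.rotate
  obtain ⟨f, hf⟩ := S.exists_quad_of_pent (i := l) (j := m) (k := i) (l := j) (m := k)
    (by simp at hnd ⊢; grind) h.rotate.rotate.rotate
  simp only [List.nodup_cons, List.mem_cons, List.not_mem_nil, or_false, not_or,
    not_false_eq_true, List.nodup_nil, and_true] at hnd
  obtain ⟨⟨hij, hik, hil, him⟩, ⟨hjk, hjl, hjm⟩, ⟨hkl, hkm⟩, hlm⟩ := hnd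
  -- The paths `kmi` and `kml` belong to the accompanying 4-cycles `e` and `f`. Coinciding with
  -- either would give `d` a third pair at `k`.
  rcases S.col_step (i := k) (j := m) (k := j) (l := i) (m := l)
    (by simp [*, Ne.symm him, Ne.symm hik, Ne.symm hjk, Ne.symm hij, Ne.symm hjm, Ne.symm hlm]) h2
    with g | g | g
  · exact g
  · obtain rfl := S.col_unique (Ne.symm hkm) (Ne.symm him) (Ne.symm hik) h2.symm g he.2.2.2.symm
      he.1
    exact (S.col_deg (Ne.symm hik) hkm hkl him hil (Ne.symm hlm) h1 h2 he.2.2.1.symm).elim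
  · obtain rfl := S.col_unique (Ne.symm hkm) (Ne.symm hlm) hkl h2.symm g hf.2.1 hf.1.symm
    exact (S.col_deg (Ne.symm hik) hkm (Ne.symm hjk) him hij (Ne.symm hjm) h1 h2 hf.2.2.1).elim

/-- The column through two chords at `k` must continue along chords, by applying `pentagram_step` to
rotations of the pentagon. -/
lemma exists_pentagram {c : V} {i j k l m : Fin 5} (hnd : [i, j, k, l, m].Nodup)
    (h : Pent G v a c i j k l m) : ∃ d, Pent G v a d i k m j l := by
  have hki : k ≠ i := by simp at hnd; grind
  have hkm : k ≠ m := by simp at hnd; grind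
  have him : i ≠ m := by simp at hnd; grind
  obtain ⟨d, d1, d2⟩ := S.exists_col hki hkm him
  have d3 := S.pentagram_step hnd h d1 d2
  have d4 := S.pentagram_step (i := k) (j := l) (k := m) (l := i) (m := j)
    (by simp at hnd ⊢; grind) h.rotate.rotate d2.symm d3
  have d5 := S.pentagram_step (i := m) (j := i) (k := j) (l := k) (m := l)
    (by simp at hnd ⊢; grind) h.rotate.rotate.rotate.rotate d3.symm d4
  exact ⟨d, d1.symm, d2, d3, d4, d5⟩

/-- Without pentagons, a 4-cycle is accompanied by the other 4-cycles on the same indices. -/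
lemma exists_quad_of_quad (hno : ∀ c i j k l m, [i, j, k, l, m].Nodup → ¬ Pent G v a c i j k l m)
    {c : V} {i j k l m : Fin 5} (hnd : [i, j, k, l, m].Nodup) (h : Quad G v a c i j k l) :
    ∃ d, Quad G v a d i j l k := by
  have hnd' := hnd
  simp only [List.nodup_cons, List.mem_cons, List.not_mem_nil, or_false, not_or,
    not_false_eq_true, List.nodup_nil, and_true] at hnd
  obtain ⟨⟨hij, hik, hil, him⟩, ⟨hjk, hjl, hjm⟩, ⟨hkl, hkm⟩, hlm⟩ := hnd
  obtain ⟨c1, c2, c3, c4⟩ := h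
  obtain ⟨d, d1, d2, hdc, hd⟩ := S.exists_opposite hnd' c1 c3
    (S.dir_of_short hij hjk hik hkl hjl c1 c2 c3)
  -- From `k` to `i` the column closes to the desired 4-cycle or to a pentagon; every other
  -- continuation gives a pentagon or an index on three pairs.
  rcases S.col_step (i := l) (j := k) (k := i) (l := j) (m := m)
    (by simp [*, Ne.symm hil, Ne.symm hik, Ne.symm hjl, Ne.symm hjk, Ne.symm hkl]) d2
    with g | g | g
  · rcases hd with hd | ⟨hd, hd'⟩
    · exact ⟨d, d1, hd, d2, g⟩
    · exact absurd ⟨d1, hd, hd', d2, g⟩ (hno d i j m l k (by simp at hnd' ⊢; grind))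
  · exfalso
    rcases hd with hd | ⟨hd, hd'⟩
    · exact S.col_deg (Ne.symm hij) hjl hjk hil hik (Ne.symm hkl) d1.symm hd g.symm
    · exact S.col_deg (Ne.symm hij) hjm hjk him hik (Ne.symm hkm) d1.symm hd g.symm
  · exfalso
    rcases hd with hd | ⟨hd, hd'⟩
    · rcases S.col_step (i := k) (j := m) (k := i) (l := j) (m := l)
        (by simp [*, Ne.symm hik, Ne.symm hjk, Ne.symm him, Ne.symm hjm, Ne.symm hlm]) g
        with g' | g' | g'
      · exact hno d i j l k m (by simp at hnd' ⊢; grind) ⟨d1, hd, d2, g, g'⟩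
      · exact S.col_deg (Ne.symm hij) hjl hjm hil him hlm d1.symm hd g'.symm
      · exact S.col_deg (Ne.symm hjl) (Ne.symm hkl) hlm hjk hjm hkm hd.symm d2 g'.symm
    · exact S.col_deg (Ne.symm hjm) (Ne.symm hlm) (Ne.symm hkm) hjl hjk (Ne.symm hkl) hd.symm hd'
        g.symm

/-- A column through `ij` and `jm` closes up to a triangle, unless it contains a pentagon or a
4-cycle. -/
lemma tri_or_quad_or_pent {c : V} {i j k l m : Fin 5} (hnd : [i, j, k, l, m].Nodup)
    (h1 : Col G v a c i j) (h2 : Col G v a c j k) :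
    Tri G v a c i j k ∨ Quad G v a c i j k l ∨ Quad G v a c i j k m ∨ Pent G v a c i j k l m ∨
      Pent G v a c i j k m l := by
  have hnd' := hnd
  simp only [List.nodup_cons, List.mem_cons, List.not_mem_nil, or_false, not_or,
    not_false_eq_true, List.nodup_nil, and_true] at hnd
  obtain ⟨⟨hij, hik, hil, him⟩, ⟨hjk, hjl, hjm⟩, ⟨hkl, hkm⟩, hlm⟩ := hnd
  rcases S.col_step (i := j) (j := k) (k := i) (l := l) (m := m)
    (by simp at hnd' ⊢; grind) h2 with g | g | g
  · exact Or.inl ⟨h1, h2, g⟩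
  · rcases S.col_step (i := k) (j := l) (k := i) (l := j) (m := m)
      (by simp at hnd' ⊢; grind) g with g' | g' | g'
    · exact Or.inr (Or.inl ⟨h1, h2, g, g'⟩)
    · exact (S.col_deg (Ne.symm hij) hjk hjl hik hil hkl h1.symm h2 g'.symm).elim
    · rcases S.col_step (i := l) (j := m) (k := i) (l := j) (m := k)
        (by simp at hnd' ⊢; grind) g' with g'' | g'' | g''
      · exact Or.inr (Or.inr (Or.inr (Or.inl ⟨h1, h2, g, g', g''⟩)))
      · exact (S.col_deg (Ne.symm hij) hjk hjm hik him hkm h1.symm h2 g''.symm).elim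
      · exact (S.col_deg (Ne.symm hjk) hkl hkm hjl hjm hlm h2.symm g g''.symm).elim
  · rcases S.col_step (i := k) (j := m) (k := i) (l := j) (m := l)
      (by simp at hnd' ⊢; grind) g with g' | g' | g'
    · exact Or.inr (Or.inr (Or.inl ⟨h1, h2, g, g'⟩))
    · exact (S.col_deg (Ne.symm hij) hjk hjm hik him hkm h1.symm h2 g'.symm).elim
    · rcases S.col_step (i := m) (j := l) (k := i) (l := j) (m := k)
        (by simp at hnd' ⊢; grind) g' with g'' | g'' | g''
      · exact Or.inr (Or.inr (Or.inr (Or.inr ⟨h1, h2, g, g', g''⟩)))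
      · exact (S.col_deg (Ne.symm hij) hjk hjl hik hil hkl h1.symm h2 g''.symm).elim
      · exact (S.col_deg (Ne.symm hjk) hkm hkl hjm hjl (Ne.symm hlm) h2.symm g g''.symm).elim

/-- Without pentagons, a 4-cycle `ijkl` is accompanied by the triangles through the fifth index. -/
lemma exists_tri_of_quad (hno : ∀ c i j k l m, [i, j, k, l, m].Nodup → ¬ Pent G v a c i j k l m)
    {c d : V} {i j k l m : Fin 5} (hnd : [i, j, k, l, m].Nodup) (hc : Quad G v a c i j k l)
    (hd : Quad G v a d i j l k) : ∃ t, Tri G v a t i j m := by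
  have hnd' := hnd
  simp only [List.nodup_cons, List.mem_cons, List.not_mem_nil, or_false, not_or,
    not_false_eq_true, List.nodup_nil, and_true] at hnd
  obtain ⟨⟨hij, hik, hil, him⟩, ⟨hjk, hjl, hjm⟩, ⟨hkl, hkm⟩, hlm⟩ := hnd
  obtain ⟨t, t1, t2⟩ := S.exists_col (Ne.symm hij) hjm him
  -- A 4-cycle through `i`, `j`, `m` would contain the path `kij` or `lij`, so it would be `d` or
  -- `c`, with a third pair at `j`.
  rcases S.tri_or_quad_or_pent (i := i) (j := j) (k := m) (l := k) (m := l)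
    (by simp at hnd' ⊢; grind) t1.symm t2 with h | h | h | h | h
  · exact ⟨t, h⟩
  · obtain rfl := S.col_unique hij hik hjk t1.symm h.2.2.2.symm hd.1 hd.2.2.2.symm
    exact (S.col_deg (Ne.symm hij) hjm hjl him hil (Ne.symm hlm) t1 t2 hd.2.1).elim
  · obtain rfl := S.col_unique hij hil hjl t1.symm h.2.2.2.symm hc.1 hc.2.2.2.symm
    exact (S.col_deg (Ne.symm hij) hjm hjk him hik (Ne.symm hkm) t1 t2 hc.2.1).elim
  · exact absurd h (hno t i j m k l (by simp at hnd' ⊢; grind))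
  · exact absurd h (hno t i j m l k (by simp at hnd' ⊢; grind))

lemma exists_tri_of_not_quad
    (hno : ∀ c i j k l m, [i, j, k, l, m].Nodup → ¬ Pent G v a c i j k l m)
    (hno' : ∀ c i j k l m, [i, j, k, l, m].Nodup → ¬ Quad G v a c i j k l)
    {i j k l m : Fin 5} (hnd : [i, j, k, l, m].Nodup) : ∃ t, Tri G v a t i j k := by
  have hij : i ≠ j := by simp at hnd; grind
  have hjk : j ≠ k := by simp at hnd; grind
  have hik : i ≠ k := by simp at hnd; grind
  obtain ⟨t, t1, t2⟩ := S.exists_col hij.symm hjk hik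
  rcases S.tri_or_quad_or_pent hnd t1.symm t2 with h | h | h | h | h
  · exact ⟨t, h⟩
  · exact absurd h (hno' t i j k l m hnd)
  · exact absurd h (hno' t i j k m l (by simp at hnd ⊢; grind))
  · exact absurd h (hno t i j k l m hnd)
  · exact absurd h (hno t i j k m l (by simp at hnd ⊢; grind))

end IsStar

end Shapes

/-! ### Complete lists of pairs, and vertices far from the star -/

section Profiles

variable {V : Type*} [Fintype V] [DecidableEq V] {G : SimpleGraph V} [DecidableRel G.Adj]
  {s : V → V → ℤ} {v : V} {a : Fin 5 → V}

/-- `L` contains the pair `xy`. -/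
def Edge (L : List (Fin 5 × Fin 5)) (x y : Fin 5) : Prop := (x, y) ∈ L ∨ (y, x) ∈ L

instance (L : List (Fin 5 × Fin 5)) (x y : Fin 5) : Decidable (Edge L x y) :=
  inferInstanceAs (Decidable (_ ∨ _))

/-- The index `x` lies on two pairs of `L` which do not contain `y`. -/
def Saturated (L : List (Fin 5 × Fin 5)) (x y : Fin 5) : Prop :=
  ∃ j, x ≠ j ∧ y ≠ j ∧ Edge L x j ∧ ∃ k, x ≠ k ∧ y ≠ k ∧ j ≠ k ∧ Edge L x k

instance (L : List (Fin 5 × Fin 5)) (x y : Fin 5) : Decidable (Saturated L x y) :=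
  inferInstanceAs (Decidable (∃ j, _))

/-- A column through the pairs of `L` cannot pass through any other pair. -/
def Closed (L : List (Fin 5 × Fin 5)) : Prop :=
  ∀ x y, x ≠ y → Edge L x y ∨ Saturated L x y ∨ Saturated L y x ∨
    ∀ z, z ≠ x → z ≠ y → Saturated L z x

instance (L : List (Fin 5 × Fin 5)) : Decidable (Closed L) :=
  inferInstanceAs (Decidable (∀ x y, _))

/-- The vertex `w` is not opposite to `v` in any quadrangle. -/
def Far (G : SimpleGraph V) (v : V) (a : Fin 5 → V) (w : V) : Prop :=
  ∀ x y, x ≠ y → w ≠ opp G v (a x) (a y)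

lemma col_of_edge {L : List (Fin 5 × Fin 5)} {c : V} (h : ∀ e ∈ L, Col G v a c e.1 e.2)
    {x y : Fin 5} (hxy : Edge L x y) : Col G v a c x y :=
  hxy.elim (h _) fun h' => (h _ h').symm

namespace IsStar

variable (S : IsStar G s v a)
include S

lemma opp_eq_opp {i j k l : Fin 5} (hij : i ≠ j) (hkl : k ≠ l)
    (h : opp G v (a i) (a j) = opp G v (a k) (a l)) : (k = i ∧ l = j) ∨ (k = j ∧ l = i) := by
  have h1 := S.opp_adj_left hkl
  have h2 := S.opp_adj_right hkl
  rw [← h, S.opp_adj_iff hij] at h1 h2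
  rcases h1 with rfl | rfl <;> rcases h2 with rfl | rfl <;> tauto

lemma not_col_of_saturated {L : List (Fin 5 × Fin 5)} {c : V}
    (h : ∀ e ∈ L, Col G v a c e.1 e.2) {x y : Fin 5} (hxy : x ≠ y) (hs : Saturated L x y) :
    ¬ Col G v a c x y := by
  obtain ⟨j, hxj, hyj, hj, k, hxk, hyk, hjk, hk⟩ := hs
  exact fun hc => S.col_deg hxy hxj hxk hyj hyk hjk hc (col_of_edge h hj) (col_of_edge h hk)

lemma edge_of_col {L : List (Fin 5 × Fin 5)} {c : V} (h : ∀ e ∈ L, Col G v a c e.1 e.2)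
    (hL : Closed L) {x y : Fin 5} (hxy : x ≠ y) (hc : Col G v a c x y) : Edge L x y := by
  rcases hL x y hxy with h' | h' | h' | h'
  · exact h'
  · exact absurd hc (S.not_col_of_saturated h hxy h')
  · exact absurd hc.symm (S.not_col_of_saturated h hxy.symm h')
  · obtain ⟨z, hzx, hzy, hz⟩ := S.col_next hxy hc
    exact absurd hz.symm (S.not_col_of_saturated h hzx (h' z hzx hzy))

/-- Two columns through exactly one common pair have another neighbour in common, which is not
opposite to `v`. -/
lemma exists_common_far {L M : List (Fin 5 × Fin 5)} {c d : V} (hcd : c ≠ d)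
    (hc : ∀ e ∈ L, Col G v a c e.1 e.2) (hd : ∀ e ∈ M, Col G v a d e.1 e.2) (hL : Closed L)
    (hM : Closed M) {x y : Fin 5} (hxy : x ≠ y) (h1 : Edge L x y) (h2 : Edge M x y)
    (huniq : ∀ x' y', x' ≠ y' → Edge L x' y' → Edge M x' y' →
      (x' = x ∧ y' = y) ∨ (x' = y ∧ y' = x)) :
    ∃ w, Far G v a w ∧ G.Adj w c ∧ G.Adj w d := by
  have h1' := col_of_edge hc h1
  have h2' := col_of_edge hd h2
  obtain ⟨w, hw, hcw, hdw⟩ := exists_other S.rect.signing hcd h1'.2 h2'.2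
  refine ⟨w, ?_, hcw.symm, hdw.symm⟩
  rintro x' y' hxy' rfl
  rcases huniq x' y' hxy' (S.edge_of_col hc hL hxy' ⟨h1'.1, hcw⟩)
    (S.edge_of_col hd hM hxy' ⟨h2'.1, hdw⟩) with ⟨rfl, rfl⟩ | ⟨rfl, rfl⟩
  · exact hw rfl
  · exact hw (opp_comm _ _ _)

/-- Four of the five neighbours of a 4-cycle column are opposite to `v`, which leaves a single one.
-/
lemma far_unique {c w w' : V} {i j k l m : Fin 5} (hnd : [i, j, k, l, m].Nodup)
    (h : Quad G v a c i j k l) (hw : Far G v a w) (hw' : Far G v a w') (hcw : G.Adj w c)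
    (hcw' : G.Adj w' c) : w = w' := by
  simp only [List.nodup_cons, List.mem_cons, List.not_mem_nil, or_false, not_or,
    not_false_eq_true, List.nodup_nil, and_true] at hnd
  obtain ⟨⟨hij, hik, hil, him⟩, ⟨hjk, hjl, hjm⟩, ⟨hkl, hkm⟩, hlm⟩ := hnd
  obtain ⟨e, -, -, -, -, -, he⟩ := exists_fifth S.rect.reg h.1.2 h.2.1.2 h.2.2.1.2 h.2.2.2.2
    (fun h => by have := S.opp_eq_opp hij hjk h; tauto)
    (fun h => by have := S.opp_eq_opp hij hkl h; tauto)
    (fun h => by have := S.opp_eq_opp hij (Ne.symm hil) h; tauto)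
    (fun h => by have := S.opp_eq_opp hjk hkl h; tauto)
    (fun h => by have := S.opp_eq_opp hjk (Ne.symm hil) h; tauto)
    (fun h => by have := S.opp_eq_opp hkl (Ne.symm hil) h; tauto)
  have key : ∀ w, Far G v a w → G.Adj w c → w = e := by
    intro w hw hcw
    rcases he w hcw.symm with h | h | h | h | h
    · exact absurd h (hw _ _ hij)
    · exact absurd h (hw _ _ hjk)
    · exact absurd h (hw _ _ hkl)
    · exact absurd h (hw _ _ (Ne.symm hil))
    · exact h
  rw [key w hw hcw, key w' hw' hcw']

end IsStar

lemma Far.not_adj (S : IsStar G s v a) {w : V} (hw : Far G v a w) (hv : w ≠ v) (i : Fin 5) :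
    ¬ G.Adj w (a i) := by
  intro h
  obtain ⟨j, hij, rfl⟩ := S.exists_eq_opp hv h
  exact hw i j hij rfl

end Profiles

/-! ### The table of a star -/

section Table

variable {V : Type*} [Fintype V] [DecidableEq V] {G : SimpleGraph V} [DecidableRel G.Adj]
  {s : V → V → ℤ} {v : V} {a : Fin 5 → V} {κ ω : Type*}

/-- The first elements of the ten pairs of indices. -/
def pairFst : Fin 10 → Fin 5 := ![0, 0, 0, 0, 1, 1, 1, 2, 2, 3]

/-- The second elements of the pairs. -/
def pairSnd : Fin 10 → Fin 5 := ![1, 2, 3, 4, 2, 3, 4, 3, 4, 4]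

lemma pairFst_ne_pairSnd : ∀ n, pairFst n ≠ pairSnd n := by decide

/-- The adjacencies between the rows `v`, the vertices opposite to `v`, and further vertices
indexed by `ω`, and the columns `a i` and further columns which pass through the pairs of their
profiles. -/
def StarTable (prof : κ → List (Fin 5 × Fin 5)) (Q : ω → κ → Prop) :
    Unit ⊕ Fin 10 ⊕ ω → Fin 5 ⊕ κ → Prop
  | .inl _, .inl _ => True
  | .inl _, .inr _ => False
  | .inr (.inl n), .inl x => x = pairFst n ∨ x = pairSnd n
  | .inr (.inl n), .inr k => Edge (prof k) (pairFst n) (pairSnd n)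
  | .inr (.inr _), .inl _ => False
  | .inr (.inr m), .inr k => Q m k

instance (prof : κ → List (Fin 5 × Fin 5)) (Q : ω → κ → Prop) [∀ m k, Decidable (Q m k)] :
    ∀ i j, Decidable (StarTable prof Q i j)
  | .inl _, .inl _ => inferInstanceAs (Decidable True)
  | .inl _, .inr _ => inferInstanceAs (Decidable False)
  | .inr (.inl n), .inl x => inferInstanceAs (Decidable (x = pairFst n ∨ x = pairSnd n))
  | .inr (.inl n), .inr k => inferInstanceAs (Decidable (Edge (prof k) (pairFst n) (pairSnd n)))
  | .inr (.inr _), .inl _ => inferInstanceAs (Decidable False)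
  | .inr (.inr m), .inr k => inferInstanceAs (Decidable (Q m k))

/-- The row vertices of a `StarTable`. -/
noncomputable def starRow (G : SimpleGraph V) (v : V) (a : Fin 5 → V) (w : ω → V) :
    Unit ⊕ Fin 10 ⊕ ω → V :=
  Sum.elim (fun _ => v) (Sum.elim (fun n => opp G v (a (pairFst n)) (a (pairSnd n))) w)

/-- The column vertices of a `StarTable`. -/
def starCol (a : Fin 5 → V) (c : κ → V) : Fin 5 ⊕ κ → V := Sum.elim a c

namespace IsStar

variable (S : IsStar G s v a)
include S

lemma starTable_adj {prof : κ → List (Fin 5 × Fin 5)} {Q : ω → κ → Prop} {w : ω → V} {c : κ → V}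
    (hc : ∀ k, ∀ e ∈ prof k, Col G v a (c k) e.1 e.2) (hQ : ∀ m k, Q m k → G.Adj (w m) (c k)) :
    ∀ i j, StarTable prof Q i j → G.Adj (starRow G v a w i) (starCol a c j)
  | .inl _, .inl i, _ => S.adj i
  | .inr (.inl n), .inl x, h => (S.opp_adj_iff (pairFst_ne_pairSnd n) x).2 h
  | .inr (.inl n), .inr k, h => (col_of_edge (hc k) h).2.symm
  | .inr (.inr m), .inr k, h => hQ m k h

lemma starRow_injective {w : ω → V} (hinj : Function.Injective w) (hfar : ∀ m, Far G v a (w m))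
    (hne : ∀ m, w m ≠ v) : Function.Injective (starRow G v a w) := by
  refine Function.Injective.sumElim (fun _ _ _ => rfl)
    (Function.Injective.sumElim ?_ hinj fun n m h => ?_) ?_
  · intro n m h
    have h' := S.opp_eq_opp (pairFst_ne_pairSnd n) (pairFst_ne_pairSnd m) h
    revert h'
    clear h
    revert n m
    decide
  · exact hfar m _ _ (pairFst_ne_pairSnd n) h.symm
  · rintro ⟨⟩ (n | m) h
    · exact S.opp_ne (pairFst_ne_pairSnd n) h.symm
    · exact hne m h.symm

lemma starCol_injective {c : κ → V} (hinj : Function.Injective c) (hout : ∀ k, ¬ G.Adj v (c k)) :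
    Function.Injective (starCol a c) :=
  Function.Injective.sumElim S.inj hinj fun i k h => hout k (h ▸ S.adj i)

/-- A closed profile lists all pairs of its column, so columns with different profiles are different
vertices. -/
lemma injective_of_profile {prof : κ → List (Fin 5 × Fin 5)} {c : κ → V}
    (hc : ∀ k, ∀ e ∈ prof k, Col G v a (c k) e.1 e.2) (hcl : ∀ k, Closed (prof k))
    (hsep : ∀ k k', k ≠ k' → ∃ x y, x ≠ y ∧ Edge (prof k) x y ∧ ¬ Edge (prof k') x y) :
    Function.Injective c := by
  intro k k' h
  by_contra hne
  obtain ⟨x, y, hxy, h1, h2⟩ := hsep k k' hne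
  exact h2 (S.edge_of_col (hc k') (hcl k') hxy (h ▸ col_of_edge (hc k) h1))

end IsStar

/-- A graph containing a star table which maps bijectively onto a bipartite graph of diameter `3` is
isomorphic to this graph. -/
lemma nonempty_iso_of_starTable {W : Type*} [Nonempty W] {H : SimpleGraph W} (S : IsStar G s v a)
    {prof : κ → List (Fin 5 × Fin 5)} {Q : ω → κ → Prop} {w : ω → V} {c : κ → V}
    (hc : ∀ k, ∀ e ∈ prof k, Col G v a (c k) e.1 e.2) (hQ : ∀ m k, Q m k → G.Adj (w m) (c k))
    (hr : Function.Injective (starRow G v a w)) (hcol : Function.Injective (starCol a c))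
    (hdist : ∀ i j, ∃ j', StarTable prof Q i j' ∧
      ∃ i', StarTable prof Q i' j' ∧ StarTable prof Q i' j)
    (φ : W → (Unit ⊕ Fin 10 ⊕ ω) ⊕ (Fin 5 ⊕ κ)) (hφ : Function.Injective φ)
    (hadj : ∀ x y, H.Adj x y → TableAdj (StarTable prof Q) (φ x) (φ y))
    (hdeg : ∀ x, ∃ t : Finset W, t.card = 5 ∧ ∀ y ∈ t, H.Adj x y) : Nonempty (G ≃g H) := by
  refine nonempty_iso_of_bipartite_table S.rect.conn S.rect.reg S.rect.tri (StarTable prof Q)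
    (starRow G v a w) (starCol a c) (S.starTable_adj hc hQ) hr hcol ?_ φ hφ hadj hdeg
  intro i j
  obtain ⟨j', h1, i', h2, h3⟩ := hdist i j
  exact ⟨i', j', h1, h2, h3⟩

end Table

/-! ### A pentagon: the double of the icosahedron -/

section Pentagon

variable {V : Type*} [Fintype V] [DecidableEq V] {G : SimpleGraph V} [DecidableRel G.Adj]
  {s : V → V → ℤ} {v : V} {a : Fin 5 → V}

instance : DecidableRel icosahedron.Adj := by
  intro x y
  exact decidable_of_iff _ (SimpleGraph.fromRel_adj _ x y).symm

instance {W : Type*} [DecidableEq W] (H : SimpleGraph W) [DecidableRel H.Adj] :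
    DecidableRel (bipartiteDouble H).Adj := fun x y =>
  inferInstanceAs (Decidable (H.Adj x.1 y.1 ∧ x.2 ≠ y.2))

/-- The index of a pair, given by its two elements in either order. -/
def pairIndex : Fin 5 → Fin 5 → Fin 10 :=
  ![![0, 0, 1, 2, 3], ![0, 0, 4, 5, 6], ![1, 4, 0, 7, 8], ![2, 5, 7, 0, 9], ![3, 6, 8, 9, 0]]

/-- The columns of a star with a pentagon: five 4-cycles, the pentagon and the pentagram. -/
def pentProfile : Fin 5 ⊕ Bool → List (Fin 5 × Fin 5)
  | .inl n => [(n, n + 1), (n + 1, n + 4), (n + 4, n + 3), (n + 3, n)]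
  | .inr true => [(0, 1), (1, 2), (2, 3), (3, 4), (4, 0)]
  | .inr false => [(0, 2), (2, 4), (4, 1), (1, 3), (3, 0)]

/-- The position of a vertex of the bipartite double of the icosahedron in the table of a star
with a pentagon. -/
def icosahedronCode : (Option (ZMod 5) × Bool) × Bool →
    (Unit ⊕ Fin 10 ⊕ Unit) ⊕ (Fin 5 ⊕ (Fin 5 ⊕ Bool))
  | ((none, false), false) => .inl (.inl ())
  | ((some n, false), false) =>
    let i : Fin 5 := n
    .inl (.inr (.inl (pairIndex (i - 1) (i + 1))))
  | ((some n, true), false) =>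
    let i : Fin 5 := n
    .inl (.inr (.inl (pairIndex (i - 1) i)))
  | ((none, true), false) => .inl (.inr (.inr ()))
  | ((none, b), true) => .inr (.inr (.inr b))
  | ((some n, false), true) => .inr (.inl n)
  | ((some n, true), true) => .inr (.inr (.inl n))

/-- Five neighbours of `v`, five 4-cycles, the pentagon and the pentagram give 12 columns.
Consecutive 4-cycles share exactly one pair, hence a far neighbour; as a 4-cycle has only one such
neighbour, a single row `w 0` is adjacent to all five. Together with `v` and the ten opposite
vertices this makes 12 rows. -/
lemma nonempty_iso_of_pent (S : IsStar G s v a) {c : V} (h : Pent G v a c 0 1 2 3 4) :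
    Nonempty (G ≃g bipartiteDouble icosahedron) := by
  obtain ⟨c', h'⟩ := S.exists_pentagram (by decide) h
  have hd : ∀ n, ∃ d, Quad G v a d n (n + 1) (n + 4) (n + 3) := by
    intro n
    refine S.exists_quad_of_pent (c := c) (k := n + 2) (by revert n; decide) ?_
    have h1 := h.rotate
    have h2 := h1.rotate
    have h3 := h2.rotate
    have h4 := h3.rotate
    fin_cases n <;> assumption
  choose d hd using hd
  let col : Fin 5 ⊕ Bool → V := Sum.elim d fun b => if b then c else c'
  have hcol : ∀ k, ∀ e ∈ pentProfile k, Col G v a (col k) e.1 e.2 := by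
    rintro (n | _ | _)
    · obtain ⟨h1, h2, h3, h4⟩ := hd n
      simp [pentProfile, col, h1, h2, h3, h4]
    · obtain ⟨h1, h2, h3, h4, h5⟩ := h'
      simp [pentProfile, col, h1, h2, h3, h4, h5]
    · obtain ⟨h1, h2, h3, h4, h5⟩ := h
      simp [pentProfile, col, h1, h2, h3, h4, h5]
  have hcl : ∀ k, Closed (pentProfile k) := by decide
  have hinj := S.injective_of_profile hcol hcl (by decide)
  have hout : ∀ k, ¬ G.Adj v (col k) := by
    rintro (n | _ | _)
    exacts [(hd n).1.1, h'.1.1, h.1.1]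
  have hw : ∀ n, ∃ w, Far G v a w ∧ G.Adj w (d n) ∧ G.Adj w (d (n + 1)) := by
    intro n
    refine S.exists_common_far (L := pentProfile (.inl n)) (M := pentProfile (.inl (n + 1)))
      (x := n + 1) (y := n + 4)
      (fun h => ?_) (hcol (.inl n)) (hcol (.inl (n + 1))) (hcl _) (hcl _) ?_ ?_ ?_ ?_
    · have := hinj (a₁ := .inl n) (a₂ := .inl (n + 1)) h
      revert this
      clear h
      revert n
      decide
    all_goals revert n; decide
  choose w hfar hw1 hw2 using hw
  have hstep : ∀ n, w n = w (n + 1) := fun n =>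
    S.far_unique (m := n + 1 + 2) (by revert n; decide) (hd (n + 1)) (hfar n) (hfar (n + 1))
      (hw2 n) (hw1 (n + 1))
  have hw0 : ∀ n, w n = w 0 := by
    have h0 := hstep 0
    have h1 := hstep 1
    have h2 := hstep 2
    have h3 := hstep 3
    intro n
    fin_cases n
    · rfl
    · exact h0.symm
    · exact (h0.trans h1).symm
    · exact (h0.trans (h1.trans h2)).symm
    · exact (h0.trans (h1.trans (h2.trans h3))).symm
  have hwv : w 0 ≠ v := fun h => hout (.inl 0) (h ▸ hw1 0)
  refine nonempty_iso_of_starTable S (prof := pentProfile) (Q := fun _ k => k.isLeft)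
    (w := fun _ : Unit => w 0) hcol ?_
    (S.starRow_injective (fun _ _ _ => rfl) (fun _ => hfar 0) fun _ => hwv)
    (S.starCol_injective hinj hout) ?_ icosahedronCode ?_ ?_ ?_
  · rintro _ (n | b) h
    · exact hw0 n ▸ hw1 n
    · cases h
  · decide +kernel
  · decide +kernel
  · decide +kernel
  · intro x
    refine ⟨univ.filter fun y => (bipartiteDouble icosahedron).Adj x y, ?_, by simp⟩
    revert x
    decide +kernel

end Pentagon

/-! ### A 4-cycle without pentagons: the Fano prism -/

section Quadrangle

variable {V : Type*} [Fintype V] [DecidableEq V] {G : SimpleGraph V} [DecidableRel G.Adj]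
  {s : V → V → ℤ} {v : V} {a : Fin 5 → V}

instance : DecidableRel fanoNonincidence.Adj := fun x y =>
  decidable_of_iff _ (SimpleGraph.fromRel_adj _ x y).symm

lemma card_le_of_adj {κ : Type*} (hreg : G.IsRegularOfDegree 5) {c : κ → V}
    (hinj : Function.Injective c) {x : V} {t : Finset κ} (h : ∀ k ∈ t, G.Adj x (c k)) :
    t.card ≤ 5 := by
  rw [← hreg x, ← SimpleGraph.card_neighborFinset_eq_degree,
    ← card_map (⟨c, hinj⟩ : κ ↪ V)]
  refine card_le_card fun y hy => ?_
  obtain ⟨k, hk, rfl⟩ := mem_map.1 hy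
  simpa using h k hk

/-- The first elements of the six pairs of the first four indices. -/
def edgeFst : Fin 6 → Fin 5 := ![0, 0, 0, 1, 1, 2]

/-- The second elements of these pairs. -/
def edgeSnd : Fin 6 → Fin 5 := ![1, 2, 3, 2, 3, 3]

/-- The three 4-cycles on the first four indices. -/
def fourCycle : Fin 3 → List (Fin 5 × Fin 5) :=
  ![[(0, 1), (1, 2), (2, 3), (3, 0)], [(0, 1), (1, 3), (3, 2), (2, 0)],
    [(0, 2), (2, 1), (1, 3), (3, 0)]]

/-- The columns of a star with a 4-cycle and no pentagon: six triangles and three 4-cycles. -/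
def quadProfile : Fin 6 ⊕ Fin 3 → List (Fin 5 × Fin 5)
  | .inl e => [(edgeFst e, edgeSnd e), (edgeSnd e, 4), (4, edgeFst e)]
  | .inr q => fourCycle q

/-- The columns adjacent to the row that belongs to a 4-cycle. -/
def QuadTable (q : Fin 3) : Fin 6 ⊕ Fin 3 → Prop
  | .inl e => Edge (fourCycle q) (edgeFst e) (edgeSnd e)
  | .inr q' => q = q'

instance (q : Fin 3) : ∀ k, Decidable (QuadTable q k)
  | .inl e => inferInstanceAs (Decidable (Edge (fourCycle q) (edgeFst e) (edgeSnd e)))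
  | .inr q' => inferInstanceAs (Decidable (q = q'))

/-- The position of a vertex of the prism over the non-incidence graph of the Fano plane in the
table of a star with a 4-cycle. -/
def fanoPrismCode (x : Fin 2 × (ZMod 7 × Bool)) :
    (Unit ⊕ Fin 10 ⊕ Fin 3) ⊕ (Fin 5 ⊕ (Fin 6 ⊕ Fin 3)) :=
  let i : Fin 7 := x.2.1
  if x.1 = 0 then
    if x.2.2 then .inr ((![.inl 0, .inr (.inr 0), .inr (.inr 2), .inl 2, .inr (.inr 1), .inl 3,
      .inl 1] : Fin 7 → _) i)
    else .inl ((![.inl (), .inr (.inl 0), .inr (.inl 2), .inr (.inl 4), .inr (.inl 1),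
      .inr (.inl 7), .inr (.inl 5)] : Fin 7 → _) i)
  else
    if x.2.2 then .inl ((![.inr (.inl 3), .inr (.inr 0), .inr (.inr 2), .inr (.inl 8),
      .inr (.inr 1), .inr (.inl 9), .inr (.inl 6)] : Fin 7 → _) i)
    else .inr ((![.inl 4, .inr (.inl 0), .inr (.inl 2), .inr (.inl 3), .inr (.inl 1),
      .inr (.inl 5), .inr (.inl 4)] : Fin 7 → _) i)

/-- All three 4-cycles on `0, 1, 2, 3` and all six triangles through `4` occur as columns. Each
4-cycle has one far row, which is also adjacent to the triangles on its four sides. This gives 14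
rows and 14 columns. -/
lemma nonempty_iso_of_quad (S : IsStar G s v a)
    (hno : ∀ c i j k l m, [i, j, k, l, m].Nodup → ¬ Pent G v a c i j k l m) {A : V}
    (hA : Quad G v a A 0 1 2 3) : Nonempty (G ≃g prism fanoNonincidence) := by
  obtain ⟨B, hB⟩ := S.exists_quad_of_quad hno (m := 4) (by decide) hA
  obtain ⟨C, hC⟩ := S.exists_quad_of_quad hno (m := 4) (by decide) hA.rotate
  -- Each pair of the first four indices is a side of two of the three 4-cycles; these two are fed
  -- to `exists_tri_of_quad`.
  have ht : ∀ e, ∃ t, Tri G v a t (edgeFst e) (edgeSnd e) 4 := by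
    intro e
    fin_cases e
    · exact S.exists_tri_of_quad hno (by decide) hA hB
    · obtain ⟨t, h1, h2, h3⟩ := S.exists_tri_of_quad hno (m := 4) (by decide)
        hB.rotate.rotate.rotate ⟨hC.2.1, hC.2.2.1, hC.2.2.2, hC.1⟩
      exact ⟨t, h1.symm, h3.symm, h2.symm⟩
    · obtain ⟨t, h1, h2, h3⟩ := S.exists_tri_of_quad hno (m := 4) (by decide)
        hA.rotate.rotate.rotate (d := C) ⟨hC.2.2.1.symm, hC.2.1.symm, hC.1.symm, hC.2.2.2.symm⟩
      exact ⟨t, h1.symm, h3.symm, h2.symm⟩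
    · exact S.exists_tri_of_quad hno (by decide) hA.rotate hC
    · exact S.exists_tri_of_quad hno (d := C) (by decide) hB.rotate
        ⟨hC.2.2.2.symm, hC.2.2.1.symm, hC.2.1.symm, hC.1.symm⟩
    · exact S.exists_tri_of_quad hno (d := B) (by decide) hA.rotate.rotate
        ⟨hB.2.2.1.symm, hB.2.1.symm, hB.1.symm, hB.2.2.2.symm⟩
  choose t ht using ht
  let col : Fin 6 ⊕ Fin 3 → V := Sum.elim t ![A, B, C]
  have hcol : ∀ k, ∀ e ∈ quadProfile k, Col G v a (col k) e.1 e.2 := by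
    rintro (e | q)
    · obtain ⟨h1, h2, h3⟩ := ht e
      simp [quadProfile, col, h1, h2, h3]
    · obtain ⟨a1, a2, a3, a4⟩ := hA
      obtain ⟨b1, b2, b3, b4⟩ := hB
      obtain ⟨c1, c2, c3, c4⟩ := hC
      fin_cases q
      · simp [quadProfile, fourCycle, col, *]
      · simp [quadProfile, fourCycle, col, *]
      · simp [quadProfile, fourCycle, col, c2.symm, c1.symm, c3.symm, c4.symm]
  have hcl : ∀ k, Closed (quadProfile k) := by decide
  have hinj := S.injective_of_profile hcol hcl (by decide)
  have hout : ∀ k, ¬ G.Adj v (col k) := by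
    rintro (e | q)
    · exact (ht e).1.1
    · fin_cases q
      exacts [hA.1.1, hB.1.1, hC.1.1]
  have hfu : ∀ (q : Fin 3) (x y : V), Far G v a x → Far G v a y → G.Adj x (col (.inr q)) →
      G.Adj y (col (.inr q)) → x = y := by
    intro q x y hx hy hxq hyq
    fin_cases q
    · exact S.far_unique (m := 4) (by decide) hA hx hy hxq hyq
    · exact S.far_unique (m := 4) (by decide) hB hx hy hxq hyq
    · exact S.far_unique (m := 4) (by decide) hC hx hy hxq hyq
  have hw : ∀ q e, Edge (fourCycle q) (edgeFst e) (edgeSnd e) →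
      ∃ w, Far G v a w ∧ G.Adj w (col (.inr q)) ∧ G.Adj w (col (.inl e)) := by
    intro q e he
    refine S.exists_common_far (L := quadProfile (.inr q)) (M := quadProfile (.inl e))
      (x := edgeFst e) (y := edgeSnd e) (fun h => ?_) (hcol _) (hcol _) (hcl _) (hcl _) ?_ he ?_ ?_
    · cases hinj h
    all_goals revert q e; decide
  have hw' : ∀ q, ∃ w, Far G v a w ∧ ∀ k, QuadTable q k → G.Adj w (col k) := by
    intro q
    obtain ⟨e, he⟩ : ∃ e, Edge (fourCycle q) (edgeFst e) (edgeSnd e) := by revert q; decide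
    obtain ⟨w, hwf, hwq, -⟩ := hw q e he
    refine ⟨w, hwf, ?_⟩
    rintro (e' | q') hk
    · obtain ⟨w', hwf', hwq', hwe⟩ := hw q e' hk
      exact hfu q w w' hwf hwf' hwq hwq' ▸ hwe
    · obtain rfl : q = q' := hk
      exact hwq
  choose w hfar hadj using hw'
  -- Two 4-cycles cover all six pairs, so a common far row would have eight neighbours.
  have hwinj : Function.Injective w := by
    intro q q' h
    by_contra hne
    have h1 : (univ.filter fun k => QuadTable q k ∨ QuadTable q' k).card ≤ 5 := by
      refine card_le_of_adj S.rect.reg hinj (x := w q) fun k hk => ?_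
      rcases (mem_filter.1 hk).2 with hk | hk
      · exact hadj q k hk
      · exact h ▸ hadj q' k hk
    revert h1
    clear h
    revert q q'
    decide
  have hwv : ∀ q, w q ≠ v := fun q h => hout (.inr q) (h ▸ hadj q (.inr q) rfl)
  refine nonempty_iso_of_starTable S (prof := quadProfile) (Q := QuadTable) hcol hadj
    (S.starRow_injective hwinj hfar hwv) (S.starCol_injective hinj hout) ?_ fanoPrismCode ?_ ?_ ?_
  · decide +kernel
  · decide +kernel
  · decide +kernel
  · intro x
    refine ⟨univ.filter fun y => (prism fanoNonincidence).Adj x y, ?_, by simp⟩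
    revert x
    decide +kernel

end Quadrangle

/-! ### Triangles only: the 5-cube and the folded 5-cube -/

section Triangles

variable {V : Type*} [Fintype V] [DecidableEq V] {G : SimpleGraph V} [DecidableRel G.Adj]
  {s : V → V → ℤ} {v : V} {a : Fin 5 → V}

instance : DecidableRel fiveCube.Adj := fun x y =>
  decidable_of_iff _ (SimpleGraph.fromRel_adj _ x y).symm

instance : DecidableRel foldedFiveCube.Adj := fun x y =>
  decidable_of_iff _ (SimpleGraph.fromRel_adj _ x y).symm

/-- The index `m` belongs to the pair `k`. -/
def InPair (m : Fin 5) (k : Fin 10) : Prop := m = pairFst k ∨ m = pairSnd k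

instance (m : Fin 5) (k : Fin 10) : Decidable (InPair m k) := inferInstanceAs (Decidable (_ ∨ _))

/-- The complement of a pair of indices. -/
def triple : Fin 10 → Fin 3 → Fin 5 :=
  ![![2, 3, 4], ![1, 3, 4], ![1, 2, 4], ![1, 2, 3], ![0, 3, 4], ![0, 2, 4], ![0, 2, 3], ![0, 1, 4],
    ![0, 1, 3], ![0, 1, 2]]

/-- The triangle on the complement of a pair. -/
def tripleProfile (k : Fin 10) : List (Fin 5 × Fin 5) :=
  [(triple k 0, triple k 1), (triple k 1, triple k 2), (triple k 2, triple k 0)]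

/-- The three pairs disjoint from a given one. -/
def disjointPair (n : Fin 10) : Fin 3 → Fin 10 :=
  ![pairIndex (triple n 0) (triple n 1), pairIndex (triple n 1) (triple n 2),
    pairIndex (triple n 0) (triple n 2)]

/-- The cut of the complete graph on the five indices determined by four truth values. -/
def cut (b₁ b₂ b₃ b₄ : Bool) : Fin 10 → Bool :=
  ![b₁, b₂, b₃, b₄, b₁ ^^ b₂, b₁ ^^ b₃, b₁ ^^ b₄, b₂ ^^ b₃, b₂ ^^ b₄, b₃ ^^ b₄]

/-- Cuts of `K_5` have 0, 4 or 6 edges, and those with 4 edges are the stars of single indices. -/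
lemma cut_small : ∀ b₁ b₂ b₃ b₄ : Bool, (univ.filter fun k => cut b₁ b₂ b₃ b₄ k).card ≤ 5 →
    ∀ k, cut b₁ b₂ b₃ b₄ k → ∃ m, ∀ k, cut b₁ b₂ b₃ b₄ k = decide (InPair m k) := by
  decide +kernel

/-- A function on the edges of `K_5` with even sum on every triangle is a cut, determined by its
values at the index 0. The triangle through 0 and a pair is used, indexed by its complementary pair.
-/
lemma eq_cut {f : Fin 10 → Bool} (h : ∀ n, (f (disjointPair n 0) ^^ f (disjointPair n 1) ^^
    f (disjointPair n 2)) = false) : f = cut (f 0) (f 1) (f 2) (f 3) := by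
  have key : ∀ x y z : Bool, (x ^^ y ^^ z) = false → y = (x ^^ z) := by decide
  funext k
  fin_cases k
  · rfl
  · rfl
  · rfl
  · rfl
  · exact key _ _ _ (h 9)
  · exact key _ _ _ (h 8)
  · exact key _ _ _ (h 7)
  · exact key _ _ _ (h 6)
  · exact key _ _ _ (h 5)
  · exact key _ _ _ (h 4)

/-- The columns of a star with triangles only: ten triangles and a last column. -/
def cubeProfile : Fin 10 ⊕ Unit → List (Fin 5 × Fin 5)
  | .inl k => tripleProfile k
  | .inr _ => []

/-- The columns adjacent to the row that belongs to an omitted index. -/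
def CubeTable (m : Fin 5) : Fin 10 ⊕ Unit → Prop
  | .inl k => InPair m k
  | .inr _ => True

instance (m : Fin 5) : ∀ k, Decidable (CubeTable m k)
  | .inl k => inferInstanceAs (Decidable (InPair m k))
  | .inr _ => inferInstanceAs (Decidable True)

/-- The position of a vertex of the 5-cube in the table of a star with triangles only. -/
def cubeCode (x : Fin 5 → Bool) :
    (Unit ⊕ Fin 10 ⊕ Fin 5) ⊕ (Fin 5 ⊕ (Fin 10 ⊕ Unit)) :=
  match (List.finRange 5).filter x, (List.finRange 5).filter fun i => !x i with
  | [], _ => .inl (.inl ())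
  | [i], _ => .inr (.inl i)
  | [i, j], _ => .inl (.inr (.inl (pairIndex i j)))
  | _, [i, j] => .inr (.inr (.inl (pairIndex i j)))
  | _, [i] => .inl (.inr (.inr i))
  | _, _ => .inr (.inr (.inr ()))

/-- The row of the 5-cube that represents a vertex of the folded 5-cube. -/
def foldedCubeCode (x : Fin 4 → Bool) : Unit ⊕ Fin 10 ⊕ Fin 5 :=
  match (List.finRange 4).filter x, (List.finRange 4).filter fun i => !x i with
  | [], _ => .inl ()
  | [i], _ => .inr (.inr i.castSucc)
  | [i, j], _ => .inr (.inl (pairIndex i.castSucc j.castSucc))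
  | _, [i] => .inr (.inl (pairIndex i.castSucc 4))
  | _, _ => .inr (.inr 4)

/-- The column antipodal to a row of the 5-cube. -/
def antipode : Unit ⊕ Fin 10 ⊕ Fin 5 → Fin 5 ⊕ (Fin 10 ⊕ Unit)
  | .inl _ => .inr (.inr ())
  | .inr (.inl n) => .inr (.inl n)
  | .inr (.inr m) => .inl m

lemma eq_of_adj_of_card {κ : Type*} (hreg : G.IsRegularOfDegree 5) {c : κ → V}
    (hinj : Function.Injective c) {x : V} {t : Finset κ} (ht : t.card = 5)
    (h : ∀ k ∈ t, G.Adj x (c k)) {y : V} (hy : G.Adj x y) : ∃ k ∈ t, c k = y := by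
  have heq : t.map ⟨c, hinj⟩ = G.neighborFinset x := by
    refine eq_of_subset_of_card_le ?_ ?_
    · intro z hz
      obtain ⟨k, hk, rfl⟩ := mem_map.1 hz
      simpa using h k hk
    · rw [card_map, ht, SimpleGraph.card_neighborFinset_eq_degree, hreg x]
  have hy' : y ∈ t.map ⟨c, hinj⟩ := by rw [heq]; simpa using hy
  simpa using hy'

/-- The columns of triangles which are adjacent to a given further row are those of the triangles
avoiding some index. -/
lemma exists_omitted_index (S : IsStar G s v a) {t : Fin 10 → V}
    (ht : ∀ k, ∀ e ∈ tripleProfile k, Col G v a (t k) e.1 e.2) (hinj : Function.Injective t)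
    {w : V} (hw : Far G v a w) {k₀ : Fin 10} (hk₀ : G.Adj w (t k₀)) :
    ∃ m, ∀ k, G.Adj w (t k) ↔ InPair m k := by
  have hout : ∀ k, ¬ G.Adj v (t k) := fun k =>
    (ht k (triple k 0, triple k 1) (by simp [tripleProfile])).1
  have hwv : w ≠ v := fun h => hout k₀ (h ▸ hk₀)
  have hta : ∀ k i, a i ≠ t k := fun k i h => hout k (h ▸ S.adj i)
  -- The row of the pair `n` has as neighbours two of the `a i` and the three triangle columns
  -- through `n`, which are indexed by the pairs disjoint from `n`. As `w` misses the `a i`, parity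
  -- says that its adjacency to the triangle columns is a cut.
  have hpar : ∀ n, (decide (G.Adj w (t (disjointPair n 0))) ^^
      decide (G.Adj w (t (disjointPair n 1))) ^^ decide (G.Adj w (t (disjointPair n 2)))) =
      false := by
    intro n
    have hne := pairFst_ne_pairSnd n
    have hd : ∀ i, G.Adj (opp G v (a (pairFst n)) (a (pairSnd n))) (t (disjointPair n i)) := by
      intro i
      refine (col_of_edge (ht (disjointPair n i)) ?_).2.symm
      revert i n
      decide
    have h01 : t (disjointPair n 0) ≠ t (disjointPair n 1) :=
      hinj.ne (by clear * -; revert n; decide)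
    have h02 : t (disjointPair n 0) ≠ t (disjointPair n 2) :=
      hinj.ne (by clear * -; revert n; decide)
    have h12 : t (disjointPair n 1) ≠ t (disjointPair n 2) :=
      hinj.ne (by clear * -; revert n; decide)
    have h1 := S.opp_adj_left hne
    have h2 := S.opp_adj_right hne
    have h := xor_adj S.rect.signing (v := opp G v (a (pairFst n)) (a (pairSnd n))) (r := w)
      (a := a (pairFst n)) (b := a (pairSnd n)) (fun x => ⟨fun hx => eq_of_five S.rect.reg h1 h2
          (hd 0) (hd 1) (hd 2) (S.inj.ne hne) (hta _ _) (hta _ _) (hta _ _) (hta _ _) (hta _ _)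
          (hta _ _) h01 h02 h12 hx, ?_⟩) (S.inj.ne hne) (hta _ _)
      (hta _ _) (hta _ _) (hta _ _) (hta _ _) (hta _ _) h01 h02 h12 (hw _ _ hne).symm
    · simpa [hw.not_adj S hwv] using h
    · rintro (rfl | rfl | rfl | rfl | rfl)
      exacts [h1, h2, hd 0, hd 1, hd 2]
  have hcut := eq_cut (f := fun k => decide (G.Adj w (t k))) hpar
  have hcard : (univ.filter fun k => G.Adj w (t k)).card ≤ 5 :=
    card_le_of_adj S.rect.reg hinj (x := w) fun k hk => (mem_filter.1 hk).2
  obtain ⟨m, hm⟩ := cut_small _ _ _ _ (by rw [← hcut]; simpa using hcard) k₀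
    (by rw [← hcut]; simpa using hk₀)
  refine ⟨m, fun k => ?_⟩
  have h := hm k
  rw [← hcut] at h
  simpa using h

/-- Each row `w m` has four triangle columns and one further neighbour. The rows `w m` and `w 0`
share exactly one triangle column, so evenness forces their further neighbours to agree. -/
lemma exists_last_column (S : IsStar G s v a) {t : Fin 10 → V} (hinj : Function.Injective t)
    {w : Fin 5 → V} (hw : ∀ m k, G.Adj (w m) (t k) ↔ InPair m k) :
    ∃ u, (∀ k, t k ≠ u) ∧ ∀ m, G.Adj (w m) u := by
  have hu : ∀ m, ∃ u, (∀ k, t k ≠ u) ∧ G.Adj (w m) u ∧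
      ∀ x, G.Adj (w m) x → x = u ∨ ∃ k, t k = x := by
    intro m
    have hsub : (univ.filter (InPair m)).map ⟨t, hinj⟩ ⊆ G.neighborFinset (w m) := by
      intro x hx
      obtain ⟨k, hk, rfl⟩ := mem_map.1 hx
      simpa using (hw m k).2 (mem_filter.1 hk).2
    have hcard : (G.neighborFinset (w m) \ (univ.filter (InPair m)).map ⟨t, hinj⟩).card = 1 := by
      rw [card_sdiff_of_subset hsub, card_map, SimpleGraph.card_neighborFinset_eq_degree,
        S.rect.reg]
      clear * -
      revert m
      decide
    obtain ⟨u, hu⟩ := card_eq_one.1 hcard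
    have hu' : ∀ x, x = u ↔ G.Adj (w m) x ∧ ¬ ∃ k, InPair m k ∧ t k = x := by
      intro x
      rw [← mem_singleton, ← hu]
      simp
    obtain ⟨h1, h2⟩ := (hu' u).1 rfl
    refine ⟨u, fun k hk => h2 ⟨k, ?_, hk⟩, h1, fun x hx => ?_⟩
    · rw [← hw, hk]
      exact h1
    · by_cases h : ∃ k, InPair m k ∧ t k = x
      · obtain ⟨k, -, hk⟩ := h
        exact Or.inr ⟨k, hk⟩
      · exact Or.inl ((hu' x).2 ⟨hx, h⟩)
  choose u hut hu hux using hu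
  have heq : ∀ m, u m = u 0 := by
    intro m
    by_cases hm : m = 0
    · rw [hm]
    have hpair : ∃ k, InPair m k ∧ InPair 0 k ∧ ∀ k', InPair m k' → InPair 0 k' → k' = k := by
      revert m
      decide
    obtain ⟨k, h1, h2, h3⟩ := hpair
    have hne : w m ≠ w 0 := by
      intro h
      have hk : ∃ k, InPair m k ∧ ¬ InPair 0 k := by
        clear h
        clear * - hm
        revert m
        decide
      obtain ⟨k, hk, hk'⟩ := hk
      rw [← hw, h, hw] at hk
      exact hk' hk
    obtain ⟨x, hxk, hx1, hx2⟩ := exists_other S.rect.signing hne ((hw m k).2 h1) ((hw 0 k).2 h2)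
    have hx : ∀ k', t k' ≠ x := by
      rintro k' rfl
      exact hxk (congrArg t (h3 k' ((hw _ _).1 hx1) ((hw _ _).1 hx2)))
    have e1 := (hux m x hx1).resolve_right fun ⟨k', hk'⟩ => hx k' hk'
    have e2 := (hux 0 x hx2).resolve_right fun ⟨k', hk'⟩ => hx k' hk'
    rw [← e1, e2]
  exact ⟨u 0, hut 0, fun m => heq m ▸ hu m⟩

-- The table is that of the 5-cube, with 16 rows and 16 columns. A row and a column can coincide
-- only if they are antipodal. One such coincidence forces all of them and gives the folded cube;
-- otherwise the graph is the 5-cube.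
set_option synthInstance.maxHeartbeats 200000 in
set_option synthInstance.maxSize 1000 in
lemma nonempty_iso_of_tri (S : IsStar G s v a)
    (h : ∀ i j k l m, [i, j, k, l, m].Nodup → ∃ t, Tri G v a t i j k) :
    Nonempty (G ≃g foldedFiveCube) ∨ Nonempty (G ≃g fiveCube) := by
  have ht : ∀ n, ∃ t, Tri G v a t (triple n 0) (triple n 1) (triple n 2) := fun n =>
    h _ _ _ (pairFst n) (pairSnd n) (by revert n; decide)
  choose t ht using ht
  have hcol : ∀ k, ∀ e ∈ tripleProfile k, Col G v a (t k) e.1 e.2 := by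
    intro k
    obtain ⟨h1, h2, h3⟩ := ht k
    simp [tripleProfile, h1, h2, h3]
  have hcl : ∀ k, Closed (tripleProfile k) := by decide +kernel
  have hinj := S.injective_of_profile hcol hcl (by decide +kernel)
  have hw : ∀ m, ∃ w, Far G v a w ∧ ∀ k, G.Adj w (t k) ↔ InPair m k := by
    intro m
    -- Two triangles avoiding `m` share exactly one pair, so they have a far common neighbour, and
    -- `m` is the only index that both omit.
    have hk : ∃ k k', k ≠ k' ∧ (∀ m', InPair m' k → InPair m' k' → m' = m) ∧
        ∃ x y, x ≠ y ∧ Edge (tripleProfile k) x y ∧ Edge (tripleProfile k') x y ∧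
          ∀ x' y', x' ≠ y' → Edge (tripleProfile k) x' y' → Edge (tripleProfile k') x' y' →
          (x' = x ∧ y' = y) ∨ (x' = y ∧ y' = x) := by
      revert m
      decide +kernel
    obtain ⟨k, k', hkk, hm, x, y, hxy, h1, h2, h3⟩ := hk
    obtain ⟨w, hwf, hwk, hwk'⟩ := S.exists_common_far (hinj.ne hkk) (hcol k) (hcol k') (hcl k)
      (hcl k') hxy h1 h2 h3
    obtain ⟨m', hm'⟩ := exists_omitted_index S hcol hinj hwf hwk
    obtain rfl := hm m' ((hm' k).1 hwk) ((hm' k').1 hwk')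
    exact ⟨w, hwf, hm'⟩
  choose w hfar hwt using hw
  have hwinj : Function.Injective w := by
    intro m m' hmm
    by_contra hne
    have hk : ∃ k, InPair m k ∧ ¬ InPair m' k := by
      clear hmm
      revert m m'
      decide
    obtain ⟨k, hk, hk'⟩ := hk
    rw [← hwt, hmm, hwt] at hk
    exact hk' hk
  have hout : ∀ k, ¬ G.Adj v (t k) := fun k => (ht k).1.1
  have hwv : ∀ m, w m ≠ v := by
    intro m hm
    have hk : ∃ k, InPair m k := by clear hm; revert m; decide
    obtain ⟨k, hk⟩ := hk
    exact hout k (hm ▸ (hwt m k).2 hk)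
  obtain ⟨u, hut, hu⟩ := exists_last_column S hinj hwt
  let col : Fin 10 ⊕ Unit → V := Sum.elim t fun _ => u
  have hcinj : Function.Injective col :=
    hinj.sumElim (fun _ _ _ => rfl) fun k _ => hut k
  have hcout : ∀ k, ¬ G.Adj v (col k) := by
    rintro (k | _) hk
    · exact hout k hk
    · obtain ⟨i, hi⟩ := (S.adj_iff _).1 hk
      exact (hfar 0).not_adj S (hwv 0) i (hi ▸ hu 0)
  have hT := S.starTable_adj (prof := cubeProfile) (Q := CubeTable) (w := w) (c := col)
    (by rintro (k | _) <;> [exact hcol k; simp [cubeProfile]])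
    (by rintro m (k | _) hk <;> [exact (hwt m k).2 hk; exact hu m])
  have hr := S.starRow_injective hwinj hfar hwv
  have hc := S.starCol_injective hcinj hcout
  have hanti : ∀ i j, starRow G v a w i = starCol a col j → j = antipode i := by
    intro i j hij
    by_contra hne
    have hd : ∀ i j, j = antipode i ∨ ∃ j', StarTable cubeProfile CubeTable i j' ∧
        ∃ i', StarTable cubeProfile CubeTable i' j' ∧ StarTable cubeProfile CubeTable i' j := by
      decide +kernel
    obtain ⟨j', h1, i', h2, h3⟩ := (hd i j).resolve_left hne
    have h3' := hT _ _ h3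
    rw [← hij] at h3'
    exact false_of_triangle S.rect.tri (hT _ _ h1) (hT _ _ h2).symm h3'
  by_cases hfold : ∃ i j, starRow G v a w i = starCol a col j
  · left
    obtain ⟨i₀, j₀, h0⟩ := hfold
    obtain rfl := hanti _ _ h0
    -- A column adjacent to row `i` is then adjacent to the column antipodal to `i`, all of whose
    -- neighbours are rows. So it is itself a row, namely its own antipode.
    have hstep : ∀ i i', starRow G v a w i = starCol a col (antipode i) →
        StarTable cubeProfile CubeTable i (antipode i') →
        starRow G v a w i' = starCol a col (antipode i') := by
      intro i i' hi hii
      have hadj := hT _ _ hii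
      rw [hi] at hadj
      obtain ⟨i'', -, h2⟩ := eq_of_adj_of_card S.rect.reg hr
        (t := univ.filter fun i' => StarTable cubeProfile CubeTable i' (antipode i))
        (by clear * -; revert i; decide +kernel) (fun k hk => (hT _ _ (mem_filter.1 hk).2).symm)
        hadj
      have h3 := hanti _ _ h2
      have : i' = i'' := by
        have hai : Function.Injective antipode := by decide
        exact hai h3
      rw [this, h2, this]
    have hall : ∀ i, starRow G v a w i = starCol a col (antipode i) := by
      intro i
      -- The folded 5-cube has diameter 2, so two steps spread the coincidence to all rows.
      have hp : ∀ i₀ i, i = i₀ ∨ StarTable cubeProfile CubeTable i₀ (antipode i) ∨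
          ∃ i', StarTable cubeProfile CubeTable i₀ (antipode i') ∧
            StarTable cubeProfile CubeTable i' (antipode i) := by
        decide +kernel
      rcases hp i₀ i with rfl | h1 | ⟨i', h1, h2⟩
      · exact h0
      · exact hstep _ _ h0 h1
      · exact hstep _ _ (hstep _ _ h0 h1) h2
    refine nonempty_iso_of_injective S.rect.conn S.rect.reg (starRow G v a w ∘ foldedCubeCode)
      (hr.comp (by decide +kernel)) ?_ ?_
    · intro x y hxy
      have hxy' : StarTable cubeProfile CubeTable (foldedCubeCode x)
          (antipode (foldedCubeCode y)) := by
        revert x y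
        decide +kernel
      have := hT _ _ hxy'
      rwa [← hall] at this
    · intro x
      refine ⟨univ.filter fun y => foldedFiveCube.Adj x y, ?_, by simp⟩
      revert x
      decide +kernel
  · right
    push Not at hfold
    refine nonempty_iso_of_injective_table S.rect.conn S.rect.reg _ _ _ hT hr hc hfold cubeCode
      (by decide +kernel) (by decide +kernel) ?_
    intro x
    refine ⟨univ.filter fun y => fiveCube.Adj x y, ?_, by simp⟩
    revert x
    decide +kernel

end Triangles

/-! ### Assembling the cases -/

section Classification

variable {V : Type*} [Fintype V] [DecidableEq V] {G : SimpleGraph V} [DecidableRel G.Adj]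
  {s : V → V → ℤ}

lemma exists_perm_of_nodup {i j k l m : Fin 5} (h : [i, j, k, l, m].Nodup) :
    ∃ σ : Equiv.Perm (Fin 5), σ 0 = i ∧ σ 1 = j ∧ σ 2 = k ∧ σ 3 = l ∧ σ 4 = m := by
  have hinj : Function.Injective ![i, j, k, l, m] := List.nodup_ofFn.1 (by simpa using h)
  exact ⟨Equiv.ofBijective _ (Finite.injective_iff_bijective.1 hinj), rfl, rfl, rfl, rfl, rfl⟩

/-- The longest cycle drawn by the columns at a single vertex decides the graph; a permutation of
the labels puts it in standard position. -/
lemma SignedRectagraph.classification (R : SignedRectagraph G s) :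
    Nonempty (G ≃g foldedFiveCube) ∨ Nonempty (G ≃g prism fanoNonincidence) ∨
      Nonempty (G ≃g fiveCube) ∨ Nonempty (G ≃g bipartiteDouble icosahedron) := by
  obtain ⟨v⟩ := R.conn.nonempty
  obtain ⟨a, S⟩ := exists_isStar R v
  by_cases hno : ∀ c i j k l m, [i, j, k, l, m].Nodup → ¬ Pent G v a c i j k l m
  · by_cases hno' : ∀ c i j k l m, [i, j, k, l, m].Nodup → ¬ Quad G v a c i j k l
    · have := nonempty_iso_of_tri S fun i j k l m h => S.exists_tri_of_not_quad hno hno' h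
      tauto
    · push Not at hno'
      obtain ⟨c, i, j, k, l, m, hnd, hq⟩ := hno'
      obtain ⟨σ, rfl, rfl, rfl, rfl, rfl⟩ := exists_perm_of_nodup hnd
      refine Or.inr (Or.inl (nonempty_iso_of_quad (S.comp σ) (fun c i j k l m h hp => ?_) hq))
      exact hno c (σ i) (σ j) (σ k) (σ l) (σ m) (by simpa using h.map σ.injective) hp
  · push Not at hno
    obtain ⟨c, i, j, k, l, m, hnd, hp⟩ := hno
    obtain ⟨σ, rfl, rfl, rfl, rfl, rfl⟩ := exists_perm_of_nodup hnd
    exact Or.inr (Or.inr (Or.inr (nonempty_iso_of_pent (S.comp σ) hp)))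

end Classification

end SkewEnergy

theorem theorem2p6 {V : Type*} [Fintype V] [DecidableEq V] (G : SimpleGraph V)
    [DecidableRel G.Adj] (σ : SkewEnergy.GraphOrientation G)
    (hconn : G.Connected) (hreg : G.IsRegularOfDegree 5)
    (hopt : SkewEnergy.HasOptimumSkewEnergy σ) (htri : G.CliqueFree 3) :
    (∃ t : ℕ, 2 ≤ t ∧ Nonempty (G ≃g SkewEnergy.tripleRing t)) ∨
    (∃ m : ℕ, 4 ≤ m ∧ Nonempty (G ≃g SkewEnergy.prism (SkewEnergy.doubledCycle m))) ∨
    (∃ k : ℕ, 4 ≤ k ∧ Nonempty (G ≃g SkewEnergy.antipodalDoubledCycle k)) ∨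
    Nonempty (G ≃g SkewEnergy.foldedFiveCube) ∨
    Nonempty (G ≃g SkewEnergy.prism SkewEnergy.fanoNonincidence) ∨
    Nonempty (G ≃g SkewEnergy.fiveCube) ∨
    Nonempty (G ≃g SkewEnergy.bipartiteDouble SkewEnergy.icosahedron) := by
  have := hconn.nonempty
  obtain ⟨s, hs⟩ := SkewEnergy.exists_isOrthogonalSigning G σ 5 hreg hopt
  by_cases huniq : ∀ v w u, SkewEnergy.Mate G v w → SkewEnergy.Mate G v u → w = u
  · by_cases hmate : ∃ v w, SkewEnergy.Mate G v w
    · obtain ⟨v, w, h⟩ := hmate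
      obtain ⟨μ, ν, M⟩ := SkewEnergy.exists_mateStructure hs hconn hreg huniq h
      rcases M.classification hconn htri with h | h
      · exact Or.inr (Or.inl h)
      · exact Or.inr (Or.inr (Or.inl h))
    · push Not at hmate
      have R : SkewEnergy.SignedRectagraph G s := ⟨hconn, hreg, htri, hs, hmate⟩
      exact Or.inr (Or.inr (Or.inr R.classification))
  · push Not at huniq
    obtain ⟨v, w, u, hw, hu, hne⟩ := huniq
    rcases SkewEnergy.nonempty_iso_of_two_mates hs hconn hreg htri hw.1 hu.1 hne hw.2 hu.2
      with h | h
    -- Only the ring with `t = 2` arises here, and below it the prism over `U_4 = K_{4,4}`.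
    · exact Or.inl ⟨2, le_rfl, h⟩
    · exact Or.inr (Or.inl ⟨4, le_rfl, h⟩)
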